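/- Let $d\ge 1$. Conventions: $\hat u(\xi)=\int_{\mathbb R^d} e^{-2\pi i\xi\cdot x}u(x)\,dx$; $\|\cdot\|$ is the $L^2(\mathbb R^d)$ norm; $\|u\|_{(s)}=\big(\int_{\mathbb R^d}|\hat u(\xi)|^2(1+4\pi^2|\xi|^2)^s\,d\xi\big)^{1/2}$ for $s\in\mathbb R$; for $s\geq 0$, $|F|_s=\|F\|_\infty+\sup_{|\sigma|=\lfloor s\rfloor}\sup_{x\ne y}\frac{|D^\sigma F(x)-D^\sigma F(y)|}{|x-y|^{s-\lfloor s\rfloor}}$; for a vector field $V=\sum_l V^l\partial_l$, $|V|_s=\max_l|V^l|_s$. For $k\ge 1$ put $\|\,|(V^l)^{(k)}u|\,\|_{(s)}=\max_{|\sigma|=k}\|\,|(D^\sigma V^l)u|\,\|_{(s)}$, and write $''$, $'''$ for $^{(2)}$, $^{(3)}$. For $t>0$ let $G_t(x)=\frac{1}{(4\pi)^{t/2}\Gamma(t/2)}\int_0^\infty e^{-\pi|x|^2/w}e^{-w/4\pi}w^{(-d+t)/2}\frac{dw}{w}$, $x\neq 0$, be the Bessel kernel, and for $s>0$ let $\mathcal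 J_s$ be the set of finite real linear combinations of the functions $x^\sigma D^\tau G_t(x)$ on $\mathbb R^d\setminus\{0\}$, with $t>0$ and multi-indices $\sigma,\tau$ such that $|\sigma|-|\tau|+t\ge s$. Let $\alpha\in(1,2)$, $J\in\mathcal J_\alpha$, $1\le i,j\le d$, and let $a,b:\mathbb R^d\to\mathbb R$ be bounded $C^\infty$ functions, where every partial derivative of $a$ has at most polynomial growth. Put $$Mu=a\,\big((b\,\partial_i\partial_j u)*J\big).$$ Let $\beta>0$ with $\alpha+\beta>2$, let $Q\subset\mathbb R^d$ be compact, and let $\gamma\in(2-\alpha,1)$. Then for every $R\ge 0$ there are constants $C_1,C_2$, depending only on $R$ and on $d,\alpha,J,a,b,i,j,\beta,Q,\gamma$, such that for every real vector field $V=\sum_l V^l\partial_l$ with Schwartz coefficients and every $u\in C_0^\infty(\mathbb R^d;\mathbb C)$ supported in $Q$, the following hold. If $|V|_{1+\gamma}\le R$, then $[V,M]u$ is integrable and $$\|[V,M]u\|_{(-\beta)}\le C_1\Big[\|u\|+\max_{l}\|\,|(V^{l})''u|\,\|_{(-\alpha-\beta+1)}+\max_{l}\|\,|(V^{l})'''u|\,\|_{(-\alpha-\beta)}\Big].$$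 If $|V|_{2+\gamma}\le R$, then $[V,[V,M]]u$ is integrable and $$\|[V,[V,M]]u\|_{(-\beta)}\le C_2\Big[\|u\|+\max_{l}\|\,|(V^{l})'''u|\,\|_{(-\alpha-\beta+1)}+\max_{l}\|\,|(V^{l})^{(4)}u|\,\|_{(-\alpha-\beta)}\Big].$$ -/

import Mathlib

open MeasureTheory
open scoped ENNReal NNReal ContDiff FourierTransform SchwartzMap Convolution

noncomputable section

/-- Euclidean space `ℝ^d`. -/
abbrev Rd (d : ℕ) : Type := EuclideanSpace ℝ (Fin d)

/-- The partial derivative `∂_i f`. -/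
def pderivAt {d : ℕ} {F : Type*} [NormedAddCommGroup F] [NormedSpace ℝ F]
    (i : Fin d) (f : Rd d → F) : Rd d → F :=
  fun x => fderiv ℝ f x (EuclideanSpace.single i 1)

/-- The iterated partial derivative `D^σ f = ∂_{i₁} ⋯ ∂_{i_k} f`, for the multi-index
`σ = (i₁, …, i_k)` written as a list; its order `|σ|` is the length of the list. -/
def multiDeriv {d : ℕ} {F : Type*} [NormedAddCommGroup F] [NormedSpace ℝ F] :
    List (Fin d) → (Rd d → F) → Rd d → F
  | [], f => f
  | i :: σ, f => pderivAt i (multiDeriv σ f)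

/-- The monomial `x^σ = x^{i₁} ⋯ x^{i_k}` for `σ = (i₁, …, i_k)`. -/
def multiMonomial {d : ℕ} (σ : List (Fin d)) (x : Rd d) : ℝ :=
  (σ.map fun i => x i).prod

/-- The Bessel kernel `G_s` on `ℝ^d ∖ {0}`, whose Fourier transform is `(1 + 4π²|ξ|²)^{-s/2}`. -/
def besselKernel (d : ℕ) (s : ℝ) (x : Rd d) : ℝ :=
  1 / (4 * Real.pi) ^ (s / 2) * (1 / Real.Gamma (s / 2)) *
    ∫ w in Set.Ioi (0 : ℝ),
      Real.exp (-Real.pi * ‖x‖ ^ 2 / w) * Real.exp (-w / (4 * Real.pi)) *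
        w ^ ((-(d : ℝ) + s) / 2) * w⁻¹

/-- The class `𝒥_s` of kernels: finite real linear combinations, on `ℝ^d ∖ {0}`, of functions
`x^σ D^τ G_t(x)` with `t > 0` and `|σ| - |τ| + t ≥ s`. The value at the origin is irrelevant. -/
def kernelClass (d : ℕ) (s : ℝ) : Set (Rd d → ℝ) :=
  {J | ∃ (n : ℕ) (c t : Fin n → ℝ) (σ τ : Fin n → List (Fin d)),
      (∀ k, 0 < t k ∧ s ≤ ((σ k).length : ℝ) - ((τ k).length : ℝ) + t k) ∧
      ∀ x : Rd d, x ≠ 0 →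
        J x = ∑ k, c k * (multiMonomial (σ k) x * multiDeriv (τ k) (besselKernel d (t k)) x)}

/-- The Sobolev norm `‖f‖_{(s)} = (∫ |f̂(ξ)|² (1 + 4π²|ξ|²)^s dξ)^{1/2}`, with values in `[0, ∞]`,
for integrable `f`. -/
def sobolevNorm {d : ℕ} (s : ℝ) (f : Rd d → ℂ) : ℝ≥0∞ :=
  (∫⁻ ξ, ‖𝓕 f ξ‖ₑ ^ 2 * ENNReal.ofReal ((1 + 4 * Real.pi ^ 2 * ‖ξ‖ ^ 2) ^ s)) ^ (1 / 2 : ℝ)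

/-- The Hölder norm `|f|_s`: the supremum of `|f|` plus the largest `(s - ⌊s⌋)`-Hölder seminorm of
a partial derivative of order `⌊s⌋`. -/
def holderNormOf {d : ℕ} (s : ℝ) (f : Rd d → ℝ) : ℝ≥0∞ :=
  (⨆ x, ‖f x‖ₑ) +
    ⨆ σ : {σ : List (Fin d) // σ.length = ⌊s⌋₊},
      eHolderNorm (s - (⌊s⌋₊ : ℝ)).toNNReal (multiDeriv σ.1 f)

/-- For a vector field `V = V^l ∂_l`, `|V|_s = sup_l |V^l|_s`. -/
def fieldHolderNorm {d : ℕ} (s : ℝ) (V : Fin d → 𝓢(Rd d, ℝ)) : ℝ≥0∞ :=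
  ⨆ l, holderNormOf s (V l)

/-- The first order operator `V u = V^l ∂_l u`. -/
def fieldOp {d : ℕ} (V : Fin d → 𝓢(Rd d, ℝ)) (u : Rd d → ℂ) : Rd d → ℂ :=
  fun x => ∑ l, V l x • pderivAt l u x

/-- The operator `M u = a (b ∂_i ∂_j u * J)`. -/
def kernelOp {d : ℕ} (a b J : Rd d → ℝ) (i j : Fin d) (u : Rd d → ℂ) : Rd d → ℂ :=
  fun x => a x •
    ((fun y => b y • pderivAt i (pderivAt j u) y)
      ⋆[ContinuousLinearMap.mul ℝ ℂ, volume] (fun z => (J z : ℂ))) x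

/-- The commutator `[A, B] = AB - BA` of two operators on functions. -/
def opComm {d : ℕ} (A B : (Rd d → ℂ) → Rd d → ℂ) (u : Rd d → ℂ) : Rd d → ℂ :=
  fun x => A (B u) x - B (A u) x

/-- `max_l ‖ |(V^l)^{(k)} u| ‖_{(s)}`: the maximum over the components `V^l` of `V` and over all
partial derivatives `D^σ` of order `k`. -/
def derivSobolevNorm {d : ℕ} (k : ℕ) (s : ℝ) (V : Fin d → 𝓢(Rd d, ℝ)) (u : Rd d → ℂ) : ℝ≥0∞ :=
  ⨆ l, ⨆ σ : {σ : List (Fin d) // σ.length = k},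
    sobolevNorm s (fun x => (‖multiDeriv σ.1 (V l) x • u x‖ : ℂ))

end

/-! The estimates hold with `‖u‖` alone on the right; the terms with derivatives of `V` are simply
added at the end. Heuristically `M` has order `2 - α`, and commuting with a vector field does not
raise the order, so both commutators should map `L²` to `H^{-θ}` as soon as `θ > 2 - α`. The proof
takes `θ = min β γ`, which is at most `γ` so that the Hölder regularity of `V` suffices, and at most
`β` so that `H^{-θ}` controls `H^{-β}`.

The singular kernel is never handled directly. By its Gaussian integral formula the Bessel kernel is
a superposition of dilations; derivatives and monomials preserve this form, so off the origin `J` is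
a finite sum of integrals `∫ w^s e^{-w/4π} h(w^{-1/2} z) dw` with `h` Schwartz and `s ≥ (α - d)/2 -
1` (`exists_scaleIntegral_of_mem_kernelClass`). It is enough to bound the commutator with kernel
`h_r(z) = h(z/r)` at each scale `r = √w` by `r^{d+θ-2}`, up to powers of `1 + r`, and to integrate
in `w`. Convergence at `w = 0` is exactly `α + θ > 2`.

At a fixed scale the commutator is an integral operator with a smooth kernel, a sum of terms `B(x,y)
(D^ν h_r)(x-y)`. Differentiating `P(x-y)` along `V_x + V_y` produces `(V^l(x) - V^l(y)) ∂_l P(x-y)`: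
each new derivative of the kernel comes with one more order of vanishing of the coefficient on the
diagonal. Hence `|ν| ≤ n + 2` persists, where `n` is the order of vanishing of `B`
(`CommutatorKernel.kernelLie`).

Taylor expansion of `B` at `y` gives a homogeneous polynomial of degree `n` in `z = x - y` with an
error `O(|z|^{n+θ})`. The error is bounded on `L²` by Young's inequality, with a moment of size
`r^{d+θ-2}`. A top-order polynomial term is convolution with `z^μ D^ν h_r`, `|ν| = |μ| + 2`, which
has mean zero by integration by parts; its Fourier transform is therefore at most `|ξ|^θ` times a
`θ`-moment of the same size, and the weight of `H^{-θ}` absorbs `|ξ|^θ` (`sobolevNorm_le_of_kernel`,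
`CommutatorKernel.exists_sobolevNorm_le`).

The passage back from Schwartz kernels to `J` uses that the Fourier transform of the commutator is
`∫ k(z) m(ξ,z) dz` with a bounded symbol `m` independent of the kernel `k`, so that Fubini and
Minkowski's inequality apply (`exists_sobolevNorm_le_of_mem_kernelClass`). -/

/-! ### Minkowski, Young, and mean-zero convolutions from `L²` to `H^{-θ}`. -/

section FunctionalAnalysis

/-- Minkowski's integral inequality in `L²`. -/
theorem lintegral_sq_lintegral_le {α β : Type*} [MeasurableSpace α] [MeasurableSpace β]
    {μ : Measure α} {ν : Measure β} [SFinite μ] [SFinite ν] {G : α → β → ℝ≥0∞}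
    (hG : Measurable (Function.uncurry G)) :
    ∫⁻ y, (∫⁻ x, G x y ∂μ) ^ 2 ∂ν ≤ (∫⁻ x, (∫⁻ y, G x y ^ 2 ∂ν) ^ (1 / 2 : ℝ) ∂μ) ^ 2 := by
  have hx : ∀ x, Measurable (G x) := fun x => hG.comp measurable_prodMk_left
  have hy : ∀ y, Measurable fun x => G x y := fun y => hG.comp measurable_prodMk_right
  have hN : Measurable fun x => (∫⁻ y, G x y ^ 2 ∂ν) ^ (1 / 2 : ℝ) :=
    (Measurable.lintegral_prod_right (hG.pow_const 2)).pow_const _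
  -- Once the square is a double integral over `x, x'`, Tonelli brings the `y`-integral innermost,
  -- where Cauchy–Schwarz separates the two factors.
  calc ∫⁻ y, (∫⁻ x, G x y ∂μ) ^ 2 ∂ν
      = ∫⁻ y, ∫⁻ x, ∫⁻ x', G x y * G x' y ∂μ ∂μ ∂ν := by
        refine lintegral_congr fun y => ?_
        simp_rw [lintegral_const_mul _ (hy y)]
        rw [lintegral_mul_const _ (hy y), sq]
    _ = ∫⁻ x, ∫⁻ y, ∫⁻ x', G x y * G x' y ∂μ ∂ν ∂μ := by
        refine lintegral_lintegral_swap (Measurable.aemeasurable ?_)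
        refine Measurable.lintegral_prod_right'
          (f := fun p : (β × α) × α => G p.1.2 p.1.1 * G p.2 p.1.1) ?_
        exact (hG.comp (by fun_prop : Measurable fun p : (β × α) × α => (p.1.2, p.1.1))).mul
          (hG.comp (by fun_prop : Measurable fun p : (β × α) × α => (p.2, p.1.1)))
    _ = ∫⁻ x, ∫⁻ x', ∫⁻ y, G x y * G x' y ∂ν ∂μ ∂μ := by
        refine lintegral_congr fun x => lintegral_lintegral_swap (Measurable.aemeasurable ?_)
        exact (hG.comp (by fun_prop : Measurable fun p : β × α => (x, p.1))).mul
          (hG.comp (by fun_prop : Measurable fun p : β × α => (p.2, p.1)))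
    _ ≤ ∫⁻ x, ∫⁻ x', (∫⁻ y, G x y ^ 2 ∂ν) ^ (1 / 2 : ℝ) *
          (∫⁻ y, G x' y ^ 2 ∂ν) ^ (1 / 2 : ℝ) ∂μ ∂μ := by
        refine lintegral_mono fun x => lintegral_mono fun x' => ?_
        have := ENNReal.lintegral_mul_le_Lp_mul_Lq ν Real.HolderConjugate.two_two
          (hx x).aemeasurable (hx x').aemeasurable
        simpa using this
    _ = _ := by
        simp_rw [lintegral_const_mul _ hN]
        rw [lintegral_mul_const _ hN, sq]

/-- The `L²` norm as a square root of a lower integral. -/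
theorem eLpNorm_two_eq {α E : Type*} [MeasurableSpace α] {μ : Measure α} [NormedAddCommGroup E]
    (f : α → E) : eLpNorm f 2 μ = (∫⁻ x, ‖f x‖ₑ ^ 2 ∂μ) ^ (1 / 2 : ℝ) := by
  rw [eLpNorm_eq_lintegral_rpow_enorm_toReal (by norm_num) (by norm_num)]
  simp

theorem ENNReal.rpow_half_le_iff {a b : ℝ≥0∞} : a ^ (1 / 2 : ℝ) ≤ b ↔ a ≤ b ^ 2 := by
  rw [one_div, ENNReal.rpow_inv_le_iff (by norm_num)]
  norm_num

variable {d : ℕ}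

/-- Young's inequality `L¹ * L² ⊆ L²` for functions dominated by a convolution. -/
theorem eLpNorm_two_le_of_le_convolution {E F : Type*} [NormedAddCommGroup E]
    [NormedAddCommGroup F] {H : Rd d → E} {e : Rd d → ℝ≥0∞} {u : Rd d → F} (he : Measurable e)
    (hu : Measurable fun x => ‖u x‖ₑ) (h : ∀ x, ‖H x‖ₑ ≤ ∫⁻ y, e (x - y) * ‖u y‖ₑ) :
    eLpNorm H 2 volume ≤ (∫⁻ z, e z) * eLpNorm u 2 volume := by
  rw [eLpNorm_two_eq, ENNReal.rpow_half_le_iff]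
  have hm : Measurable (Function.uncurry fun (z x : Rd d) => e z * ‖u (x - z)‖ₑ) :=
    (he.comp measurable_fst).mul (hu.comp (measurable_snd.sub measurable_fst))
  calc ∫⁻ x, ‖H x‖ₑ ^ 2 ≤ ∫⁻ x, (∫⁻ z, e z * ‖u (x - z)‖ₑ) ^ 2 := by
        refine lintegral_mono fun x => ?_
        gcongr
        refine (h x).trans_eq ?_
        rw [← lintegral_sub_left_eq_self _ x]
        simp
    _ ≤ _ := lintegral_sq_lintegral_le hm
    _ ≤ _ := by
        gcongr
        rw [← lintegral_mul_const _ he]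
        refine lintegral_mono fun z => ?_
        simp only [mul_pow]
        have hz : Measurable fun y => ‖u (y - z)‖ₑ ^ 2 :=
          (hu.comp (measurable_sub_const z)).pow_const 2
        rw [lintegral_const_mul _ hz, ENNReal.mul_rpow_of_nonneg _ _ (by norm_num)]
        refine mul_le_mul' (by rw [← ENNReal.rpow_natCast, ← ENNReal.rpow_mul]; norm_num) ?_
        rw [eLpNorm_two_eq, lintegral_sub_right_eq_self (fun x => ‖u x‖ₑ ^ 2) z]

/-- The weight `(1 + 4π²|ξ|²)^{s/2}` of the Sobolev norm. -/
noncomputable def sobolevWeight (s : ℝ) (ξ : Rd d) : ℝ := (1 + 4 * Real.pi ^ 2 * ‖ξ‖ ^ 2) ^ (s / 2)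

theorem one_le_sobolevBase (ξ : Rd d) : 1 ≤ 1 + 4 * Real.pi ^ 2 * ‖ξ‖ ^ 2 :=
  le_add_of_nonneg_right (by positivity)

theorem sobolevWeight_nonneg (s : ℝ) (ξ : Rd d) : 0 ≤ sobolevWeight s ξ := by
  have := one_le_sobolevBase ξ
  unfold sobolevWeight; positivity

@[fun_prop] theorem continuous_sobolevWeight (s : ℝ) :
    Continuous (sobolevWeight s : Rd d → ℝ) := by
  unfold sobolevWeight
  refine Continuous.rpow_const (by fun_prop) fun ξ => Or.inl ?_
  have := one_le_sobolevBase ξ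
  positivity

theorem sobolevWeight_le_one {s : ℝ} (hs : s ≤ 0) (ξ : Rd d) : sobolevWeight s ξ ≤ 1 :=
  Real.rpow_le_one_of_one_le_of_nonpos (one_le_sobolevBase ξ) (by linarith)

/-- Since `‖ξ‖² ≤ 1 + 4π²‖ξ‖²`, the negative weight pays for a factor `‖ξ‖ ^ θ`; this is where the
loss of `θ` derivatives is spent. -/
theorem sobolevWeight_neg_mul_le_one {θ : ℝ} (hθ : 0 ≤ θ) (ξ : Rd d) :
    sobolevWeight (-θ) ξ * ‖ξ‖ ^ θ ≤ 1 := by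
  have h1 := one_le_sobolevBase ξ
  have h2 : ‖ξ‖ ^ θ ≤ (1 + 4 * Real.pi ^ 2 * ‖ξ‖ ^ 2) ^ (θ / 2) := by
    have : ‖ξ‖ ^ θ = (‖ξ‖ ^ 2) ^ (θ / 2) := by
      rw [← Real.rpow_natCast, ← Real.rpow_mul (norm_nonneg _)]; congr 1; push_cast; ring
    rw [this]
    refine Real.rpow_le_rpow (by positivity) ?_ (by positivity)
    have : 1 ≤ Real.pi := by linarith [Real.pi_gt_three]
    nlinarith [sq_nonneg ‖ξ‖, mul_nonneg (sub_nonneg.2 (one_le_pow₀ this (n := 2))) (sq_nonneg ‖ξ‖)]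
  have h3 : sobolevWeight (-θ) ξ = ((1 + 4 * Real.pi ^ 2 * ‖ξ‖ ^ 2) ^ (θ / 2))⁻¹ := by
    unfold sobolevWeight
    rw [← Real.rpow_neg (by positivity)]; congr 1; ring
  rw [h3, inv_mul_le_iff₀ (by positivity)]
  simpa using h2

theorem sobolevNorm_eq (s : ℝ) (f : Rd d → ℂ) :
    sobolevNorm s f = eLpNorm (fun ξ => sobolevWeight s ξ • 𝓕 f ξ) 2 volume := by
  rw [eLpNorm_two_eq, sobolevNorm]
  congr 1
  refine lintegral_congr fun ξ => ?_
  rw [enorm_smul, mul_pow, mul_comm]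
  congr 1
  have h1 := one_le_sobolevBase ξ
  rw [Real.enorm_of_nonneg (sobolevWeight_nonneg s ξ), ← ENNReal.ofReal_pow (sobolevWeight_nonneg s ξ),
    sobolevWeight, ← Real.rpow_mul_natCast (by positivity)]
  congr 2; push_cast; ring

theorem sobolevNorm_mono {s t : ℝ} (h : s ≤ t) (f : Rd d → ℂ) :
    sobolevNorm s f ≤ sobolevNorm t f := by
  unfold sobolevNorm
  gcongr with ξ
  exact one_le_sobolevBase ξ

theorem eLpNorm_fourier_schwartz (f : 𝓢(Rd d, ℂ)) :
    eLpNorm (𝓕 (f : Rd d → ℂ)) 2 volume = eLpNorm f 2 volume := by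
  have h := SchwartzMap.norm_fourier_toL2_eq f
  rw [SchwartzMap.norm_toLp, SchwartzMap.norm_toLp] at h
  exact (ENNReal.toReal_eq_toReal_iff' ((𝓕 f).memLp 2 volume).2.ne (f.memLp 2 volume).2.ne).1 h

/-- A vanishing integral improves the trivial bound on the Fourier transform near the origin. -/
theorem norm_fourier_le_of_integral_eq_zero {θ : ℝ} (h0 : 0 ≤ θ) (h1 : θ ≤ 1) {Q : Rd d → ℂ}
    (hQ : Integrable Q) (hQθ : Integrable fun z => ‖z‖ ^ θ * ‖Q z‖) (hint : ∫ z, Q z = 0)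
    (ξ : Rd d) :
    ‖𝓕 Q ξ‖ ≤ 4 * Real.pi * ‖ξ‖ ^ θ * ∫ z, ‖z‖ ^ θ * ‖Q z‖ := by
  -- Interpolation between the bounds `|s|` (used for `|s| ≤ 1`) and `2` (used for `|s| ≥ 1`).
  have key : ∀ s : ℝ, ‖Complex.exp (s * Complex.I) - 1‖ ≤ 2 * |s| ^ θ := by
    intro s
    rcases le_total |s| 1 with hs | hs
    · have h2 : ‖Complex.exp (s * Complex.I) - 1‖ ≤ |s| := by
        have := Real.norm_exp_I_mul_ofReal_sub_one_le (x := s)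
        rwa [mul_comm, Real.norm_eq_abs] at this
      have : |s| ≤ |s| ^ θ := by
        rcases (abs_nonneg s).eq_or_lt with h | h
        · rw [← h]; positivity
        · simpa using Real.rpow_le_rpow_of_exponent_ge h hs h1
      linarith [abs_nonneg s]
    · have h2 : ‖Complex.exp (s * Complex.I) - 1‖ ≤ 2 := by
        refine (norm_sub_le _ _).trans ?_
        rw [Complex.norm_exp_ofReal_mul_I]; norm_num
      linarith [Real.one_le_rpow hs h0]
  have hI : Integrable fun z => Complex.exp (↑(-2 * Real.pi * inner ℝ z ξ) * Complex.I) • Q z := by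
    have := (Real.fourierIntegral_convergent_iff (f := Q) ξ).2 hQ
    simpa [Real.fourierChar_apply, Circle.smul_def] using this
  -- Mean zero allows the constant `1` to be subtracted from the character.
  have heq : 𝓕 Q ξ = ∫ z, (Complex.exp (↑(-2 * Real.pi * inner ℝ z ξ) * Complex.I) - 1) * Q z := by
    rw [Real.fourier_eq']
    simp only [sub_mul, one_mul]
    refine Eq.trans ?_ (integral_sub hI hQ).symm
    rw [hint, sub_zero]
  rw [heq, ← integral_const_mul]
  refine norm_integral_le_of_norm_le (hQθ.const_mul _) (Filter.Eventually.of_forall fun z => ?_)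
  rw [norm_mul]
  have h3 : |-2 * Real.pi * inner ℝ z ξ| ^ θ ≤ 2 * Real.pi * (‖z‖ ^ θ * ‖ξ‖ ^ θ) := by
    have hpi : (1:ℝ) ≤ 2 * Real.pi := by linarith [Real.pi_gt_three]
    calc |-2 * Real.pi * inner ℝ z ξ| ^ θ ≤ (2 * Real.pi * (‖z‖ * ‖ξ‖)) ^ θ := by
          refine Real.rpow_le_rpow (abs_nonneg _) ?_ h0
          rw [abs_mul]
          gcongr
          · rw [abs_mul, abs_of_pos Real.pi_pos]; norm_num
          · exact abs_real_inner_le_norm z ξ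
      _ = (2 * Real.pi) ^ θ * (‖z‖ ^ θ * ‖ξ‖ ^ θ) := by
          rw [Real.mul_rpow (by positivity) (by positivity),
            Real.mul_rpow (norm_nonneg z) (norm_nonneg ξ)]
      _ ≤ _ := by
          gcongr
          simpa using Real.rpow_le_rpow_of_exponent_le hpi h1
  calc _ ≤ 2 * |-2 * Real.pi * inner ℝ z ξ| ^ θ * ‖Q z‖ := by gcongr; exact key _
    _ ≤ 2 * (2 * Real.pi * (‖z‖ ^ θ * ‖ξ‖ ^ θ)) * ‖Q z‖ := by gcongr
    _ = _ := by ring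

/-- A real Schwartz function as a complex one. -/
noncomputable def schwartzOfReal (q : 𝓢(Rd d, ℝ)) : 𝓢(Rd d, ℂ) :=
  SchwartzMap.postcompCLM Complex.ofRealCLM q

@[simp] theorem schwartzOfReal_apply (q : 𝓢(Rd d, ℝ)) (x : Rd d) :
    schwartzOfReal q x = (q x : ℂ) := rfl

/-- Convolution of a Schwartz function with a real Schwartz kernel. -/
theorem exists_schwartz_convolution (q : 𝓢(Rd d, ℝ)) (f : 𝓢(Rd d, ℂ)) :
    ∃ P : 𝓢(Rd d, ℂ), (∀ x, P x = ∫ y, q (x - y) • f y) ∧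
      ∀ ξ, 𝓕 (P : Rd d → ℂ) ξ = 𝓕 (schwartzOfReal q : Rd d → ℂ) ξ * 𝓕 (f : Rd d → ℂ) ξ := by
  refine ⟨SchwartzMap.convolution (ContinuousLinearMap.mul ℂ ℂ) (schwartzOfReal q) f,
    fun x => ?_, fun ξ => ?_⟩
  · rw [SchwartzMap.convolution_apply, convolution_eq_swap]
    refine integral_congr_ae (Filter.Eventually.of_forall fun y => ?_)
    simp
  · rw [← Real.fourier_mul_convolution_eq (schwartzOfReal q).integrable f.integrable ξ]
    have h : ⇑(SchwartzMap.convolution (ContinuousLinearMap.mul ℂ ℂ) (schwartzOfReal q) f) =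
        (schwartzOfReal q : Rd d → ℂ) ⋆[ContinuousLinearMap.mul ℂ ℂ, volume] (f : Rd d → ℂ) :=
      funext fun x => SchwartzMap.convolution_apply _ _ _ _
    rw [h]

/-- Convolution with a kernel of mean zero maps `L²` to `H^{-θ}`. -/
theorem eLpNorm_sobolevWeight_fourier_mul_le {θ : ℝ} (h0 : 0 ≤ θ) (h1 : θ ≤ 1) (q : 𝓢(Rd d, ℝ))
    (hq : ∫ z, q z = 0) (hqθ : Integrable fun z => ‖z‖ ^ θ * |q z|) (f : 𝓢(Rd d, ℂ)) :
    eLpNorm (fun ξ => sobolevWeight (-θ) ξ •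
      (𝓕 (schwartzOfReal q : Rd d → ℂ) ξ * 𝓕 (f : Rd d → ℂ) ξ)) 2 volume ≤
      ENNReal.ofReal (4 * Real.pi * ∫ z, ‖z‖ ^ θ * |q z|) * eLpNorm f 2 volume := by
  set I := ∫ z, ‖z‖ ^ θ * |q z|
  have hI : 0 ≤ I := integral_nonneg fun z => by positivity
  rw [← eLpNorm_fourier_schwartz f]
  refine eLpNorm_le_mul_eLpNorm_of_ae_le_mul (Filter.Eventually.of_forall fun ξ => ?_) 2
  rw [norm_smul, norm_mul, ← mul_assoc]
  refine mul_le_mul_of_nonneg_right ?_ (norm_nonneg _)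
  rw [Real.norm_of_nonneg (sobolevWeight_nonneg _ _)]
  have h3 := norm_fourier_le_of_integral_eq_zero h0 h1 (Q := schwartzOfReal q)
    (schwartzOfReal q).integrable (by simpa using hqθ)
    (by simp only [schwartzOfReal_apply]; rw [integral_complex_ofReal, hq]; simp) ξ
  simp only [schwartzOfReal_apply, Complex.norm_real, Real.norm_eq_abs] at h3
  calc _ ≤ sobolevWeight (-θ) ξ * (4 * Real.pi * ‖ξ‖ ^ θ * I) :=
        mul_le_mul_of_nonneg_left h3 (sobolevWeight_nonneg _ _)
    _ = (sobolevWeight (-θ) ξ * ‖ξ‖ ^ θ) * (4 * Real.pi * I) := by ring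
    _ ≤ 1 * (4 * Real.pi * I) :=
        mul_le_mul_of_nonneg_right (sobolevWeight_neg_mul_le_one h0 ξ) (by positivity)
    _ = _ := one_mul _

theorem fourier_schwartz_sum_add {S : Type*} [Fintype S] {F E : 𝓢(Rd d, ℂ)} {P : S → 𝓢(Rd d, ℂ)}
    (h : F = (∑ s, P s) + E) (ξ : Rd d) :
    𝓕 (F : Rd d → ℂ) ξ = (∑ s, 𝓕 (P s : Rd d → ℂ) ξ) + 𝓕 (E : Rd d → ℂ) ξ := by
  have h2 := congrArg (FourierTransform.fourierCLM ℂ 𝓢(Rd d, ℂ)) h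
  rw [map_add, map_sum] at h2
  have h4 := congrArg (fun h : 𝓢(Rd d, ℂ) => h ξ) h2
  simpa [SchwartzMap.fourier_coe] using h4

theorem sobolevNorm_neg_le_eLpNorm {θ : ℝ} (h0 : 0 ≤ θ) (E : 𝓢(Rd d, ℂ)) :
    sobolevNorm (-θ) E ≤ eLpNorm E 2 volume := by
  rw [sobolevNorm_eq, ← eLpNorm_fourier_schwartz E]
  refine eLpNorm_mono fun ξ => ?_
  rw [norm_smul, Real.norm_of_nonneg (sobolevWeight_nonneg _ _)]
  exact mul_le_of_le_one_left (norm_nonneg _) (sobolevWeight_le_one (by linarith) ξ)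

theorem sobolevNorm_schwartz_le_sum_add (s : ℝ) {S : Type*} [Fintype S] {F E : 𝓢(Rd d, ℂ)}
    {P : S → 𝓢(Rd d, ℂ)} (h : F = (∑ i, P i) + E) :
    sobolevNorm s F ≤ (∑ i, sobolevNorm s (P i)) + sobolevNorm s E := by
  have hmeas : ∀ G : 𝓢(Rd d, ℂ), AEStronglyMeasurable
      (fun ξ => sobolevWeight s ξ • 𝓕 (G : Rd d → ℂ) ξ) volume := fun G =>
    ((continuous_sobolevWeight _).smul (𝓕 G).continuous).aestronglyMeasurable
  have hsplit : (fun ξ => sobolevWeight s ξ • 𝓕 (F : Rd d → ℂ) ξ) =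
      (∑ i, fun ξ => sobolevWeight s ξ • 𝓕 (P i : Rd d → ℂ) ξ) +
        fun ξ => sobolevWeight s ξ • 𝓕 (E : Rd d → ℂ) ξ := by
    ext ξ
    rw [fourier_schwartz_sum_add h]
    simp [Finset.mul_sum]
  simp only [sobolevNorm_eq]
  rw [hsplit]
  refine (eLpNorm_add_le (Finset.aestronglyMeasurable_sum _ fun s _ => hmeas _) (hmeas _)
    one_le_two).trans ?_
  gcongr
  exact eLpNorm_sum_le (fun s _ => hmeas _) one_le_two

theorem exists_schwartz_eq {u : Rd d → ℂ} (hu : ContDiff ℝ ∞ u) (hcs : HasCompactSupport u) :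
    ∃ f : 𝓢(Rd d, ℂ), (f : Rd d → ℂ) = u :=
  ⟨hcs.toSchwartzMap hu, rfl⟩

/-- An integral operator whose kernel is a sum of convolution kernels of mean zero, with bounded
coefficients, and of an error dominated by an integrable convolution kernel is bounded from `L²`
to `H^{-θ}`. -/
theorem sobolevNorm_le_of_kernel {θ : ℝ} (h0 : 0 ≤ θ) (h1 : θ ≤ 1) {Q : Set (Rd d)}
    {u : Rd d → ℂ} (hu : ContDiff ℝ ∞ u) (hcs : HasCompactSupport u) (huQ : tsupport u ⊆ Q)
    (F : 𝓢(Rd d, ℂ)) (κ : Rd d → Rd d → ℝ) (hκ : ∀ x, Continuous (κ x))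
    (hF : ∀ x, F x = ∫ y, κ x y • u y) {S : Type*} [Fintype S] (q : S → 𝓢(Rd d, ℝ))
    (g : S → Rd d → ℝ) (hg : ∀ s, ContDiff ℝ ∞ (g s)) {C : ℝ} (hC : 0 ≤ C)
    (hgC : ∀ s, ∀ y ∈ Q, |g s y| ≤ C) (hq : ∀ s, ∫ z, q s z = 0)
    (hqθ : ∀ s, Integrable fun z => ‖z‖ ^ θ * |q s z|) {e : Rd d → ℝ} (he : Continuous e)
    (he0 : ∀ z, 0 ≤ e z) (hei : Integrable e)
    (hE : ∀ x, ∀ y ∈ Q, |κ x y - ∑ s, q s (x - y) * g s y| ≤ e (x - y)) :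
    sobolevNorm (-θ) F ≤
      ENNReal.ofReal (∑ s, C * (4 * Real.pi * ∫ z, ‖z‖ ^ θ * |q s z|) + ∫ z, e z) *
        eLpNorm u 2 volume := by
  classical
  have hgu : ∀ s, ContDiff ℝ ∞ fun y => g s y • u y := fun s => (hg s).smul hu
  have hgucs : ∀ s, HasCompactSupport fun y => g s y • u y :=
    fun s => hcs.smul_left (f := g s)
  choose f hf' using fun s => exists_schwartz_eq (hgu s) (hgucs s)
  have hf : ∀ s y, f s y = g s y • u y := fun s y => congrFun (hf' s) y
  choose P hP hPf using fun s => exists_schwartz_convolution (q s) (f s)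
  -- The error is defined as a difference of Schwartz functions, so Plancherel and additivity of the
  -- Fourier transform apply to it directly; its kernel is identified afterwards.
  obtain ⟨E, hFE⟩ : ∃ E : 𝓢(Rd d, ℂ), F = (∑ s, P s) + E := ⟨F - ∑ s, P s, by simp⟩
  have hEle : eLpNorm E 2 volume ≤ ENNReal.ofReal (∫ z, e z) * eLpNorm u 2 volume := by
    rw [ofReal_integral_eq_lintegral_ofReal hei (Filter.Eventually.of_forall he0)]
    refine eLpNorm_two_le_of_le_convolution (he.measurable.ennreal_ofReal)
      hu.continuous.enorm.measurable fun x => ?_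
    have hx : E x = ∫ y, (κ x y - ∑ s, q s (x - y) * g s y) • u y := by
      have hi : ∀ (m : Rd d → ℝ), Continuous m → Integrable fun y => m y • u y := fun m hm =>
        (hm.smul hu.continuous).integrable_of_hasCompactSupport (hcs.smul_left (f := m))
      have hqc : ∀ s, Continuous fun y => q s (x - y) * g s y := fun s =>
        ((q s).continuous.comp (continuous_const.sub continuous_id)).mul (hg s).continuous
      simp only [sub_smul, Finset.sum_smul]
      rw [integral_sub (hi _ (hκ x)) (integrable_finsetSum _ fun s _ => hi _ (hqc s)),
        integral_finsetSum _ fun s _ => hi _ (hqc s), ← hF, hFE]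
      simp [hP, hf, mul_assoc]
    rw [hx]
    refine (enorm_integral_le_lintegral_enorm _).trans (lintegral_mono fun y => ?_)
    by_cases hy : y ∈ tsupport u
    · rw [enorm_smul]
      gcongr
      rw [Real.enorm_eq_ofReal_abs]
      exact ENNReal.ofReal_le_ofReal (hE x y (huQ hy))
    · simp [image_eq_zero_of_notMem_tsupport hy]
  have hmain : ∀ s, sobolevNorm (-θ) (P s) ≤
      ENNReal.ofReal (C * (4 * Real.pi * ∫ z, ‖z‖ ^ θ * |q s z|)) * eLpNorm u 2 volume := by
    intro s
    have h2 := eLpNorm_sobolevWeight_fourier_mul_le h0 h1 (q s) (hq s) (hqθ s) (f s)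
    simp only [← hPf] at h2
    rw [sobolevNorm_eq]
    refine h2.trans ?_
    have hI : 0 ≤ ∫ z, ‖z‖ ^ θ * |q s z| := integral_nonneg fun z => by positivity
    set I := 4 * Real.pi * ∫ z, ‖z‖ ^ θ * |q s z|
    have hI' : 0 ≤ I := by positivity
    rw [mul_comm C, ENNReal.ofReal_mul hI', mul_assoc]
    refine mul_le_mul' le_rfl ?_
    refine eLpNorm_le_mul_eLpNorm_of_ae_le_mul (Filter.Eventually.of_forall fun y => ?_) 2
    rw [hf, norm_smul, Real.norm_eq_abs]
    by_cases hy : y ∈ tsupport u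
    · gcongr
      exact hgC s y (huQ hy)
    · simp [image_eq_zero_of_notMem_tsupport hy]
  have hnn : ∀ s, 0 ≤ C * (4 * Real.pi * ∫ z, ‖z‖ ^ θ * |q s z|) := fun s => by
    have : 0 ≤ ∫ z, ‖z‖ ^ θ * |q s z| := integral_nonneg fun z => by positivity
    positivity
  refine (sobolevNorm_schwartz_le_sum_add (-θ) hFE).trans ?_
  rw [ENNReal.ofReal_add (Finset.sum_nonneg fun s _ => hnn s) (integral_nonneg he0), add_mul,
    ENNReal.ofReal_sum_of_nonneg fun s _ => hnn s, Finset.sum_mul]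
  exact add_le_add (Finset.sum_le_sum fun s _ => hmain s)
    ((sobolevNorm_neg_le_eLpNorm h0 E).trans hEle)

end FunctionalAnalysis

/-! ### Commutators of vector fields with integral operators. -/

section KernelCalculus

variable {d : ℕ}

theorem SchwartzMap.contDiff_infty {E F : Type*} [NormedAddCommGroup E] [NormedSpace ℝ E]
    [NormedAddCommGroup F] [NormedSpace ℝ F] (f : 𝓢(E, F)) : ContDiff ℝ ∞ f :=
  f.smooth ⊤

theorem ContDiff.pderivAt {F : Type*} [NormedAddCommGroup F] [NormedSpace ℝ F] {f : Rd d → F}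
    (hf : ContDiff ℝ ∞ f) (l : Fin d) : ContDiff ℝ ∞ (pderivAt l f) :=
  (hf.fderiv_right (by simp)).clm_apply contDiff_const

theorem ContDiff.multiDeriv {F : Type*} [NormedAddCommGroup F] [NormedSpace ℝ F] {f : Rd d → F}
    (hf : ContDiff ℝ ∞ f) (σ : List (Fin d)) : ContDiff ℝ ∞ (multiDeriv σ f) := by
  induction σ with
  | nil => exact hf
  | cons i σ ih => exact ih.pderivAt i

theorem ContDiff.pderivAt_fst {B : Rd d → Rd d → ℝ} (hB : ContDiff ℝ ∞ (Function.uncurry B))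
    (l : Fin d) :
    ContDiff ℝ ∞ (Function.uncurry fun x y => _root_.pderivAt l (fun x' => B x' y) x) := by
  refine ContDiff.clm_apply (ContDiff.fderiv (f := fun (p : Rd d × Rd d) x' => B x' p.2)
    (g := Prod.fst) (n := ∞) (m := ∞) ?_ contDiff_fst (by simp)) contDiff_const
  exact hB.comp (contDiff_snd.prodMk (contDiff_snd.comp contDiff_fst))

theorem ContDiff.pderivAt_snd {B : Rd d → Rd d → ℝ} (hB : ContDiff ℝ ∞ (Function.uncurry B))
    (l : Fin d) :
    ContDiff ℝ ∞ (Function.uncurry fun x y => _root_.pderivAt l (B x) y) := by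
  refine ContDiff.clm_apply (ContDiff.fderiv (f := fun (p : Rd d × Rd d) y' => B p.1 y')
    (g := Prod.snd) (n := ∞) (m := ∞) ?_ contDiff_snd (by simp)) contDiff_const
  exact hB.comp ((contDiff_fst.comp contDiff_fst).prodMk contDiff_snd)

theorem HasCompactSupport.pderivAt {F : Type*} [NormedAddCommGroup F] [NormedSpace ℝ F]
    {f : Rd d → F} (hf : HasCompactSupport f) (l : Fin d) : HasCompactSupport (pderivAt l f) :=
  (hf.fderiv ℝ).comp_left (g := fun L : Rd d →L[ℝ] F => L (EuclideanSpace.single l 1)) rfl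

theorem pderivAt_mul {f g : Rd d → ℝ} {x : Rd d} (hf : DifferentiableAt ℝ f x)
    (hg : DifferentiableAt ℝ g x) (l : Fin d) :
    pderivAt l (fun y => f y * g y) x = pderivAt l f x * g x + f x * pderivAt l g x := by
  simp only [pderivAt]
  rw [fderiv_fun_mul hf hg]
  simp only [add_apply, smul_apply, smul_eq_mul]
  ring

theorem pderivAt_smul {E : Type*} [NormedAddCommGroup E] [NormedSpace ℝ E] {f : Rd d → ℝ}
    {g : Rd d → E} {x : Rd d} (hf : DifferentiableAt ℝ f x)
    (hg : DifferentiableAt ℝ g x) (l : Fin d) :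
    pderivAt l (fun y => f y • g y) x = pderivAt l f x • g x + f x • pderivAt l g x := by
  simp only [pderivAt]
  rw [fderiv_fun_smul hf hg]
  simp [add_comm]

theorem pderivAt_add {E : Type*} [NormedAddCommGroup E] [NormedSpace ℝ E]
    {f g : Rd d → E} {x : Rd d} (hf : DifferentiableAt ℝ f x)
    (hg : DifferentiableAt ℝ g x) (l : Fin d) :
    pderivAt l (fun y => f y + g y) x = pderivAt l f x + pderivAt l g x := by
  simp only [pderivAt]
  rw [fderiv_fun_add hf hg]
  simp

theorem pderivAt_sub {E : Type*} [NormedAddCommGroup E] [NormedSpace ℝ E]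
    {f g : Rd d → E} {x : Rd d} (hf : DifferentiableAt ℝ f x)
    (hg : DifferentiableAt ℝ g x) (l : Fin d) :
    pderivAt l (fun y => f y - g y) x = pderivAt l f x - pderivAt l g x := by
  simp only [pderivAt]
  rw [fderiv_fun_sub hf hg]
  simp

theorem pderivAt_sum {E ι : Type*} [NormedAddCommGroup E] [NormedSpace ℝ E] (s : Finset ι)
    {f : ι → Rd d → E} {x : Rd d} (hf : ∀ i ∈ s, DifferentiableAt ℝ (f i) x) (l : Fin d) :
    pderivAt l (fun y => ∑ i ∈ s, f i y) x = ∑ i ∈ s, pderivAt l (f i) x := by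
  simp only [pderivAt]
  rw [fderiv_fun_sum hf]
  simp

@[simp] theorem pderivAt_const {E : Type*} [NormedAddCommGroup E] [NormedSpace ℝ E] (c : E)
    (x : Rd d) (l : Fin d) : pderivAt l (fun _ => c) x = 0 := by
  simp [pderivAt]

theorem pderivAt_comp_sub_const (f : Rd d → ℝ) (x y : Rd d) (l : Fin d) :
    pderivAt l (fun x' => f (x' - y)) x = pderivAt l f (x - y) := by
  simp only [pderivAt]
  rw [fderiv_comp_sub]

theorem pderivAt_comp_const_sub {f : Rd d → ℝ} (hf : Differentiable ℝ f) (x y : Rd d)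
    (l : Fin d) : pderivAt l (fun y' => f (x - y')) y = -pderivAt l f (x - y) := by
  have h := (hf (x - y)).hasFDerivAt.comp y ((hasFDerivAt_id (𝕜 := ℝ) y).const_sub x)
  simp only [pderivAt]
  rw [show (fun y' => f (x - y')) = f ∘ fun y' => x - y' from rfl]
  rw [h.fderiv]
  simp

/-- Integration by parts against a smooth compactly supported function. -/
theorem integral_smul_pderivAt {f : Rd d → ℝ} {u : Rd d → ℂ} (hf : ContDiff ℝ ∞ f)
    (hu : ContDiff ℝ ∞ u) (hcs : HasCompactSupport u) (l : Fin d) :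
    ∫ y, f y • pderivAt l u y = -∫ y, pderivAt l f y • u y := by
  have hi : ∀ (m : Rd d → ℝ) (v : Rd d → ℂ), Continuous m → Continuous v → HasCompactSupport v →
      Integrable fun y => m y • v y := fun m v hm hv hc =>
    (hm.smul hv).integrable_of_hasCompactSupport (hc.smul_left (f := m))
  exact integral_bilinear_fderiv_right_eq_neg_left_of_integrable
    (B := ContinuousLinearMap.lsmul ℝ ℝ) (v := EuclideanSpace.single l 1)
    (hi _ _ (hf.pderivAt l).continuous hu.continuous hcs)
    (hi _ _ hf.continuous (hu.pderivAt l).continuous (hcs.pderivAt l))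
    (hi _ _ hf.continuous hu.continuous hcs)
    (fun x _ => hf.differentiable (by simp) x) (fun x _ => hu.differentiable (by simp) x)

/-- Differentiation of an integral operator with smooth kernel. -/
theorem hasFDerivAt_integral_kernel {κ : Rd d → Rd d → ℝ}
    (hκ : ContDiff ℝ ∞ (Function.uncurry κ)) {u : Rd d → ℂ} (hu : Continuous u)
    (hcs : HasCompactSupport u) (x : Rd d) :
    HasFDerivAt (fun x => ∫ y, κ x y • u y)
      (∫ y, (fderiv ℝ (fun x' => κ x' y) x).smulRight (u y)) x := by
  have hd : Continuous fun p : Rd d × Rd d => fderiv ℝ (fun x' => κ x' p.2) p.1 := by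
    refine (ContDiff.fderiv (f := fun (p : Rd d × Rd d) x' => κ x' p.2)
      (g := Prod.fst) (n := ∞) (m := ∞) ?_ contDiff_fst (by simp)).continuous
    exact hκ.comp (contDiff_snd.prodMk (contDiff_snd.comp contDiff_fst))
  have hc : ∀ x, Continuous (κ x) := fun x => hκ.continuous.comp (Continuous.prodMk_right x)
  -- Compactness of a unit ball in `x` times the support of `u` gives the uniform domination.
  obtain ⟨C, hC⟩ := ((isCompact_closedBall x 1).prod hcs).exists_bound_of_continuousOn hd.continuousOn
  refine hasFDerivAt_integral_of_dominated_of_fderiv_le (𝕜 := ℝ) (bound := fun y => C * ‖u y‖)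
    (F' := fun x y => (fderiv ℝ (fun x' => κ x' y) x).smulRight (u y))
    (Metric.closedBall_mem_nhds x one_pos)
    (Filter.Eventually.of_forall fun x => ((hc x).smul hu).aestronglyMeasurable)
    (((hc x).smul hu).integrable_of_hasCompactSupport (hcs.smul_left (f := κ x))) ?_ ?_ ?_ ?_
  · have h1 : Continuous fun y => fderiv ℝ (fun x' => κ x' y) x :=
      hd.comp (Continuous.prodMk_right x)
    have h2 : Continuous fun y => ((ContinuousLinearMap.smulRightL ℝ (Rd d) ℂ)
      (fderiv ℝ (fun x' => κ x' y) x)) (u y) := by fun_prop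
    exact h2.aestronglyMeasurable
  · refine Filter.Eventually.of_forall fun y x' hx' => ?_
    rw [ContinuousLinearMap.norm_smulRight_apply]
    by_cases hy : y ∈ tsupport u
    · gcongr
      exact hC (x', y) ⟨hx', hy⟩
    · simp [image_eq_zero_of_notMem_tsupport hy]
  · exact (hu.norm.integrable_of_hasCompactSupport hcs.norm).const_mul C
  · refine Filter.Eventually.of_forall fun y x' _ => ?_
    have h3 : DifferentiableAt ℝ (fun x' => κ x' y) x' :=
      (hκ.comp (contDiff_id.prodMk contDiff_const)).differentiable (by simp) x'
    exact h3.hasFDerivAt.smul_const (u y)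

theorem pderivAt_integral_kernel {κ : Rd d → Rd d → ℝ}
    (hκ : ContDiff ℝ ∞ (Function.uncurry κ)) {u : Rd d → ℂ} (hu : Continuous u)
    (hcs : HasCompactSupport u) (l : Fin d) (x : Rd d) :
    pderivAt l (fun x => ∫ y, κ x y • u y) x =
      ∫ y, pderivAt l (fun x' => κ x' y) x • u y := by
  have h := hasFDerivAt_integral_kernel hκ hu hcs x
  rw [pderivAt, h.fderiv, ContinuousLinearMap.integral_apply]
  · rfl
  have hd : Continuous fun p : Rd d × Rd d => fderiv ℝ (fun x' => κ x' p.2) p.1 := by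
    refine (ContDiff.fderiv (f := fun (p : Rd d × Rd d) x' => κ x' p.2)
      (g := Prod.fst) (n := ∞) (m := ∞) ?_ contDiff_fst (by simp)).continuous
    exact hκ.comp (contDiff_snd.prodMk (contDiff_snd.comp contDiff_fst))
  have h1 : Continuous fun y => fderiv ℝ (fun x' => κ x' y) x :=
    hd.comp (Continuous.prodMk_right x)
  have h2 : Continuous fun y => ((ContinuousLinearMap.smulRightL ℝ (Rd d) ℂ)
    (fderiv ℝ (fun x' => κ x' y) x)) (u y) := by fun_prop
  refine h2.integrable_of_hasCompactSupport (hcs.mono fun y hy => ?_)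
  contrapose! hy
  simp only [Function.mem_support, not_not] at hy ⊢
  rw [hy, map_zero]

/-- The derivation `V f = V^l ∂_l f` on real functions. -/
noncomputable def vecDeriv (V : Fin d → 𝓢(Rd d, ℝ)) (f : Rd d → ℝ) (x : Rd d) : ℝ :=
  ∑ l, V l x * pderivAt l f x

/-- The divergence `∂_l V^l`. -/
noncomputable def divField (V : Fin d → 𝓢(Rd d, ℝ)) (y : Rd d) : ℝ := ∑ l, pderivAt l (V l) y

/-- The derivation `V_x + V_y` on functions of two variables. -/
noncomputable def transport (V : Fin d → 𝓢(Rd d, ℝ)) (B : Rd d → Rd d → ℝ) (x y : Rd d) : ℝ :=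
  ∑ l, (V l x * pderivAt l (fun x' => B x' y) x + V l y * pderivAt l (B x) y)

/-- The kernel of `[V, T]` when `T` has the kernel `κ`. -/
noncomputable def kernelLie (V : Fin d → 𝓢(Rd d, ℝ)) (κ : Rd d → Rd d → ℝ) (x y : Rd d) : ℝ :=
  transport V κ x y + divField V y * κ x y

/-- `T` acts on test functions as the integral operator with the smooth kernel `κ`. -/
def HasKernel (T : (Rd d → ℂ) → Rd d → ℂ) (κ : Rd d → Rd d → ℝ) : Prop :=
  ContDiff ℝ ∞ (Function.uncurry κ) ∧ ∀ u : Rd d → ℂ, ContDiff ℝ ∞ u → HasCompactSupport u →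
    ∀ x, T u x = ∫ y, κ x y • u y

theorem contDiff_divField (V : Fin d → 𝓢(Rd d, ℝ)) : ContDiff ℝ ∞ (divField V) :=
  ContDiff.sum fun l _ => ContDiff.pderivAt (V l).contDiff_infty l

theorem contDiff_transport (V : Fin d → 𝓢(Rd d, ℝ)) {B : Rd d → Rd d → ℝ}
    (hB : ContDiff ℝ ∞ (Function.uncurry B)) :
    ContDiff ℝ ∞ (Function.uncurry (transport V B)) := by
  have h : ∀ l, ContDiff ℝ ∞ fun p : Rd d × Rd d =>
      V l p.1 * pderivAt l (fun x' => B x' p.2) p.1 + V l p.2 * pderivAt l (B p.1) p.2 := fun l =>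
    have hV : ContDiff ℝ ∞ (V l) := (V l).contDiff_infty
    ((hV.comp contDiff_fst).mul (hB.pderivAt_fst l)).add
      ((hV.comp contDiff_snd).mul (hB.pderivAt_snd l))
  simpa only [Function.uncurry_def, transport] using
    ContDiff.sum (s := Finset.univ) fun l _ => h l

theorem contDiff_kernelLie (V : Fin d → 𝓢(Rd d, ℝ)) {κ : Rd d → Rd d → ℝ}
    (hκ : ContDiff ℝ ∞ (Function.uncurry κ)) :
    ContDiff ℝ ∞ (Function.uncurry (kernelLie V κ)) :=
  (contDiff_transport V hκ).add (((contDiff_divField V).comp contDiff_snd).mul hκ)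

theorem contDiff_fieldOp (V : Fin d → 𝓢(Rd d, ℝ)) {u : Rd d → ℂ} (hu : ContDiff ℝ ∞ u) :
    ContDiff ℝ ∞ (fieldOp V u) :=
  ContDiff.sum fun l _ => (V l).contDiff_infty.smul (hu.pderivAt l)

theorem hasCompactSupport_fieldOp (V : Fin d → 𝓢(Rd d, ℝ)) {u : Rd d → ℂ}
    (hu : HasCompactSupport u) : HasCompactSupport (fieldOp V u) := by
  refine (hu.fderiv ℝ).mono fun x hx => ?_
  contrapose! hx
  simp only [Function.mem_support, not_not] at hx ⊢
  simp [fieldOp, pderivAt, hx]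

/-- The commutator of a vector field with an integral operator. -/
theorem HasKernel.opComm {T : (Rd d → ℂ) → Rd d → ℂ} {κ : Rd d → Rd d → ℝ} (h : HasKernel T κ)
    (V : Fin d → 𝓢(Rd d, ℝ)) : HasKernel (opComm (fieldOp V) T) (kernelLie V κ) := by
  obtain ⟨hκ, h⟩ := h
  refine ⟨contDiff_kernelLie V hκ, fun u hu hcs x => ?_⟩
  have hV : ∀ l, ContDiff ℝ ∞ (V l) := fun l => (V l).contDiff_infty
  have hκx : ContDiff ℝ ∞ (κ x) := hκ.comp (contDiff_const.prodMk contDiff_id)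
  have hκ1 : ∀ l, ContDiff ℝ ∞ fun y => pderivAt l (fun x' => κ x' y) x := fun l =>
    (hκ.pderivAt_fst l).comp (contDiff_const.prodMk contDiff_id)
  have hi : ∀ (m : Rd d → ℝ), ContDiff ℝ ∞ m → Integrable fun y => m y • u y := fun m hm =>
    (hm.continuous.smul hu.continuous).integrable_of_hasCompactSupport (hcs.smul_left (f := m))
  have hi' : ∀ l (m : Rd d → ℝ), ContDiff ℝ ∞ m → Integrable fun y => m y • pderivAt l u y :=
    fun l m hm => (hm.continuous.smul (hu.pderivAt l).continuous).integrable_of_hasCompactSupport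
      ((hcs.pderivAt l).smul_left (f := m))
  have h1 : fieldOp V (T u) x = ∑ l, ∫ y, (V l x * pderivAt l (fun x' => κ x' y) x) • u y := by
    refine Finset.sum_congr rfl fun l _ => ?_
    rw [show T u = fun x => ∫ y, κ x y • u y from funext (h u hu hcs),
      pderivAt_integral_kernel hκ hu.continuous hcs, ← integral_smul]
    simp only [mul_smul]
  -- Integration by parts in `y` takes the derivative off `u`; its sign turns the difference of the
  -- commutator into the sum `V_x + V_y`, and the derivative of `V` leaves the divergence.
  have h2 : T (fieldOp V u) x = -∑ l, ∫ y,
      (pderivAt l (κ x) y * V l y + κ x y * pderivAt l (V l) y) • u y := by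
    rw [h _ (contDiff_fieldOp V hu) (hasCompactSupport_fieldOp V hcs)]
    simp only [fieldOp, Finset.smul_sum, smul_smul]
    rw [integral_finsetSum _ fun l _ => hi' l _ (hκx.mul (hV l)), ← Finset.sum_neg_distrib]
    refine Finset.sum_congr rfl fun l _ => ?_
    rw [integral_smul_pderivAt (hκx.mul (hV l)) hu hcs l]
    congr 1
    refine integral_congr_ae (Filter.Eventually.of_forall fun y => ?_)
    simp only
    rw [pderivAt_mul (hκx.differentiable (by simp) y) ((hV l).differentiable (by simp) y)]
  simp only [_root_.opComm]
  rw [h1, h2, sub_neg_eq_add, ← Finset.sum_add_distrib]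
  have h3 : ∀ l, (∫ y, (V l x * pderivAt l (fun x' => κ x' y) x) • u y) +
      ∫ y, (pderivAt l (κ x) y * V l y + κ x y * pderivAt l (V l) y) • u y =
      ∫ y, (V l x * pderivAt l (fun x' => κ x' y) x + (pderivAt l (κ x) y * V l y +
        κ x y * pderivAt l (V l) y)) • u y := fun l => by
    simp only [add_smul _ (_ + _)]
    exact (integral_add (hi _ (contDiff_const.mul (hκ1 l)))
      (hi _ (((hκx.pderivAt l).mul (hV l)).add (hκx.mul ((hV l).pderivAt l))))).symm
  simp only [h3]
  rw [← integral_finsetSum _ fun l _ => hi _ ((contDiff_const.mul (hκ1 l)).add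
    (((hκx.pderivAt l).mul (hV l)).add (hκx.mul ((hV l).pderivAt l))))]
  refine integral_congr_ae (Filter.Eventually.of_forall fun y => ?_)
  simp only [kernelLie, transport, divField]
  rw [← Finset.sum_smul, Finset.sum_mul, ← Finset.sum_add_distrib]
  congr 1
  exact Finset.sum_congr rfl fun l _ => by ring

theorem transport_add (V : Fin d → 𝓢(Rd d, ℝ)) {B B' : Rd d → Rd d → ℝ}
    (hB : ContDiff ℝ ∞ (Function.uncurry B)) (hB' : ContDiff ℝ ∞ (Function.uncurry B'))
    (x y : Rd d) :
    transport V (fun x y => B x y + B' x y) x y = transport V B x y + transport V B' x y := by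
  have hx : ∀ {B : Rd d → Rd d → ℝ}, ContDiff ℝ ∞ (Function.uncurry B) →
      DifferentiableAt ℝ (fun x' => B x' y) x := fun hB =>
    (hB.comp (contDiff_id.prodMk contDiff_const)).differentiable (by simp) x
  have hy : ∀ {B : Rd d → Rd d → ℝ}, ContDiff ℝ ∞ (Function.uncurry B) →
      DifferentiableAt ℝ (B x) y := fun hB =>
    (hB.comp (contDiff_const.prodMk contDiff_id)).differentiable (by simp) y
  simp only [transport]
  rw [← Finset.sum_add_distrib]
  refine Finset.sum_congr rfl fun l _ => ?_
  rw [pderivAt_add (hx hB) (hx hB'), pderivAt_add (hy hB) (hy hB')]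
  ring

theorem transport_mul (V : Fin d → 𝓢(Rd d, ℝ)) {B B' : Rd d → Rd d → ℝ}
    (hB : ContDiff ℝ ∞ (Function.uncurry B)) (hB' : ContDiff ℝ ∞ (Function.uncurry B'))
    (x y : Rd d) :
    transport V (fun x y => B x y * B' x y) x y =
      transport V B x y * B' x y + B x y * transport V B' x y := by
  have hx : ∀ {B : Rd d → Rd d → ℝ}, ContDiff ℝ ∞ (Function.uncurry B) →
      DifferentiableAt ℝ (fun x' => B x' y) x := fun hB =>
    (hB.comp (contDiff_id.prodMk contDiff_const)).differentiable (by simp) x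
  have hy : ∀ {B : Rd d → Rd d → ℝ}, ContDiff ℝ ∞ (Function.uncurry B) →
      DifferentiableAt ℝ (B x) y := fun hB =>
    (hB.comp (contDiff_const.prodMk contDiff_id)).differentiable (by simp) y
  simp only [transport]
  rw [Finset.sum_mul, Finset.mul_sum, ← Finset.sum_add_distrib]
  refine Finset.sum_congr rfl fun l _ => ?_
  rw [pderivAt_mul (hx hB) (hx hB'), pderivAt_mul (hy hB) (hy hB')]
  ring

@[simp] theorem transport_fst (V : Fin d → 𝓢(Rd d, ℝ)) (f : Rd d → ℝ) (x y : Rd d) :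
    transport V (fun x _ => f x) x y = vecDeriv V f x := by
  simp [transport, vecDeriv]

@[simp] theorem transport_snd (V : Fin d → 𝓢(Rd d, ℝ)) (f : Rd d → ℝ) (x y : Rd d) :
    transport V (fun _ y => f y) x y = vecDeriv V f y := by
  simp [transport, vecDeriv]

theorem transport_sub (V : Fin d → 𝓢(Rd d, ℝ)) {f : Rd d → ℝ} (hf : ContDiff ℝ ∞ f)
    (x y : Rd d) :
    transport V (fun x y => f x - f y) x y = vecDeriv V f x - vecDeriv V f y := by
  have h := hf.differentiable (by simp)
  simp only [transport, vecDeriv]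
  rw [← Finset.sum_sub_distrib]
  refine Finset.sum_congr rfl fun l _ => ?_
  rw [pderivAt_sub (h x) (differentiableAt_const _), pderivAt_sub (differentiableAt_const _) (h y)]
  simp only [pderivAt_const]
  ring

/-- On functions of `x - y` the two gradients are opposite, so the coefficients combine into `V(x) -
V(y)`. This is the cancellation behind the whole estimate: the extra derivative of `P` is
compensated by a zero on the diagonal. -/
theorem transport_convolution (V : Fin d → 𝓢(Rd d, ℝ)) {P : Rd d → ℝ} (hP : ContDiff ℝ ∞ P)
    (x y : Rd d) :
    transport V (fun x y => P (x - y)) x y =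
      ∑ l, (V l x - V l y) * pderivAt l P (x - y) := by
  simp only [transport]
  refine Finset.sum_congr rfl fun l _ => ?_
  rw [pderivAt_comp_sub_const, pderivAt_comp_const_sub (hP.differentiable (by simp))]
  ring

theorem contDiff_convolution_kernel {P : Rd d → ℝ} (hP : ContDiff ℝ ∞ P) :
    ContDiff ℝ ∞ (Function.uncurry fun x y : Rd d => P (x - y)) :=
  hP.comp (contDiff_fst.sub contDiff_snd)

/-- Leibniz rule for `V_x + V_y`: when it falls on `B` the derivative `ν` is unchanged, and when it
falls on the convolution kernel both the length of `ν` and the vanishing order of the coefficient go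
up by one. -/
theorem kernelLie_mul_convolution (V : Fin d → 𝓢(Rd d, ℝ)) {B : Rd d → Rd d → ℝ}
    (hB : ContDiff ℝ ∞ (Function.uncurry B)) {k : Rd d → ℝ} (hk : ContDiff ℝ ∞ k)
    (ν : List (Fin d)) (x y : Rd d) :
    kernelLie V (fun x y => B x y * multiDeriv ν k (x - y)) x y =
      (transport V B x y + divField V y * B x y) * multiDeriv ν k (x - y) +
        ∑ l, (B x y * (V l x - V l y)) * multiDeriv (l :: ν) k (x - y) := by
  rw [kernelLie, transport_mul V hB (contDiff_convolution_kernel (hk.multiDeriv ν)),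
    transport_convolution V (hk.multiDeriv ν), Finset.mul_sum, add_mul, add_assoc,
    add_comm (∑ l, _) _, ← add_assoc]
  congr 1
  · ring
  · exact Finset.sum_congr rfl fun l _ => by rw [multiDeriv]; ring

theorem kernelLie_sum (V : Fin d → 𝓢(Rd d, ℝ)) {S : Type*} [Fintype S]
    {κ : S → Rd d → Rd d → ℝ} (hκ : ∀ s, ContDiff ℝ ∞ (Function.uncurry (κ s))) (x y : Rd d) :
    kernelLie V (fun x y => ∑ s, κ s x y) x y = ∑ s, kernelLie V (κ s) x y := by
  have hx : ∀ s, DifferentiableAt ℝ (fun x' => κ s x' y) x := fun s =>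
    ((hκ s).comp (contDiff_id.prodMk contDiff_const)).differentiable (by simp) x
  have hy : ∀ s, DifferentiableAt ℝ (κ s x) y := fun s =>
    ((hκ s).comp (contDiff_const.prodMk contDiff_id)).differentiable (by simp) y
  simp only [kernelLie, transport]
  rw [Finset.sum_add_distrib (s := (Finset.univ : Finset S)), Finset.mul_sum, Finset.sum_comm]
  congr 1
  refine Finset.sum_congr rfl fun l _ => ?_
  rw [pderivAt_sum _ fun s _ => hx s, pderivAt_sum _ fun s _ => hy s]
  simp only [Finset.mul_sum, Finset.sum_add_distrib]

/-- The kernel of `a (b ∂_i ∂_j · * k)`. -/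
theorem hasKernel_kernelOp {a b k : Rd d → ℝ} (ha : ContDiff ℝ ∞ a) (hb : ContDiff ℝ ∞ b)
    (hk : ContDiff ℝ ∞ k) (i j : Fin d) :
    HasKernel (kernelOp a b k i j) fun x y =>
      a x * b y * multiDeriv [j, i] k (x - y) + a x * -pderivAt j b y * multiDeriv [i] k (x - y) +
        (a x * -pderivAt i b y * multiDeriv [j] k (x - y) +
          a x * pderivAt j (pderivAt i b) y * multiDeriv [] k (x - y)) := by
  have hc : ∀ {f g : Rd d → ℝ} (σ : List (Fin d)), ContDiff ℝ ∞ f → ContDiff ℝ ∞ g →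
      ContDiff ℝ ∞ (Function.uncurry fun x y : Rd d => f x * g y * multiDeriv σ k (x - y)) :=
    fun σ hf hg => ((hf.comp contDiff_fst).mul (hg.comp contDiff_snd)).mul
      (contDiff_convolution_kernel (hk.multiDeriv σ))
  refine ⟨((hc _ ha hb).add (hc _ ha (hb.pderivAt j).neg)).add
    ((hc _ ha (hb.pderivAt i).neg).add (hc _ ha ((hb.pderivAt i).pderivAt j))),
    fun u hu hcs x => ?_⟩
  have hkx : ∀ {f : Rd d → ℝ}, ContDiff ℝ ∞ f → ContDiff ℝ ∞ fun y => f (x - y) := fun hf =>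
    hf.comp (contDiff_const.sub contDiff_id)
  have hd : ∀ {f : Rd d → ℝ}, ContDiff ℝ ∞ f → Differentiable ℝ f := fun hf =>
    hf.differentiable (by simp)
  -- Two integrations by parts will move `∂_i` and `∂_j` from `u` to `k(x - y) b(y)`; expanding by
  -- Leibniz gives the four terms.
  have h1 : kernelOp a b k i j u x = a x • ∫ y, (k (x - y) * b y) • pderivAt i (pderivAt j u) y := by
    simp only [kernelOp, convolution]
    congr 1
    refine integral_congr_ae (Filter.Eventually.of_forall fun y => ?_)
    simp only [ContinuousLinearMap.mul_apply', Complex.real_smul, Complex.ofReal_mul]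
    ring
  have h2 : pderivAt i (fun y => k (x - y) * b y) =
      fun y => -pderivAt i k (x - y) * b y + k (x - y) * pderivAt i b y := by
    ext y
    rw [pderivAt_mul (hd (hkx hk) y) (hd hb y), pderivAt_comp_const_sub (hd hk)]
  have h3 : ∀ y, pderivAt j (fun y => -pderivAt i k (x - y) * b y + k (x - y) * pderivAt i b y) y =
      multiDeriv [j, i] k (x - y) * b y - multiDeriv [i] k (x - y) * pderivAt j b y -
        multiDeriv [j] k (x - y) * pderivAt i b y +
          multiDeriv [] k (x - y) * pderivAt j (pderivAt i b) y := by
    intro y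
    have hki := hkx (hk.pderivAt i)
    have hki' : ContDiff ℝ ∞ fun y => -pderivAt i k (x - y) := hki.neg
    rw [pderivAt_add (hd (hki'.mul hb) y) (hd ((hkx hk).mul (hb.pderivAt i)) y),
      pderivAt_mul (hd hki' y) (hd hb y),
      pderivAt_mul (hd (hkx hk) y) (hd (hb.pderivAt i) y), pderivAt_comp_const_sub (hd hk)]
    have h4 : pderivAt j (fun y => -pderivAt i k (x - y)) y = pderivAt j (pderivAt i k) (x - y) := by
      have := pderivAt_comp_const_sub (f := fun z => -pderivAt i k z) (hd (hk.pderivAt i).neg) x y j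
      rw [this]
      rw [pderivAt, fderiv_fun_neg]
      simp [pderivAt]
    rw [h4]
    simp only [multiDeriv]
    ring
  rw [h1, integral_smul_pderivAt ((hkx hk).mul hb) (hu.pderivAt j) (hcs.pderivAt j), h2,
    integral_smul_pderivAt (((hkx (hk.pderivAt i)).neg.mul hb).add ((hkx hk).mul (hb.pderivAt i)))
      hu hcs, neg_neg, ← integral_smul]
  refine integral_congr_ae (Filter.Eventually.of_forall fun y => ?_)
  simp only [h3]
  rw [smul_smul]
  congr 1
  ring

end KernelCalculus

/-! ### Uniform Taylor expansions of coefficients on the diagonal. -/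

section Expansions

variable {d : ℕ}

theorem clm_apply_eq_sum {E : Type*} [NormedAddCommGroup E] [NormedSpace ℝ E]
    (L : Rd d →L[ℝ] E) (v : Rd d) : L v = ∑ l, v l • L (EuclideanSpace.single l 1) := by
  conv_lhs => rw [← (EuclideanSpace.basisFun (Fin d) ℝ).sum_repr v]
  simp

theorem norm_clm_le_sum {E : Type*} [NormedAddCommGroup E] [NormedSpace ℝ E]
    (L : Rd d →L[ℝ] E) : ‖L‖ ≤ ∑ l, ‖L (EuclideanSpace.single l 1)‖ := by
  refine L.opNorm_le_bound (Finset.sum_nonneg fun _ _ => norm_nonneg _) fun v => ?_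
  rw [clm_apply_eq_sum L v, Finset.sum_mul]
  refine (norm_sum_le _ _).trans (Finset.sum_le_sum fun l _ => ?_)
  rw [norm_smul, mul_comm]
  gcongr
  exact PiLp.norm_apply_le v l

theorem abs_multiMonomial_le (μ : List (Fin d)) (z : Rd d) :
    |multiMonomial μ z| ≤ ‖z‖ ^ μ.length := by
  induction μ with
  | nil => simp [multiMonomial]
  | cons i μ ih =>
    have : multiMonomial (i :: μ) z = z i * multiMonomial μ z := by simp [multiMonomial]
    rw [this, abs_mul, List.length_cons, pow_succ']
    exact mul_le_mul (PiLp.norm_apply_le z i) ih (abs_nonneg _) (norm_nonneg _)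

theorem multiMonomial_append (μ μ' : List (Fin d)) (z : Rd d) :
    multiMonomial (μ ++ μ') z = multiMonomial μ z * multiMonomial μ' z := by
  simp [multiMonomial]

/-- A family of two-variable functions `B(x, y)` indexed by vector fields has, uniformly over the
set `𝒱`, an expansion by homogeneous polynomials of degree `n` in `x - y` with coefficients bounded
on `Q`, up to `O(|x - y|^{n + θ})`, with polynomial growth at infinity. -/
def Expands (𝒱 : Set (Fin d → 𝓢(Rd d, ℝ))) (Q : Set (Rd d)) (θ : ℝ) (n : ℕ)
    (B : (Fin d → 𝓢(Rd d, ℝ)) → Rd d → Rd d → ℝ) : Prop :=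
  ∃ (S : Type) (_ : Fintype S) (μ : S → List (Fin d))
    (g : S → (Fin d → 𝓢(Rd d, ℝ)) → Rd d → ℝ) (C : ℝ) (N : ℕ),
    0 ≤ C ∧ (∀ s, (μ s).length = n) ∧ (∀ s V, ContDiff ℝ ∞ (g s V)) ∧
    (∀ s, ∀ V ∈ 𝒱, ∀ y ∈ Q, |g s V y| ≤ C) ∧
    ∀ V ∈ 𝒱, ∀ x, ∀ y ∈ Q, |B V x y - ∑ s, g s V y * multiMonomial (μ s) (x - y)| ≤
      C * ‖x - y‖ ^ ((n : ℝ) + θ) * (1 + ‖x - y‖) ^ N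

/-- Polynomial growth on `X`, uniformly over `𝒱`. -/
def UnifPoly (𝒱 : Set (Fin d → 𝓢(Rd d, ℝ))) (X : Set (Rd d))
    (f : (Fin d → 𝓢(Rd d, ℝ)) → Rd d → ℝ) : Prop :=
  ∃ (C : ℝ) (N : ℕ), 0 ≤ C ∧ ∀ V ∈ 𝒱, ∀ x ∈ X, |f V x| ≤ C * (1 + ‖x‖) ^ N

/-- Boundedness in `C^{1+γ}`, uniformly over `𝒱`. -/
def UnifHolder (𝒱 : Set (Fin d → 𝓢(Rd d, ℝ))) (γ : ℝ)
    (f : (Fin d → 𝓢(Rd d, ℝ)) → Rd d → ℝ) : Prop :=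
  (∀ V, ContDiff ℝ ∞ (f V)) ∧ ∃ C : ℝ, 0 ≤ C ∧ ∀ V ∈ 𝒱, (∀ x, |f V x| ≤ C) ∧
    (∀ l x, |pderivAt l (f V) x| ≤ C) ∧
    ∀ l x y, |pderivAt l (f V) x - pderivAt l (f V) y| ≤ C * ‖x - y‖ ^ γ

variable {𝒱 : Set (Fin d → 𝓢(Rd d, ℝ))} {Q : Set (Rd d)} {θ : ℝ} {n m : ℕ}
  {f g : (Fin d → 𝓢(Rd d, ℝ)) → Rd d → ℝ} {B B' : (Fin d → 𝓢(Rd d, ℝ)) → Rd d → Rd d → ℝ}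

theorem UnifPoly.mul {X : Set (Rd d)} (hf : UnifPoly 𝒱 X f) (hg : UnifPoly 𝒱 X g) :
    UnifPoly 𝒱 X fun V x => f V x * g V x := by
  obtain ⟨C, N, hC, hf⟩ := hf
  obtain ⟨C', N', hC', hg⟩ := hg
  refine ⟨C * C', N + N', by positivity, fun V hV x hx => ?_⟩
  rw [abs_mul, pow_add, mul_mul_mul_comm]
  exact mul_le_mul (hf V hV x hx) (hg V hV x hx) (abs_nonneg _) (by positivity)

theorem UnifPoly.add {X : Set (Rd d)} (hf : UnifPoly 𝒱 X f) (hg : UnifPoly 𝒱 X g) :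
    UnifPoly 𝒱 X fun V x => f V x + g V x := by
  obtain ⟨C, N, hC, hf⟩ := hf
  obtain ⟨C', N', hC', hg⟩ := hg
  refine ⟨C + C', N + N', by positivity, fun V hV x hx => (abs_add_le _ _).trans ?_⟩
  have h1 : (1 : ℝ) ≤ 1 + ‖x‖ := le_add_of_nonneg_right (norm_nonneg x)
  rw [add_mul]
  refine add_le_add ((hf V hV x hx).trans ?_) ((hg V hV x hx).trans ?_)
  · exact mul_le_mul_of_nonneg_left (pow_le_pow_right₀ h1 (by omega)) hC
  · exact mul_le_mul_of_nonneg_left (pow_le_pow_right₀ h1 (by omega)) hC'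

theorem UnifPoly.zero {X : Set (Rd d)} : UnifPoly 𝒱 X fun _ _ => (0 : ℝ) :=
  ⟨0, 0, le_rfl, by simp⟩

theorem UnifPoly.mono {X Y : Set (Rd d)} (h : Y ⊆ X) (hf : UnifPoly 𝒱 X f) : UnifPoly 𝒱 Y f := by
  obtain ⟨C, N, hC, hf⟩ := hf
  exact ⟨C, N, hC, fun V hV x hx => hf V hV x (h hx)⟩

theorem UnifPoly.exists_bound (hf : UnifPoly 𝒱 Q f) (hQ : IsCompact Q) :
    ∃ C : ℝ, 0 ≤ C ∧ ∀ V ∈ 𝒱, ∀ y ∈ Q, |f V y| ≤ C := by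
  obtain ⟨C, N, hC, hf⟩ := hf
  obtain ⟨R, hR⟩ := hQ.exists_bound_of_continuousOn (f := fun y : Rd d => ‖y‖) (by fun_prop)
  refine ⟨C * (1 + |R|) ^ N, by positivity, fun V hV y hy => (hf V hV y hy).trans ?_⟩
  gcongr
  have := hR y hy
  rw [norm_norm] at this
  exact this.trans (le_abs_self R)

theorem unifPoly_const (hQ : IsCompact Q) {c : Rd d → ℝ} (hc : Continuous c) :
    UnifPoly 𝒱 Q fun _ => c := by
  obtain ⟨R, hR⟩ := hQ.exists_bound_of_continuousOn (f := c) hc.continuousOn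
  exact ⟨|R|, 0, abs_nonneg _, fun V _ y hy => by
    simpa using (hR y hy).trans (le_abs_self R)⟩

theorem Expands.add (hB : Expands 𝒱 Q θ n B) (hB' : Expands 𝒱 Q θ n B') :
    Expands 𝒱 Q θ n fun V x y => B V x y + B' V x y := by
  obtain ⟨S, _, μ, g, C, N, hC, hμ, hg, hgC, hB⟩ := hB
  obtain ⟨S', _, μ', g', C', N', hC', hμ', hg', hgC', hB'⟩ := hB'
  refine ⟨S ⊕ S', inferInstance, Sum.elim μ μ', Sum.elim g g', C + C', N + N', by positivity,
    by rintro (s | s); exacts [hμ s, hμ' s], by rintro (s | s); exacts [hg s, hg' s], ?_, ?_⟩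
  · rintro (s | s) V hV y hy
    · exact (hgC s V hV y hy).trans (by linarith)
    · exact (hgC' s V hV y hy).trans (by linarith)
  · intro V hV x y hy
    have h1 : (1 : ℝ) ≤ 1 + ‖x - y‖ := le_add_of_nonneg_right (norm_nonneg _)
    simp only [Fintype.sum_sum_type, Sum.elim_inl, Sum.elim_inr]
    rw [add_sub_add_comm, add_mul, add_mul]
    refine (abs_add_le _ _).trans (add_le_add ((hB V hV x y hy).trans ?_)
      ((hB' V hV x y hy).trans ?_))
    · exact mul_le_mul_of_nonneg_left (pow_le_pow_right₀ h1 (by omega)) (by positivity)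
    · exact mul_le_mul_of_nonneg_left (pow_le_pow_right₀ h1 (by omega)) (by positivity)

theorem expands_zero : Expands 𝒱 Q θ n fun _ _ _ => (0 : ℝ) :=
  ⟨Empty, inferInstance, Empty.elim, Empty.elim, 0, 0, le_rfl, by rintro ⟨⟩, by rintro ⟨⟩,
    by rintro ⟨⟩, by simp⟩

theorem Expands.sum {ι : Type*} (s : Finset ι)
    {B : ι → (Fin d → 𝓢(Rd d, ℝ)) → Rd d → Rd d → ℝ} (hB : ∀ i ∈ s, Expands 𝒱 Q θ n (B i)) :
    Expands 𝒱 Q θ n fun V x y => ∑ i ∈ s, B i V x y := by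
  classical
  induction s using Finset.induction_on with
  | empty => simpa using expands_zero
  | insert a s ha ih =>
    simp only [Finset.sum_insert ha]
    exact (hB a (by simp)).add (ih fun i hi => hB i (by simp [hi]))

theorem rpow_natCast_add_le {r θ : ℝ} (hr : 0 ≤ r) (h0 : 0 ≤ θ) (h1 : θ ≤ 1) (n : ℕ) :
    r ^ ((n : ℝ) + θ) ≤ r ^ n * (1 + r) := by
  rw [Real.rpow_add_of_nonneg hr (Nat.cast_nonneg _) h0, Real.rpow_natCast]
  refine mul_le_mul_of_nonneg_left ?_ (by positivity)
  calc r ^ θ ≤ (1 + r) ^ θ := Real.rpow_le_rpow hr (by linarith) h0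
    _ ≤ (1 + r) ^ (1 : ℝ) := Real.rpow_le_rpow_of_exponent_le (by linarith) h1
    _ = _ := Real.rpow_one _

theorem abs_sum_mul_multiMonomial_le {S : Type*} [Fintype S] {μ : S → List (Fin d)}
    (hμ : ∀ s, (μ s).length = n) {c : S → ℝ} {C : ℝ} (hc : ∀ s, |c s| ≤ C) (z : Rd d) :
    |∑ s, c s * multiMonomial (μ s) z| ≤ Fintype.card S * C * ‖z‖ ^ n := by
  refine (Finset.abs_sum_le_sum_abs _ _).trans ?_
  rw [mul_assoc, ← nsmul_eq_mul]
  refine Finset.sum_le_card_nsmul _ _ _ fun s _ => ?_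
  rw [abs_mul]
  refine mul_le_mul (hc s) ?_ (abs_nonneg _) ((abs_nonneg _).trans (hc s))
  rw [← hμ s]
  exact abs_multiMonomial_le _ _

/-- The leading polynomial is `O(|z|^n)`, and the remainder obeys `|z|^{n+θ} ≤ |z|^n (1 + |z|)`, at
the price of one more power of growth. -/
theorem Expands.exists_le (h0 : 0 ≤ θ) (h1 : θ ≤ 1) (hB : Expands 𝒱 Q θ n B) :
    ∃ (C : ℝ) (N : ℕ), 0 ≤ C ∧ ∀ V ∈ 𝒱, ∀ x, ∀ y ∈ Q,
      |B V x y| ≤ C * ‖x - y‖ ^ n * (1 + ‖x - y‖) ^ N := by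
  obtain ⟨S, _, μ, g, C, N, hC, hμ, hg, hgC, hB⟩ := hB
  refine ⟨Fintype.card S * C + C, N + 1, by positivity, fun V hV x y hy => ?_⟩
  set r := ‖x - y‖ with hr
  have hr0 : 0 ≤ r := norm_nonneg _
  have h2 := hB V hV x y hy
  have h3 := abs_sum_mul_multiMonomial_le hμ (fun s => hgC s V hV y hy) (x - y)
  have h4 : |B V x y| ≤ C * r ^ ((n : ℝ) + θ) * (1 + r) ^ N + Fintype.card S * C * r ^ n := by
    have := abs_add_le (B V x y - ∑ s, g s V y * multiMonomial (μ s) (x - y))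
      (∑ s, g s V y * multiMonomial (μ s) (x - y))
    rw [sub_add_cancel] at this
    linarith
  refine h4.trans ?_
  have h5 : (1 : ℝ) ≤ (1 + r) ^ (N + 1) := one_le_pow₀ (by linarith)
  have h6 : C * r ^ ((n : ℝ) + θ) * (1 + r) ^ N ≤ C * (r ^ n * (1 + r)) * (1 + r) ^ N := by
    gcongr
    exact rpow_natCast_add_le hr0 h0 h1 n
  have h7 : Fintype.card S * C * r ^ n ≤ Fintype.card S * C * r ^ n * (1 + r) ^ (N + 1) :=
    le_mul_of_one_le_right (by positivity) h5
  calc _ ≤ C * (r ^ n * (1 + r)) * (1 + r) ^ N + Fintype.card S * C * r ^ n * (1 + r) ^ (N + 1) :=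
        add_le_add h6 h7
    _ = _ := by rw [pow_succ]; ring

/-- The leading polynomials `P, P'` multiply, and `BB' - PP' = (B - P)B' + P(B' - P')` keeps the
gain of `θ`, the undifferenced factors being of orders `m` and `n`. -/
theorem Expands.mul (h0 : 0 ≤ θ) (h1 : θ ≤ 1) (hB : Expands 𝒱 Q θ n B)
    (hB' : Expands 𝒱 Q θ m B') : Expands 𝒱 Q θ (n + m) fun V x y => B V x y * B' V x y := by
  obtain ⟨C₀, N₀, hC₀, hB₀⟩ := hB'.exists_le h0 h1
  obtain ⟨S, _, μ, g, C, N, hC, hμ, hg, hgC, hB⟩ := hB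
  obtain ⟨S', _, μ', g', C', N', hC', hμ', hg', hgC', hB'⟩ := hB'
  refine ⟨S × S', inferInstance, fun p => μ p.1 ++ μ' p.2, fun p V y => g p.1 V y * g' p.2 V y,
    -- The first summand bounds the product coefficients, the other two bound the two error terms.
    C * C' + C * C₀ + Fintype.card S * C * C', N + N₀ + N', by positivity,
    fun p => by rw [List.length_append, hμ, hμ'], fun p V => (hg _ V).mul (hg' _ V), ?_, ?_⟩
  · intro p V hV y hy
    rw [abs_mul]
    have := mul_le_mul (hgC p.1 V hV y hy) (hgC' p.2 V hV y hy) (abs_nonneg _) hC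
    have h2 : 0 ≤ C * C₀ := by positivity
    have h3 : 0 ≤ Fintype.card S * C * C' := by positivity
    linarith
  · intro V hV x y hy
    set r := ‖x - y‖ with hr
    have hr0 : 0 ≤ r := norm_nonneg _
    set P := ∑ s, g s V y * multiMonomial (μ s) (x - y) with hP
    set P' := ∑ s, g' s V y * multiMonomial (μ' s) (x - y) with hP'
    have hPP : ∑ p : S × S', g p.1 V y * g' p.2 V y * multiMonomial (μ p.1 ++ μ' p.2) (x - y) =
        P * P' := by
      rw [hP, hP', Finset.sum_mul_sum, Fintype.sum_prod_type]
      refine Finset.sum_congr rfl fun s _ => Finset.sum_congr rfl fun s' _ => ?_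
      rw [multiMonomial_append]; ring
    rw [hPP]
    have e1 : |B V x y - P| * |B' V x y| ≤
        C * r ^ ((n : ℝ) + θ) * (1 + r) ^ N * (C₀ * r ^ m * (1 + r) ^ N₀) :=
      mul_le_mul (hB V hV x y hy) (hB₀ V hV x y hy) (abs_nonneg _) (by positivity)
    have e2 : |P| * |B' V x y - P'| ≤
        Fintype.card S * C * r ^ n * (C' * r ^ ((m : ℝ) + θ) * (1 + r) ^ N') :=
      mul_le_mul (abs_sum_mul_multiMonomial_le hμ (fun s => hgC s V hV y hy) (x - y))
        (hB' V hV x y hy) (abs_nonneg _) (by positivity)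
    have e3 : |B V x y * B' V x y - P * P'| ≤ |B V x y - P| * |B' V x y| + |P| * |B' V x y - P'| := by
      rw [← abs_mul, ← abs_mul]
      refine le_trans (le_of_eq ?_) (abs_add_le _ _)
      congr 1; ring
    have hR1 : r ^ ((n : ℝ) + θ) * r ^ m = r ^ (((n + m : ℕ) : ℝ) + θ) := by
      rw [← Real.rpow_natCast, ← Real.rpow_add_of_nonneg hr0 (by positivity) (by positivity)]
      congr 1; push_cast; ring
    have hR2 : r ^ n * r ^ ((m : ℝ) + θ) = r ^ (((n + m : ℕ) : ℝ) + θ) := by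
      rw [← Real.rpow_natCast, ← Real.rpow_add_of_nonneg hr0 (by positivity) (by positivity)]
      congr 1; push_cast; ring
    set X := r ^ (((n + m : ℕ) : ℝ) + θ) with hX
    have hX0 : 0 ≤ X := by positivity
    have hge : (1 : ℝ) ≤ 1 + r := by linarith
    have p1 : (1 + r) ^ (N + N₀) ≤ (1 + r) ^ (N + N₀ + N') := pow_le_pow_right₀ hge (by omega)
    have p2 : (1 + r) ^ N' ≤ (1 + r) ^ (N + N₀ + N') := pow_le_pow_right₀ hge (by omega)
    calc _ ≤ _ := e3
      _ ≤ _ := add_le_add e1 e2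
      _ = C * C₀ * (r ^ ((n : ℝ) + θ) * r ^ m) * (1 + r) ^ (N + N₀) +
          Fintype.card S * C * C' * (r ^ n * r ^ ((m : ℝ) + θ)) * (1 + r) ^ N' := by
        rw [pow_add]; ring
      _ ≤ C * C₀ * X * (1 + r) ^ (N + N₀ + N') +
          Fintype.card S * C * C' * X * (1 + r) ^ (N + N₀ + N') := by
        rw [hR1, hR2]
        gcongr
      _ ≤ _ := by
        have : 0 ≤ C * C' * X * (1 + r) ^ (N + N₀ + N') := by positivity
        linarith

theorem expands_snd (hQ : IsCompact Q) (hf : ∀ V, ContDiff ℝ ∞ (f V)) (hfb : UnifPoly 𝒱 Q f) :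
    Expands 𝒱 Q θ 0 fun V _ y => f V y := by
  obtain ⟨C, hC, hfb⟩ := hfb.exists_bound hQ
  refine ⟨Unit, inferInstance, fun _ => [], fun _ => f, C, 0, hC, fun _ => rfl, fun _ => hf,
    fun _ => hfb, fun V hV x y hy => ?_⟩
  simp only [multiMonomial, List.map_nil, List.prod_nil, mul_one, Finset.univ_unique,
    Finset.sum_singleton, sub_self, abs_zero]
  positivity

/-- The leading term is `f` frozen at `y`. The mean value inequality on a ball containing `x` and
`y`, of radius comparable to `1 + |x - y|`, bounds the difference through the polynomially growing
gradient, and `r ≤ r^θ (1 + r)` supplies the required form. -/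
theorem expands_fst (h0 : 0 ≤ θ) (h1 : θ ≤ 1) (hQ : IsCompact Q)
    (hf : ∀ V, ContDiff ℝ ∞ (f V)) (hfp : UnifPoly 𝒱 Set.univ f)
    (hfd : ∀ l, UnifPoly 𝒱 Set.univ fun V => pderivAt l (f V)) :
    Expands 𝒱 Q θ 0 fun V x _ => f V x := by
  obtain ⟨C₀, hC₀, hf0⟩ := (hfp.mono (Set.subset_univ Q)).exists_bound hQ
  choose C N hC hfC using hfd
  obtain ⟨R', hR'⟩ := hQ.exists_bound_of_continuousOn (f := fun y : Rd d => ‖y‖) (by fun_prop)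
  set R := |R'|
  have hR : ∀ y ∈ Q, ‖y‖ ≤ R := fun y hy => by
    have := hR' y hy
    rw [norm_norm] at this
    exact this.trans (le_abs_self R')
  have hRnn : 0 ≤ R := abs_nonneg _
  set M := ∑ l, N l
  set D := ∑ l, C l * (1 + R) ^ N l
  have hD : 0 ≤ D := Finset.sum_nonneg fun l _ => mul_nonneg (hC l) (by positivity)
  refine ⟨Unit, inferInstance, fun _ => [], fun _ => f, C₀ + D, M + 1, by positivity,
    fun _ => rfl, fun _ => hf, fun _ V hV y hy => (hf0 V hV y hy).trans (by linarith),
    fun V hV x y hy => ?_⟩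
  simp only [multiMonomial, List.map_nil, List.prod_nil, mul_one, Finset.univ_unique,
    Finset.sum_singleton]
  set r := ‖x - y‖ with hr
  have hr0 : 0 ≤ r := norm_nonneg _
  have hb : ∀ z ∈ Metric.closedBall (0 : Rd d) (R + r), ‖fderiv ℝ (f V) z‖ ≤ D * (1 + r) ^ M := by
    intro z hz
    rw [mem_closedBall_zero_iff] at hz
    refine (norm_clm_le_sum _).trans ?_
    rw [Finset.sum_mul]
    refine Finset.sum_le_sum fun l _ => (hfC l V hV z (Set.mem_univ z)).trans ?_
    rw [mul_assoc]
    refine mul_le_mul_of_nonneg_left ?_ (hC l)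
    calc (1 + ‖z‖) ^ N l ≤ ((1 + R) * (1 + r)) ^ N l := by
          gcongr
          nlinarith [mul_nonneg hRnn hr0]
      _ = (1 + R) ^ N l * (1 + r) ^ N l := mul_pow _ _ _
      _ ≤ (1 + R) ^ N l * (1 + r) ^ M := by
          refine mul_le_mul_of_nonneg_left (pow_le_pow_right₀ (by linarith) ?_) (by positivity)
          exact Finset.single_le_sum (fun _ _ => Nat.zero_le _) (Finset.mem_univ l)
  have hy' : ‖y‖ ≤ R + r := (hR y hy).trans (by linarith)
  have hx' : ‖x‖ ≤ R + r := by
    have := norm_add_le y (x - y)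
    rw [add_sub_cancel] at this
    linarith [hR y hy]
  have h2 := (convex_closedBall (0 : Rd d) (R + r)).norm_image_sub_le_of_norm_fderiv_le (𝕜 := ℝ)
    (fun z _ => (hf V).differentiable (by simp) z) hb
    (mem_closedBall_zero_iff.2 hy') (mem_closedBall_zero_iff.2 hx')
  rw [Real.norm_eq_abs] at h2
  have h3 : r ≤ r ^ θ * (1 + r) := by
    rcases hr0.eq_or_lt with h | h
    · rw [← h]; positivity
    · have : r = r ^ θ * r ^ (1 - θ) := by
        rw [← Real.rpow_add h]; simp
      calc r = r ^ θ * r ^ (1 - θ) := this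
        _ ≤ r ^ θ * (1 + r) := by
          refine mul_le_mul_of_nonneg_left ?_ (by positivity)
          calc r ^ (1 - θ) ≤ (1 + r) ^ (1 - θ) := Real.rpow_le_rpow hr0 (by linarith) (by linarith)
            _ ≤ (1 + r) ^ (1 : ℝ) := Real.rpow_le_rpow_of_exponent_le (by linarith) (by linarith)
            _ = _ := Real.rpow_one _
  calc |f V x - f V y| ≤ D * (1 + r) ^ M * r := h2
    _ ≤ D * (1 + r) ^ M * (r ^ θ * (1 + r)) := by gcongr
    _ = D * r ^ θ * (1 + r) ^ (M + 1) := by rw [pow_succ]; ring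
    _ ≤ (C₀ + D) * r ^ (((0 : ℕ) : ℝ) + θ) * (1 + r) ^ (M + 1) := by
        rw [Nat.cast_zero, zero_add]
        gcongr
        linarith

/-- First-order Taylor formula at `y`: the `γ`-Hölder gradient gives a remainder `r^{1+γ} ≤ r^{1+θ}
(1 + r)`. -/
theorem UnifHolder.expands {γ : ℝ} (h0 : 0 ≤ θ) (hθ : θ ≤ γ) (h1 : γ ≤ 1)
    (hf : UnifHolder 𝒱 γ f) : Expands 𝒱 Q θ 1 fun V x y => f V x - f V y := by
  obtain ⟨hfs, C, hC, h⟩ := hf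
  refine ⟨Fin d, inferInstance, fun l => [l], fun l V => pderivAt l (f V), d * C + C, 1,
    by positivity, fun _ => rfl, fun l V => (hfs V).pderivAt l, fun l V hV y hy =>
      ((h V hV).2.1 l y).trans (le_add_of_nonneg_left (by positivity)), fun V hV x y hy => ?_⟩
  set r := ‖x - y‖ with hr
  have hr0 : 0 ≤ r := norm_nonneg _
  have hb : ∀ z ∈ Metric.closedBall y r, ‖fderiv ℝ (f V) z - fderiv ℝ (f V) y‖ ≤ d * C * r ^ γ := by
    intro z hz
    rw [mem_closedBall_iff_norm] at hz
    refine (norm_clm_le_sum _).trans ?_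
    have : ∀ l ∈ (Finset.univ : Finset (Fin d)), ‖(fderiv ℝ (f V) z - fderiv ℝ (f V) y)
        (EuclideanSpace.single l 1)‖ ≤ C * r ^ γ := fun l _ =>
      ((h V hV).2.2 l z y).trans (by gcongr; linarith)
    refine (Finset.sum_le_card_nsmul _ _ _ this).trans (le_of_eq ?_)
    simp [mul_assoc]
  have h2 := (convex_closedBall y r).norm_image_sub_le_of_norm_fderiv_le' (𝕜 := ℝ)
    (fun z _ => (hfs V).differentiable (by simp) z) hb
    (Metric.mem_closedBall_self hr0) (mem_closedBall_iff_norm.2 le_rfl)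
  have h3 : ∑ l, pderivAt l (f V) y * multiMonomial [l] (x - y) = fderiv ℝ (f V) y (x - y) := by
    rw [clm_apply_eq_sum]
    refine Finset.sum_congr rfl fun l _ => ?_
    simp [multiMonomial, pderivAt, mul_comm]
  rw [h3, ← Real.norm_eq_abs]
  refine h2.trans ?_
  have h4 : r ^ γ * r ≤ r ^ (((1 : ℕ) : ℝ) + θ) * (1 + r) ^ 1 := by
    rcases hr0.eq_or_lt with h | h
    · rw [← h, mul_zero]; positivity
    · rw [pow_one, Nat.cast_one, Real.rpow_add h, Real.rpow_one, mul_comm, mul_assoc]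
      refine mul_le_mul_of_nonneg_left ?_ hr0
      have : r ^ γ = r ^ θ * r ^ (γ - θ) := by rw [← Real.rpow_add h]; simp
      rw [this]
      refine mul_le_mul_of_nonneg_left ?_ (by positivity)
      calc r ^ (γ - θ) ≤ (1 + r) ^ (γ - θ) := Real.rpow_le_rpow hr0 (by linarith) (by linarith)
        _ ≤ (1 + r) ^ (1 : ℝ) := Real.rpow_le_rpow_of_exponent_le (by linarith) (by linarith)
        _ = _ := Real.rpow_one _
  calc d * C * r ^ γ * ‖x - y‖ = d * C * (r ^ γ * r) := by rw [← hr]; ring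
    _ ≤ (d * C + C) * (r ^ (((1 : ℕ) : ℝ) + θ) * (1 + r) ^ 1) := by
        refine mul_le_mul (by linarith) h4 (by positivity) (by positivity)
    _ = _ := by ring

end Expansions

/-! ### The class of kernels stable under commutation, with a budget of transports. -/

section CommutatorKernels

variable {d : ℕ} {𝒱 : Set (Fin d → 𝓢(Rd d, ℝ))} {X Q : Set (Rd d)} {θ γ : ℝ} {n m : ℕ}
  {f g : (Fin d → 𝓢(Rd d, ℝ)) → Rd d → ℝ} {B B' : (Fin d → 𝓢(Rd d, ℝ)) → Rd d → Rd d → ℝ}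

/-- Polynomial growth of a smooth function and its derivatives of order at most `j`. -/
def UnifPolyDeriv (𝒱 : Set (Fin d → 𝓢(Rd d, ℝ))) (X : Set (Rd d)) :
    ℕ → ((Fin d → 𝓢(Rd d, ℝ)) → Rd d → ℝ) → Prop
  | 0, f => (∀ V, ContDiff ℝ ∞ (f V)) ∧ UnifPoly 𝒱 X f
  | j + 1, f => UnifPolyDeriv 𝒱 X j f ∧ ∀ l, UnifPolyDeriv 𝒱 X j fun V => pderivAt l (f V)

theorem UnifPolyDeriv.contDiff : ∀ {j f}, UnifPolyDeriv 𝒱 X j f → ∀ V, ContDiff ℝ ∞ (f V)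
  | 0, _, h => h.1
  | _ + 1, _, h => h.1.contDiff

theorem UnifPolyDeriv.unifPoly : ∀ {j f}, UnifPolyDeriv 𝒱 X j f → UnifPoly 𝒱 X f
  | 0, _, h => h.2
  | _ + 1, _, h => h.1.unifPoly

theorem UnifPolyDeriv.mono {Y : Set (Rd d)} (hXY : Y ⊆ X) :
    ∀ {j f}, UnifPolyDeriv 𝒱 X j f → UnifPolyDeriv 𝒱 Y j f
  | 0, _, h => ⟨h.1, h.2.mono hXY⟩
  | _ + 1, _, h => ⟨h.1.mono hXY, fun l => (h.2 l).mono hXY⟩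

theorem UnifPolyDeriv.add {j : ℕ} : ∀ {f g}, UnifPolyDeriv 𝒱 X j f → UnifPolyDeriv 𝒱 X j g →
    UnifPolyDeriv 𝒱 X j fun V x => f V x + g V x := by
  induction j with
  | zero => exact fun hf hg => ⟨fun V => (hf.1 V).add (hg.1 V), hf.2.add hg.2⟩
  | succ j ih =>
    refine fun hf hg => ⟨ih hf.1 hg.1, fun l => ?_⟩
    convert ih (hf.2 l) (hg.2 l) using 1
    ext V x
    exact pderivAt_add ((hf.contDiff V).differentiable (by simp) x)
      ((hg.contDiff V).differentiable (by simp) x) l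

theorem UnifPolyDeriv.mul {j : ℕ} : ∀ {f g}, UnifPolyDeriv 𝒱 X j f → UnifPolyDeriv 𝒱 X j g →
    UnifPolyDeriv 𝒱 X j fun V x => f V x * g V x := by
  induction j with
  | zero => exact fun hf hg => ⟨fun V => (hf.1 V).mul (hg.1 V), hf.2.mul hg.2⟩
  | succ j ih =>
    refine fun hf hg => ⟨ih hf.1 hg.1, fun l => ?_⟩
    convert (ih (hf.2 l) hg.1).add (ih hf.1 (hg.2 l)) using 1
    ext V x
    exact pderivAt_mul ((hf.contDiff V).differentiable (by simp) x)
      ((hg.contDiff V).differentiable (by simp) x) l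

theorem unifPolyDeriv_zero {j : ℕ} : UnifPolyDeriv 𝒱 X j fun _ _ => (0 : ℝ) := by
  induction j with
  | zero => exact ⟨fun _ => contDiff_const, UnifPoly.zero⟩
  | succ j ih =>
    refine ⟨ih, fun l => ?_⟩
    convert ih using 2
    ext x
    simp

theorem UnifPolyDeriv.sum {j : ℕ} {ι : Type*} (s : Finset ι)
    {f : ι → (Fin d → 𝓢(Rd d, ℝ)) → Rd d → ℝ} (hf : ∀ i ∈ s, UnifPolyDeriv 𝒱 X j (f i)) :
    UnifPolyDeriv 𝒱 X j fun V x => ∑ i ∈ s, f i V x := by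
  classical
  induction s using Finset.induction_on with
  | empty => simpa using unifPolyDeriv_zero
  | insert a s ha ih =>
    simp only [Finset.sum_insert ha]
    exact (hf a (by simp)).add (ih fun i hi => hf i (by simp [hi]))

theorem UnifPolyDeriv.vecDeriv {j : ℕ} (hf : UnifPolyDeriv 𝒱 X (j + 1) f)
    (hV : ∀ l, UnifPolyDeriv 𝒱 X j fun V => V l) :
    UnifPolyDeriv 𝒱 X j fun V => vecDeriv V (f V) :=
  UnifPolyDeriv.sum _ fun l _ => (hV l).mul (hf.2 l)

theorem UnifPolyDeriv.divField {j : ℕ} (hV : ∀ l, UnifPolyDeriv 𝒱 X (j + 1) fun V => V l) :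
    UnifPolyDeriv 𝒱 X j fun V => divField V :=
  UnifPolyDeriv.sum _ fun l _ => (hV l).2 l

theorem unifPolyDeriv_const (hQ : IsCompact Q) (j : ℕ) :
    ∀ {c : Rd d → ℝ}, ContDiff ℝ ∞ c → UnifPolyDeriv 𝒱 Q j fun _ => c := by
  induction j with
  | zero => exact fun hc => ⟨fun _ => hc, unifPoly_const hQ hc.continuous⟩
  | succ j ih => exact fun hc => ⟨ih hc, fun l => ih (hc.pderivAt l)⟩

theorem Function.HasTemperateGrowth.pderivAt {a : Rd d → ℝ} (ha : a.HasTemperateGrowth)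
    (l : Fin d) : (pderivAt l a).HasTemperateGrowth := by
  have h : (fderiv ℝ a).HasTemperateGrowth := by
    refine ⟨ha.1.fderiv_right (by simp), fun n => ?_⟩
    obtain ⟨k, C, h⟩ := ha.2 (n + 1)
    exact ⟨k, C, fun x => by rw [norm_iteratedFDeriv_fderiv]; exact h x⟩
  exact (ContinuousLinearMap.apply ℝ ℝ
    (EuclideanSpace.single l 1 : Rd d)).hasTemperateGrowth.comp h

theorem unifPolyDeriv_of_hasTemperateGrowth (j : ℕ) :
    ∀ {a : Rd d → ℝ}, a.HasTemperateGrowth → UnifPolyDeriv 𝒱 Set.univ j fun _ => a := by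
  induction j with
  | zero =>
    refine fun {a} ha => ⟨fun _ => ha.1, ?_⟩
    obtain ⟨k, C, h⟩ := ha.2 0
    refine ⟨|C|, k, abs_nonneg C, fun V _ x _ => ?_⟩
    have := h x
    rw [norm_iteratedFDeriv_zero, Real.norm_eq_abs] at this
    exact this.trans (by gcongr; exact le_abs_self C)
  | succ j ih => exact fun ha => ⟨ih ha, fun l => ih (ha.pderivAt l)⟩

/-- Families of smooth coefficients that expand to order `n`, together with their images under at
most `j` transports. -/
def SmoothExpands (𝒱 : Set (Fin d → 𝓢(Rd d, ℝ))) (Q : Set (Rd d)) (θ : ℝ) (n : ℕ) :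
    ℕ → ((Fin d → 𝓢(Rd d, ℝ)) → Rd d → Rd d → ℝ) → Prop
  | 0, B => (∀ V, ContDiff ℝ ∞ (Function.uncurry (B V))) ∧ Expands 𝒱 Q θ n B
  | j + 1, B => SmoothExpands 𝒱 Q θ n j B ∧ SmoothExpands 𝒱 Q θ n j fun V => transport V (B V)

theorem SmoothExpands.contDiff :
    ∀ {j B}, SmoothExpands 𝒱 Q θ n j B → ∀ V, ContDiff ℝ ∞ (Function.uncurry (B V))
  | 0, _, h => h.1
  | _ + 1, _, h => h.1.contDiff

theorem SmoothExpands.expands : ∀ {j B}, SmoothExpands 𝒱 Q θ n j B → Expands 𝒱 Q θ n B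
  | 0, _, h => h.2
  | _ + 1, _, h => h.1.expands

theorem SmoothExpands.add {j : ℕ} : ∀ {B B'}, SmoothExpands 𝒱 Q θ n j B →
    SmoothExpands 𝒱 Q θ n j B' → SmoothExpands 𝒱 Q θ n j fun V x y => B V x y + B' V x y := by
  induction j with
  | zero => exact fun hB hB' => ⟨fun V => (hB.1 V).add (hB'.1 V), hB.2.add hB'.2⟩
  | succ j ih =>
    refine fun hB hB' => ⟨ih hB.1 hB'.1, ?_⟩
    convert ih hB.2 hB'.2 using 1
    ext V x y
    exact transport_add V (hB.contDiff V) (hB'.contDiff V) x y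

theorem SmoothExpands.mul (h0 : 0 ≤ θ) (h1 : θ ≤ 1) {j : ℕ} : ∀ {B B'},
    SmoothExpands 𝒱 Q θ n j B → SmoothExpands 𝒱 Q θ m j B' →
      SmoothExpands 𝒱 Q θ (n + m) j fun V x y => B V x y * B' V x y := by
  induction j with
  | zero => exact fun hB hB' => ⟨fun V => (hB.1 V).mul (hB'.1 V), hB.2.mul h0 h1 hB'.2⟩
  | succ j ih =>
    refine fun hB hB' => ⟨ih hB.1 hB'.1, ?_⟩
    convert (ih hB.2 hB'.1).add (ih hB.1 hB'.2) using 1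
    ext V x y
    exact transport_mul V (hB.contDiff V) (hB'.contDiff V) x y

/-- Each transport replaces `f` by `V f` and costs one derivative, and freezing at `y` costs a last
one: hence the budget `j + 1`. -/
theorem smoothExpands_fst (h0 : 0 ≤ θ) (h1 : θ ≤ 1) (hQ : IsCompact Q) {j : ℕ} : ∀ {f},
    UnifPolyDeriv 𝒱 Set.univ (j + 1) f → (∀ l, UnifPolyDeriv 𝒱 Set.univ j fun V => V l) →
      SmoothExpands 𝒱 Q θ 0 j fun V x _ => f V x := by
  induction j with
  | zero =>
    exact fun hf _ => ⟨fun V => (hf.contDiff V).comp contDiff_fst,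
      expands_fst h0 h1 hQ hf.contDiff hf.unifPoly fun l => (hf.2 l).unifPoly⟩
  | succ j ih =>
    refine fun hf hV => ⟨ih hf.1 fun l => (hV l).1, ?_⟩
    convert ih (hf.vecDeriv hV) fun l => (hV l).1 using 1
    ext V x y
    simp

/-- A function of `y` alone is its own expansion, so `j` derivatives suffice here, and only bounds
on `Q` matter. The field, introduced at the first transport, is differentiated at most `j - 1`
times. -/
theorem smoothExpands_snd (hQ : IsCompact Q) {j : ℕ} : ∀ {f},
    UnifPolyDeriv 𝒱 Q j f → (∀ l, UnifPolyDeriv 𝒱 Q (j - 1) fun V => V l) →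
      SmoothExpands 𝒱 Q θ 0 j fun V _ y => f V y := by
  induction j with
  | zero =>
    exact fun hf _ => ⟨fun V => (hf.contDiff V).comp contDiff_snd,
      expands_snd hQ hf.contDiff hf.unifPoly⟩
  | succ j ih =>
    refine fun {f} hf hV => ?_
    have hV' : ∀ l, UnifPolyDeriv 𝒱 Q (j - 1) fun V => V l := fun l => by
      cases j with
      | zero => exact hV l
      | succ j => exact (hV l).1
    refine ⟨ih hf.1 hV', ?_⟩
    convert ih (hf.vecDeriv hV) hV' using 1
    ext V x y
    simp

theorem UnifHolder.unifPolyDeriv (hf : UnifHolder 𝒱 γ f) : UnifPolyDeriv 𝒱 Set.univ 1 f := by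
  obtain ⟨hs, C, hC, h⟩ := hf
  refine ⟨⟨hs, C, 0, hC, fun V hV x _ => by simpa using (h V hV).1 x⟩, fun l =>
    ⟨fun V => (hs V).pderivAt l, C, 0, hC, fun V hV x _ => by simpa using (h V hV).2.1 l x⟩⟩

theorem UnifHolder.smoothExpands (h0 : 0 ≤ θ) (hθ : θ ≤ γ) (h1 : γ ≤ 1)
    (hf : UnifHolder 𝒱 γ f) : SmoothExpands 𝒱 Q θ 1 0 fun V x y => f V x - f V y :=
  ⟨fun V => ((hf.1 V).comp contDiff_fst).sub ((hf.1 V).comp contDiff_snd), hf.expands h0 hθ h1⟩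

/-- The transport of `V^l(x) - V^l(y)` splits as the sum over `m` of `(V^m(x) - V^m(y)) ∂_m V^l(x)`
and `V^m(y) (∂_m V^l(x) - ∂_m V^l(y))`, which again vanish to first order. The second term needs a
Hölder gradient of `∂_m V^l`; this is why the double commutator asks for `C^{2+γ}`. -/
theorem smoothExpands_sub_of_unifHolder_pderivAt (h0 : 0 ≤ θ) (hθ : θ ≤ γ) (h1 : γ ≤ 1)
    (hQ : IsCompact Q) (hV : ∀ l, UnifHolder 𝒱 γ fun V => V l)
    (hdV : ∀ l m, UnifHolder 𝒱 γ fun V => pderivAt m (V l)) (l : Fin d) :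
    SmoothExpands 𝒱 Q θ 1 1 fun V x y => V l x - V l y := by
  refine ⟨(hV l).smoothExpands h0 hθ h1, fun V => contDiff_transport V ((hV l).smoothExpands
    (Q := Q) h0 hθ h1 |>.contDiff V), ?_⟩
  have h : Expands 𝒱 Q θ 1 fun V x y => ∑ m, ((V m x - V m y) * pderivAt m (V l) x +
      V m y * (pderivAt m (V l) x - pderivAt m (V l) y)) := by
    refine Expands.sum _ fun m _ => Expands.add ?_ ?_
    · exact ((hV m).expands h0 hθ h1).mul h0 (hθ.trans h1)
        (expands_fst h0 (hθ.trans h1) hQ (hdV l m).1 (hdV l m).unifPolyDeriv.unifPoly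
          fun i => ((hdV l m).unifPolyDeriv.2 i).unifPoly)
    · have h2 := (expands_snd (θ := θ) hQ (hV m).1
        ((hV m).unifPolyDeriv.unifPoly.mono (Set.subset_univ Q))).mul h0 (hθ.trans h1)
        ((hdV l m).expands h0 hθ h1)
      rwa [zero_add] at h2
  convert h using 1
  ext V x y
  rw [transport_sub V (V l).contDiff_infty]
  simp only [vecDeriv, ← Finset.sum_sub_distrib]
  exact Finset.sum_congr rfl fun m _ => by ring

/-- Families of kernels `∑ B(x, y) (D^ν k)(x - y)`, with coefficients vanishing to order at least
`|ν| - 2` on the diagonal. -/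
def CommutatorKernel (𝒱 : Set (Fin d → 𝓢(Rd d, ℝ))) (Q : Set (Rd d)) (θ : ℝ) (j : ℕ)
    (κ : (Fin d → 𝓢(Rd d, ℝ)) → 𝓢(Rd d, ℝ) → Rd d → Rd d → ℝ) : Prop :=
  ∃ (S : Type) (_ : Fintype S) (n : S → ℕ) (ν : S → List (Fin d))
    (B : S → (Fin d → 𝓢(Rd d, ℝ)) → Rd d → Rd d → ℝ),
    (∀ s, (ν s).length ≤ n s + 2) ∧ (∀ s, SmoothExpands 𝒱 Q θ (n s) j (B s)) ∧
    ∀ V k, κ V k = fun x y => ∑ s, B s V x y * multiDeriv (ν s) k (x - y)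

theorem CommutatorKernel.add {j : ℕ} {κ κ' : (Fin d → 𝓢(Rd d, ℝ)) → 𝓢(Rd d, ℝ) → Rd d → Rd d → ℝ}
    (h : CommutatorKernel 𝒱 Q θ j κ) (h' : CommutatorKernel 𝒱 Q θ j κ') :
    CommutatorKernel 𝒱 Q θ j fun V k x y => κ V k x y + κ' V k x y := by
  obtain ⟨S, _, n, ν, B, hν, hB, h⟩ := h
  obtain ⟨S', _, n', ν', B', hν', hB', h'⟩ := h'
  refine ⟨S ⊕ S', inferInstance, Sum.elim n n', Sum.elim ν ν', Sum.elim B B', ?_, ?_, ?_⟩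
  · rintro (s | s); exacts [hν s, hν' s]
  · rintro (s | s); exacts [hB s, hB' s]
  · intro V k
    ext x y
    simp [h, h']

theorem SmoothExpands.commutatorKernel {j : ℕ} (hB : SmoothExpands 𝒱 Q θ n j B)
    {ν : List (Fin d)} (hν : ν.length ≤ n + 2) :
    CommutatorKernel 𝒱 Q θ j fun V k x y => B V x y * multiDeriv ν k (x - y) :=
  ⟨Unit, inferInstance, fun _ => n, fun _ => ν, fun _ => B, fun _ => hν, fun _ => hB,
    fun V k => by simp⟩

/-- A commutation spends one transport of the budget and preserves `|ν| ≤ n + 2`, because a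
derivative added to `ν` always comes with a factor `V^l(x) - V^l(y)`. -/
theorem CommutatorKernel.kernelLie (h0 : 0 ≤ θ) (h1 : θ ≤ 1) {j : ℕ}
    {κ : (Fin d → 𝓢(Rd d, ℝ)) → 𝓢(Rd d, ℝ) → Rd d → Rd d → ℝ}
    (h : CommutatorKernel 𝒱 Q θ (j + 1) κ)
    (hV : ∀ l, SmoothExpands 𝒱 Q θ 1 j fun V x y => V l x - V l y)
    (hdiv : SmoothExpands 𝒱 Q θ 0 j fun V _ y => divField V y) :
    CommutatorKernel 𝒱 Q θ j fun V k => kernelLie V (κ V k) := by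
  obtain ⟨S, _, n, ν, B, hν, hB, h⟩ := h
  -- Left indices: the field acts on the coefficient, together with the divergence term. Right
  -- indices: it acts on the convolution kernel through `∂_l`.
  refine ⟨S ⊕ (S × Fin d), inferInstance, Sum.elim n fun p => n p.1 + 1,
    Sum.elim ν fun p => p.2 :: ν p.1,
    Sum.elim (fun s V x y => transport V (B s V) x y + divField V y * B s V x y)
      fun p V x y => B p.1 V x y * (V p.2 x - V p.2 y), ?_, ?_, ?_⟩
  · rintro (s | p)
    · exact hν s
    · simpa using hν p.1
  · rintro (s | p)
    · have h2 := hdiv.mul h0 h1 (hB s).1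
      rw [zero_add] at h2
      exact (hB s).2.add h2
    · exact (hB p.1).1.mul h0 h1 (hV p.2)
  · intro V k
    ext x y
    beta_reduce
    rw [h, kernelLie_sum V (κ := fun s x y => B s V x y * multiDeriv (ν s) k (x - y)) fun s =>
      ((hB s).contDiff V).mul (contDiff_convolution_kernel (k.contDiff_infty.multiDeriv (ν s)))]
    simp only [kernelLie_mul_convolution V ((hB _).contDiff V) k.contDiff_infty]
    rw [Finset.sum_add_distrib]
    simp only [Fintype.sum_sum_type, Sum.elim_inl, Sum.elim_inr, Fintype.sum_prod_type]

end CommutatorKernels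

/-! ### Mean-zero products `z^μ D^ν k` and moments of dilations. -/

section Scaling

variable {d : ℕ}

theorem hasTemperateGrowth_coord (m : Fin d) : (fun z : Rd d => z m).HasTemperateGrowth :=
  (EuclideanSpace.proj m : Rd d →L[ℝ] ℝ).hasTemperateGrowth

/-- Multiplication of a Schwartz function by a coordinate. -/
noncomputable def schwartzCoordMul (m : Fin d) : 𝓢(Rd d, ℝ) →L[ℝ] 𝓢(Rd d, ℝ) :=
  SchwartzMap.smulLeftCLM ℝ fun z : Rd d => z m

@[simp] theorem schwartzCoordMul_apply (m : Fin d) (q : 𝓢(Rd d, ℝ)) (z : Rd d) :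
    schwartzCoordMul m q z = z m * q z := by
  rw [schwartzCoordMul, SchwartzMap.smulLeftCLM_apply_apply (hasTemperateGrowth_coord m)]
  rfl

/-- A partial derivative of a Schwartz function. -/
noncomputable def schwartzPderiv (l : Fin d) (q : 𝓢(Rd d, ℝ)) : 𝓢(Rd d, ℝ) :=
  LineDeriv.lineDerivOp (EuclideanSpace.single l (1 : ℝ)) q

@[simp] theorem schwartzPderiv_apply (l : Fin d) (q : 𝓢(Rd d, ℝ)) (z : Rd d) :
    schwartzPderiv l q z = pderivAt l q z :=
  SchwartzMap.lineDerivOp_apply_eq_fderiv _ _ _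

theorem coe_schwartzPderiv (l : Fin d) (q : 𝓢(Rd d, ℝ)) :
    (schwartzPderiv l q : Rd d → ℝ) = pderivAt l q :=
  funext fun z => schwartzPderiv_apply l q z

/-- The span of the derivatives of order `p` of Schwartz functions. -/
noncomputable def derivSpan (d : ℕ) : ℕ → Submodule ℝ 𝓢(Rd d, ℝ)
  | 0 => ⊤
  | p + 1 => Submodule.span ℝ {q | ∃ l, ∃ q' ∈ derivSpan d p, q = schwartzPderiv l q'}

theorem schwartzPderiv_mem_derivSpan {p : ℕ} {q : 𝓢(Rd d, ℝ)} (hq : q ∈ derivSpan d p)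
    (l : Fin d) : schwartzPderiv l q ∈ derivSpan d (p + 1) :=
  Submodule.subset_span ⟨l, q, hq, rfl⟩

theorem schwartzCoordMul_schwartzPderiv (m l : Fin d) (q : 𝓢(Rd d, ℝ)) :
    schwartzCoordMul m (schwartzPderiv l q) =
      schwartzPderiv l (schwartzCoordMul m q) - (if m = l then (1 : ℝ) else 0) • q := by
  ext z
  have h1 : (schwartzCoordMul m q : Rd d → ℝ) = fun z => z m * q z :=
    funext fun z => schwartzCoordMul_apply m q z
  have h2 : pderivAt l (fun z : Rd d => z m) z = if m = l then 1 else 0 := by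
    have : (fun z : Rd d => z m) = (EuclideanSpace.proj m : Rd d →L[ℝ] ℝ) := rfl
    rw [pderivAt, this, ContinuousLinearMap.fderiv]
    simp
  have h3 : DifferentiableAt ℝ (fun z : Rd d => z m) z :=
    (EuclideanSpace.proj m : Rd d →L[ℝ] ℝ).differentiableAt
  simp only [schwartzCoordMul_apply, schwartzPderiv_apply, sub_apply,
    smul_apply, smul_eq_mul]
  rw [h1, pderivAt_mul h3 q.differentiableAt, h2]
  ring

/-- Since `z_m ∂_l q = ∂_l (z_m q) - δ_{lm} q`, multiplication by a coordinate destroys at most one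
derivative. -/
theorem schwartzCoordMul_mem_derivSpan (m : Fin d) {p : ℕ} :
    ∀ {q : 𝓢(Rd d, ℝ)}, q ∈ derivSpan d (p + 1) → schwartzCoordMul m q ∈ derivSpan d p := by
  induction p with
  | zero => exact fun _ => Submodule.mem_top
  | succ p ih =>
    intro q hq
    refine Submodule.span_induction (p := fun q _ => schwartzCoordMul m q ∈ derivSpan d (p + 1))
      ?_ (by simp) (fun x y _ _ hx hy => by rw [map_add]; exact add_mem hx hy)
      (fun c x _ hx => by rw [map_smul]; exact Submodule.smul_mem _ _ hx) hq
    rintro _ ⟨l, q', hq', rfl⟩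
    rw [schwartzCoordMul_schwartzPderiv]
    exact sub_mem (schwartzPderiv_mem_derivSpan (ih hq') l) (Submodule.smul_mem _ _ hq')

theorem integral_eq_zero_of_mem_derivSpan {p : ℕ} {q : 𝓢(Rd d, ℝ)}
    (hq : q ∈ derivSpan d (p + 1)) : ∫ z, q z = 0 := by
  refine Submodule.span_induction (p := fun q _ => ∫ z, q z = 0) ?_ (by simp)
    (fun x y _ _ hx hy => ?_) (fun c x _ hx => ?_) hq
  · rintro _ ⟨l, q', -, rfl⟩
    have hi : Integrable (pderivAt l q') := by
      rw [← coe_schwartzPderiv]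
      exact (schwartzPderiv l q').integrable
    -- Integration by parts against the constant `1`.
    have h := integral_mul_fderiv_eq_neg_fderiv_mul_of_integrable (μ := volume)
      (f := fun _ : Rd d => (1 : ℝ)) (g := q') (v := EuclideanSpace.single l 1) (by simp)
      (by simp only [one_mul]; exact hi)
      (by simpa using q'.integrable (μ := volume))
      (fun _ _ => differentiableAt_const _) (fun _ _ => q'.differentiableAt)
    simpa [pderivAt] using h
  · simp only [add_apply]
    rw [integral_add x.integrable y.integrable, hx, hy, add_zero]
  · simp only [smul_apply]
    rw [integral_smul, hx, smul_zero]

theorem exists_schwartz_multiDeriv (k : 𝓢(Rd d, ℝ)) (ν : List (Fin d)) :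
    ∃ q ∈ derivSpan d ν.length, (q : Rd d → ℝ) = multiDeriv ν k := by
  induction ν with
  | nil => exact ⟨k, Submodule.mem_top, rfl⟩
  | cons l ν ih =>
    obtain ⟨q, hq, h⟩ := ih
    exact ⟨schwartzPderiv l q, schwartzPderiv_mem_derivSpan hq l, by
      rw [coe_schwartzPderiv, h]; rfl⟩

/-- The products `z^μ D^ν k` are Schwartz functions, of mean zero if `|μ| < |ν|`. -/
theorem exists_schwartz_multiMonomial_mul (k : 𝓢(Rd d, ℝ)) (μ ν : List (Fin d)) :
    ∃ q : 𝓢(Rd d, ℝ), (∀ z, q z = multiMonomial μ z * multiDeriv ν k z) ∧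
      (μ.length < ν.length → ∫ z, q z = 0) := by
  -- Here `p` counts the derivatives left over after the monomial has used up `|μ|` of them.
  have key : ∀ p (q₀ : 𝓢(Rd d, ℝ)), q₀ ∈ derivSpan d (p + μ.length) →
      ∃ q ∈ derivSpan d p, ∀ z, q z = multiMonomial μ z * q₀ z := by
    induction μ with
    | nil => exact fun p q₀ hq₀ => ⟨q₀, hq₀, fun z => by simp [multiMonomial]⟩
    | cons i μ ih =>
      intro p q₀ hq₀
      obtain ⟨q, hq, h⟩ := ih (p + 1) q₀ (by convert hq₀ using 1; simp; ring_nf)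
      exact ⟨schwartzCoordMul i q, schwartzCoordMul_mem_derivSpan i hq, fun z => by
        rw [schwartzCoordMul_apply, h]; simp [multiMonomial]; ring⟩
  obtain ⟨q₀, hq₀, h₀⟩ := exists_schwartz_multiDeriv k ν
  rcases lt_or_ge μ.length ν.length with hlt | hge
  -- The surplus `|ν| - |μ|` is written as a successor: one surviving derivative is what makes the
  -- integral vanish.
  · obtain ⟨q, hq, h⟩ := key ((ν.length - μ.length - 1) + 1) q₀ (by convert hq₀ using 1; congr 1; omega)
    exact ⟨q, fun z => by rw [h, h₀], fun _ => integral_eq_zero_of_mem_derivSpan hq⟩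
  · have : ∀ (μ : List (Fin d)), ∃ q : 𝓢(Rd d, ℝ), ∀ z, q z = multiMonomial μ z * q₀ z := by
      intro μ
      induction μ with
      | nil => exact ⟨q₀, fun z => by simp [multiMonomial]⟩
      | cons i μ ih =>
        obtain ⟨q, h⟩ := ih
        exact ⟨schwartzCoordMul i q, fun z => by
          rw [schwartzCoordMul_apply, h]; simp [multiMonomial]; ring⟩
    obtain ⟨q, h⟩ := this μ
    exact ⟨q, fun z => by rw [h, h₀], fun hlt => absurd hge (by omega)⟩

/-- The dilation `z ↦ k(z / r)`. -/
noncomputable def dilate (r : ℝ) (k : Rd d → ℝ) (z : Rd d) : ℝ := k (r⁻¹ • z)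

theorem exists_schwartz_dilate (k : 𝓢(Rd d, ℝ)) {r : ℝ} (hr : r ≠ 0) :
    ∃ q : 𝓢(Rd d, ℝ), (q : Rd d → ℝ) = dilate r k :=
  ⟨SchwartzMap.compCLMOfContinuousLinearEquiv ℝ
    (ContinuousLinearEquiv.smulLeft (M₁ := Rd d) (R₁ := ℝ) (Units.mk0 r⁻¹ (inv_ne_zero hr))) k, rfl⟩

theorem multiDeriv_dilate {k : Rd d → ℝ} (hk : ContDiff ℝ ∞ k) (r : ℝ) (ν : List (Fin d)) :
    multiDeriv ν (dilate r k) = fun z => r⁻¹ ^ ν.length * multiDeriv ν k (r⁻¹ • z) := by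
  induction ν with
  | nil => ext z; simp [multiDeriv, dilate]
  | cons l ν ih =>
    ext z
    have h1 : HasFDerivAt (fun z => r⁻¹ ^ ν.length * multiDeriv ν k (r⁻¹ • z))
        (r⁻¹ ^ ν.length • (fderiv ℝ (multiDeriv ν k) (r⁻¹ • z)).comp
          (r⁻¹ • ContinuousLinearMap.id ℝ (Rd d))) z :=
      (((hk.multiDeriv ν).differentiable (by simp) (r⁻¹ • z)).hasFDerivAt.comp z
        ((hasFDerivAt_id z).const_smul r⁻¹)).const_mul _
    rw [multiDeriv, ih, pderivAt, h1.fderiv]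
    simp [multiDeriv, pderivAt, pow_succ]
    ring

theorem integrable_one_add_norm_pow_mul (q : 𝓢(Rd d, ℝ)) (M : ℕ) :
    Integrable fun z => (1 + ‖z‖) ^ M * |q z| := by
  have h : Integrable fun z => 2 ^ M * (‖q z‖ + ‖z‖ ^ M * ‖q z‖) :=
    (q.integrable.norm.add (q.integrable_pow_mul volume M)).const_mul _
  refine h.mono' (by fun_prop) (Filter.Eventually.of_forall fun z => ?_)
  rw [Real.norm_of_nonneg (by positivity), ← Real.norm_eq_abs]
  have h2 : (1 + ‖z‖) ^ M ≤ 2 ^ M * (1 + ‖z‖ ^ M) := by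
    have := add_pow_le (zero_le_one) (norm_nonneg z) M
    rw [one_pow] at this
    refine this.trans ?_
    gcongr
    · norm_num
    · omega
  calc _ ≤ 2 ^ M * (1 + ‖z‖ ^ M) * ‖q z‖ := by gcongr
    _ = _ := by ring

theorem rpow_le_one_add_pow {r m : ℝ} (hr : 0 ≤ r) (hm : 0 ≤ m) {M : ℕ} (hM : m ≤ M) :
    r ^ m ≤ (1 + r) ^ M := by
  calc r ^ m ≤ (1 + r) ^ m := Real.rpow_le_rpow hr (by linarith) hm
    _ ≤ (1 + r) ^ (M : ℝ) := Real.rpow_le_rpow_of_exponent_le (by linarith) hM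
    _ = _ := Real.rpow_natCast _ _

/-- The weighted `L¹` norms of the derivatives of dilations. -/
theorem exists_moment_dilate_le (k : 𝓢(Rd d, ℝ)) (ν : List (Fin d)) {m : ℝ} (hm : 0 ≤ m) (N : ℕ) :
    ∃ C : ℝ, 0 ≤ C ∧ ∀ r : ℝ, 0 < r →
      Integrable (fun z => ‖z‖ ^ m * (1 + ‖z‖) ^ N * |multiDeriv ν (dilate r k) z|) ∧
      ∫ z, ‖z‖ ^ m * (1 + ‖z‖) ^ N * |multiDeriv ν (dilate r k) z| ≤
        C * r ^ ((d : ℝ) + m - ν.length) * (1 + r) ^ N := by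
  obtain ⟨q, -, hq⟩ := exists_schwartz_multiDeriv k ν
  have hi : Integrable fun z => ‖z‖ ^ m * (1 + ‖z‖) ^ N * |q z| := by
    refine (integrable_one_add_norm_pow_mul q (⌈m⌉₊ + N)).mono' ?_
      (Filter.Eventually.of_forall fun z => ?_)
    · have : Continuous fun z : Rd d => ‖z‖ ^ m := continuous_norm.rpow_const fun _ => Or.inr hm
      exact (by fun_prop : Continuous fun z => ‖z‖ ^ m * (1 + ‖z‖) ^ N * |q z|).aestronglyMeasurable
    · rw [Real.norm_of_nonneg (by positivity), pow_add]
      gcongr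
      exact rpow_le_one_add_pow (norm_nonneg z) hm (Nat.le_ceil m)
  refine ⟨∫ z, ‖z‖ ^ m * (1 + ‖z‖) ^ N * |q z|, integral_nonneg fun z => by positivity,
    fun r hr => ?_⟩
  -- With `z = r y` the moment gives `r^m`, the derivatives give `r^{-|ν|}`, and `1 + r|y| ≤ (1 +
  -- r)(1 + |y|)`; the Jacobian will supply `r^d`.
  have hpt : ∀ z : Rd d, ‖z‖ ^ m * (1 + ‖z‖) ^ N * |multiDeriv ν (dilate r k) z| ≤
      r ^ (m - ν.length) * (1 + r) ^ N *
        (‖r⁻¹ • z‖ ^ m * (1 + ‖r⁻¹ • z‖) ^ N * |q (r⁻¹ • z)|) := by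
    intro z
    rw [multiDeriv_dilate k.contDiff_infty, ← hq, abs_mul, abs_of_nonneg (by positivity)]
    set y := r⁻¹ • z
    have hz : ‖z‖ = r * ‖y‖ := by
      simp only [y, norm_smul, norm_inv, Real.norm_of_nonneg hr.le]
      field_simp
    rw [hz, Real.mul_rpow hr.le (norm_nonneg _), Real.rpow_sub hr, Real.rpow_natCast]
    have h1 : (1 + r * ‖y‖) ^ N ≤ ((1 + r) * (1 + ‖y‖)) ^ N := by
      gcongr
      nlinarith [norm_nonneg y]
    rw [mul_pow] at h1
    calc _ ≤ r ^ m * ‖y‖ ^ m * ((1 + r) ^ N * (1 + ‖y‖) ^ N) * (r⁻¹ ^ ν.length * |q y|) := by gcongr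
      _ = _ := by rw [inv_pow]; ring
  have hi2 : Integrable fun z : Rd d => r ^ (m - ν.length) * (1 + r) ^ N *
        (‖r⁻¹ • z‖ ^ m * (1 + ‖r⁻¹ • z‖) ^ N * |q (r⁻¹ • z)|) :=
    (hi.comp_smul (inv_ne_zero hr.ne')).const_mul _
  have hi3 : Integrable fun z => ‖z‖ ^ m * (1 + ‖z‖) ^ N * |multiDeriv ν (dilate r k) z| := by
    refine hi2.mono' ?_ (Filter.Eventually.of_forall fun z => ?_)
    · have h1 : Continuous fun z : Rd d => ‖z‖ ^ m := continuous_norm.rpow_const fun _ => Or.inr hm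
      have h2 : Continuous (multiDeriv ν (dilate r k)) := by
        rw [multiDeriv_dilate k.contDiff_infty, ← hq]
        fun_prop
      exact (by fun_prop : Continuous fun z =>
        ‖z‖ ^ m * (1 + ‖z‖) ^ N * |multiDeriv ν (dilate r k) z|).aestronglyMeasurable
    · rw [Real.norm_of_nonneg (by positivity)]
      exact hpt z
  refine ⟨hi3, (integral_mono hi3 hi2 hpt).trans (le_of_eq ?_)⟩
  rw [integral_const_mul, Measure.integral_comp_smul volume
    (fun z => ‖z‖ ^ m * (1 + ‖z‖) ^ N * |q z|) r⁻¹]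
  simp only [finrank_euclideanSpace, Fintype.card_fin, inv_pow, inv_inv, smul_eq_mul]
  rw [abs_of_nonneg (by positivity), add_sub_assoc, Real.rpow_add hr, Real.rpow_natCast]
  ring

end Scaling

/-! ### The `L² → H^{-θ}` bound at a single scale. -/

section ScaleEstimate

variable {d : ℕ} {𝒱 : Set (Fin d → 𝓢(Rd d, ℝ))} {Q : Set (Rd d)} {θ : ℝ} {h : 𝓢(Rd d, ℝ)}

/-- A family of kernels at scale `r` is, on `Q`, a sum of kernels `g(y) z^μ D^ν h_r(z)` with
`z = x - y` and `|ν| = |μ| + 2`, up to an error of convolution type of size `r^{d + θ - 2}`. -/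
def ScaleDecomposition (𝒱 : Set (Fin d → 𝓢(Rd d, ℝ))) (Q : Set (Rd d)) (θ : ℝ) (h : 𝓢(Rd d, ℝ))
    (K : (Fin d → 𝓢(Rd d, ℝ)) → ℝ → Rd d → Rd d → ℝ) : Prop :=
  ∃ (S : Type) (_ : Fintype S) (μ ν : S → List (Fin d))
    (g : S → (Fin d → 𝓢(Rd d, ℝ)) → Rd d → ℝ) (e : ℝ → Rd d → ℝ) (C : ℝ) (N : ℕ),
    0 ≤ C ∧ (∀ s, (ν s).length = (μ s).length + 2) ∧ (∀ s V, ContDiff ℝ ∞ (g s V)) ∧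
    (∀ s, ∀ V ∈ 𝒱, ∀ y ∈ Q, |g s V y| ≤ C) ∧
    (∀ r, 0 < r → Continuous (e r) ∧ (∀ z, 0 ≤ e r z) ∧ Integrable (e r) ∧
      ∫ z, e r z ≤ C * r ^ ((d : ℝ) + θ - 2) * (1 + r) ^ N) ∧
    ∀ V ∈ 𝒱, ∀ r, 0 < r → ∀ x, ∀ y ∈ Q, |K V r x y - ∑ s, multiMonomial (μ s) (x - y) *
      multiDeriv (ν s) (dilate r h) (x - y) * g s V y| ≤ e r (x - y)

theorem ScaleDecomposition.add {K K' : (Fin d → 𝓢(Rd d, ℝ)) → ℝ → Rd d → Rd d → ℝ}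
    (hK : ScaleDecomposition 𝒱 Q θ h K) (hK' : ScaleDecomposition 𝒱 Q θ h K') :
    ScaleDecomposition 𝒱 Q θ h fun V r x y => K V r x y + K' V r x y := by
  obtain ⟨S, _, μ, ν, g, e, C, N, hC, hμ, hg, hgC, he, hK⟩ := hK
  obtain ⟨S', _, μ', ν', g', e', C', N', hC', hμ', hg', hgC', he', hK'⟩ := hK'
  refine ⟨S ⊕ S', inferInstance, Sum.elim μ μ', Sum.elim ν ν', Sum.elim g g',
    fun r z => e r z + e' r z, C + C', N + N', by positivity, ?_, ?_, ?_, ?_, ?_⟩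
  · rintro (s | s); exacts [hμ s, hμ' s]
  · rintro (s | s); exacts [hg s, hg' s]
  · rintro (s | s) V hV y hy
    · exact (hgC s V hV y hy).trans (by linarith)
    · exact (hgC' s V hV y hy).trans (by linarith)
  · intro r hr
    obtain ⟨h1, h2, h3, h4⟩ := he r hr
    obtain ⟨h1', h2', h3', h4'⟩ := he' r hr
    refine ⟨h1.add h1', fun z => add_nonneg (h2 z) (h2' z), h3.add h3', ?_⟩
    rw [integral_add h3 h3', add_mul, add_mul]
    have hr1 : (1 : ℝ) ≤ 1 + r := by linarith
    refine add_le_add (h4.trans ?_) (h4'.trans ?_)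
    · exact mul_le_mul_of_nonneg_left (pow_le_pow_right₀ hr1 (by omega)) (by positivity)
    · exact mul_le_mul_of_nonneg_left (pow_le_pow_right₀ hr1 (by omega)) (by positivity)
  · intro V hV r hr x y hy
    simp only [Fintype.sum_sum_type, Sum.elim_inl, Sum.elim_inr]
    rw [add_sub_add_comm]
    exact (abs_add_le _ _).trans (add_le_add (hK V hV r hr x y hy) (hK' V hV r hr x y hy))

theorem scaleDecomposition_zero : ScaleDecomposition 𝒱 Q θ h fun _ _ _ _ => (0 : ℝ) :=
  ⟨Empty, inferInstance, Empty.elim, Empty.elim, Empty.elim, fun _ _ => 0, 0, 0, le_rfl,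
    by rintro ⟨⟩, by rintro ⟨⟩, by rintro ⟨⟩, by simp [continuous_const], by simp⟩

theorem ScaleDecomposition.sum {ι : Type*} (s : Finset ι)
    {K : ι → (Fin d → 𝓢(Rd d, ℝ)) → ℝ → Rd d → Rd d → ℝ}
    (hK : ∀ i ∈ s, ScaleDecomposition 𝒱 Q θ h (K i)) :
    ScaleDecomposition 𝒱 Q θ h fun V r x y => ∑ i ∈ s, K i V r x y := by
  classical
  induction s using Finset.induction_on with
  | empty => simpa using scaleDecomposition_zero
  | insert a s ha ih =>
    simp only [Finset.sum_insert ha]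
    exact (hK a (by simp)).add (ih fun i hi => hK i (by simp [hi]))

theorem continuous_moment (h : 𝓢(Rd d, ℝ)) (ν : List (Fin d)) {m : ℝ} (hm : 0 ≤ m) (N : ℕ)
    (r C : ℝ) :
    Continuous fun z => C * (‖z‖ ^ m * (1 + ‖z‖) ^ N * |multiDeriv ν (dilate r h) z|) := by
  have h1 : Continuous fun z : Rd d => ‖z‖ ^ m := continuous_norm.rpow_const fun _ => Or.inr hm
  have h2 : Continuous (multiDeriv ν (dilate r h)) := by
    rw [multiDeriv_dilate h.contDiff_infty]
    have := (h.contDiff_infty.multiDeriv ν).continuous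
    fun_prop
  fun_prop

/-- In the critical case `|ν| = n + 2` the Taylor polynomial gives the main terms, and the remainder
has moment exponent `d + (n + θ) - (n + 2)`. If `|ν| ≤ n + 1` no cancellation is needed and
everything is error: `r^{d+n-|ν|}` exceeds the target power by `r^{n-|ν|+2-θ}`, whose exponent lies
in `[0, n + 2]` and is absorbed by `(1 + r)^{n+2}`. -/
theorem Expands.scaleDecomposition (h0 : 0 < θ) (h1 : θ ≤ 1) {n : ℕ}
    {B : (Fin d → 𝓢(Rd d, ℝ)) → Rd d → Rd d → ℝ} (hB : Expands 𝒱 Q θ n B) {ν : List (Fin d)}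
    (hν : ν.length ≤ n + 2) :
    ScaleDecomposition 𝒱 Q θ h fun V r x y => B V x y * multiDeriv ν (dilate r h) (x - y) := by
  rcases hν.eq_or_lt with hν | hν
  · obtain ⟨S, _, μ, g, C, N, hC, hμ, hg, hgC, hB⟩ := hB
    obtain ⟨A, hA, hmom⟩ := exists_moment_dilate_le h ν (m := n + θ) (by positivity) N
    refine ⟨S, inferInstance, μ, fun _ => ν, g,
      fun r z => C * (‖z‖ ^ ((n : ℝ) + θ) * (1 + ‖z‖) ^ N * |multiDeriv ν (dilate r h) z|),
      C + C * A, N, by positivity, fun s => by rw [hν, hμ], hg,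
      fun s V hV y hy => (hgC s V hV y hy).trans (le_add_of_nonneg_right (by positivity)), ?_, ?_⟩
    · intro r hr
      refine ⟨continuous_moment h ν (by positivity) N r C, fun z => by positivity,
        (hmom r hr).1.const_mul C, ?_⟩
      rw [integral_const_mul]
      have h2 := (hmom r hr).2
      have h3 : (d : ℝ) + (n + θ) - ν.length = d + θ - 2 := by rw [hν]; push_cast; ring
      rw [h3] at h2
      calc _ ≤ C * (A * r ^ ((d : ℝ) + θ - 2) * (1 + r) ^ N) := by gcongr
        _ = C * A * r ^ ((d : ℝ) + θ - 2) * (1 + r) ^ N := by ring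
        _ ≤ _ := by gcongr; linarith
    · intro V hV r hr x y hy
      have h2 : B V x y * multiDeriv ν (dilate r h) (x - y) - ∑ s, multiMonomial (μ s) (x - y) *
          multiDeriv ν (dilate r h) (x - y) * g s V y =
          (B V x y - ∑ s, g s V y * multiMonomial (μ s) (x - y)) *
            multiDeriv ν (dilate r h) (x - y) := by
        rw [sub_mul, Finset.sum_mul]
        congr 1
        exact Finset.sum_congr rfl fun s _ => by ring
      beta_reduce
      rw [h2, abs_mul, ← mul_assoc, ← mul_assoc]
      exact mul_le_mul_of_nonneg_right (hB V hV x y hy) (abs_nonneg _)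
  · obtain ⟨C, N, hC, hB⟩ := hB.exists_le h0.le h1
    obtain ⟨A, hA, hmom⟩ := exists_moment_dilate_le h ν (m := n) (by positivity) N
    refine ⟨Empty, inferInstance, Empty.elim, Empty.elim, Empty.elim,
      fun r z => C * (‖z‖ ^ (n : ℝ) * (1 + ‖z‖) ^ N * |multiDeriv ν (dilate r h) z|),
      C * A, N + (n + 2), by positivity, by rintro ⟨⟩, by rintro ⟨⟩, by rintro ⟨⟩, ?_, ?_⟩
    · intro r hr
      refine ⟨continuous_moment h ν (by positivity) N r C, fun z => by positivity,
        (hmom r hr).1.const_mul C, ?_⟩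
      rw [integral_const_mul]
      have h2 := (hmom r hr).2
      have hl : (ν.length : ℝ) ≤ n + 1 := by exact_mod_cast (by omega : ν.length ≤ n + 1)
      have hl0 : (0 : ℝ) ≤ ν.length := by positivity
      have h3 : r ^ ((d : ℝ) + n - ν.length) ≤ r ^ ((d : ℝ) + θ - 2) * (1 + r) ^ (n + 2) := by
        rw [show (d : ℝ) + n - ν.length = (d + θ - 2) + (n - ν.length + 2 - θ) by ring,
          Real.rpow_add hr]
        refine mul_le_mul_of_nonneg_left ?_ (by positivity)
        exact rpow_le_one_add_pow hr.le (by linarith) (by push_cast; linarith)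
      calc _ ≤ C * (A * r ^ ((d : ℝ) + n - ν.length) * (1 + r) ^ N) := by gcongr
        _ ≤ C * (A * (r ^ ((d : ℝ) + θ - 2) * (1 + r) ^ (n + 2)) * (1 + r) ^ N) := by gcongr
        _ = _ := by rw [pow_add]; ring
    · intro V hV r hr x y hy
      beta_reduce
      rw [Finset.univ_eq_empty, Finset.sum_empty, sub_zero, abs_mul, Real.rpow_natCast,
        ← mul_assoc, ← mul_assoc]
      exact mul_le_mul_of_nonneg_right (hB V hV x y hy) (abs_nonneg _)

/-- The bound from `L²` to `H^{-θ}` for a commutator kernel at scale `r`. -/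
theorem CommutatorKernel.exists_sobolevNorm_le (h0 : 0 < θ) (h1 : θ ≤ 1)
    {κ : (Fin d → 𝓢(Rd d, ℝ)) → 𝓢(Rd d, ℝ) → Rd d → Rd d → ℝ}
    (hκ : CommutatorKernel 𝒱 Q θ 0 κ) (h : 𝓢(Rd d, ℝ)) :
    ∃ (C : ℝ) (N : ℕ), 0 ≤ C ∧ ∀ V ∈ 𝒱, ∀ r, 0 < r → ∀ k : 𝓢(Rd d, ℝ), (k : Rd d → ℝ) = dilate r h →
      ∀ u : Rd d → ℂ, ContDiff ℝ ∞ u → HasCompactSupport u → tsupport u ⊆ Q →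
        ∀ F : 𝓢(Rd d, ℂ), (∀ x, F x = ∫ y, κ V k x y • u y) →
          sobolevNorm (-θ) F ≤
            ENNReal.ofReal (C * r ^ ((d : ℝ) + θ - 2) * (1 + r) ^ N) * eLpNorm u 2 volume := by
  obtain ⟨S₀, _, n, ν₀, B, hν₀, hB, hκ⟩ := hκ
  have hdec : ScaleDecomposition 𝒱 Q θ h fun V r x y =>
      ∑ s, B s V x y * multiDeriv (ν₀ s) (dilate r h) (x - y) :=
    ScaleDecomposition.sum _ fun s _ => (hB s).expands.scaleDecomposition h0 h1 (hν₀ s)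
  obtain ⟨S, _, μ, ν, g, e, C, N, hC, hμ, hg, hgC, he, hK⟩ := hdec
  choose A hA hmom using fun s => exists_moment_dilate_le h (ν s)
    (m := (μ s).length + θ) (by positivity) 0
  refine ⟨(∑ s, C * (4 * Real.pi * A s)) + C, N, ?_, ?_⟩
  · exact add_nonneg (Finset.sum_nonneg fun s _ => by have := hA s; positivity) hC
  intro V hV r hr k hk u hu hcs huQ F hF
  choose q hq hq0 using fun s => exists_schwartz_multiMonomial_mul k (μ s) (ν s)
  obtain ⟨e1, e2, e3, e4⟩ := he r hr
  have hle : ∀ s z, ‖z‖ ^ θ * |q s z| ≤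
      ‖z‖ ^ ((μ s).length + θ) * (1 + ‖z‖) ^ 0 * |multiDeriv (ν s) (dilate r h) z| := by
    intro s z
    rw [hq, ← hk, abs_mul, pow_zero, mul_one, Real.rpow_add_of_nonneg (norm_nonneg _)
      (by positivity) h0.le, Real.rpow_natCast]
    calc _ ≤ ‖z‖ ^ θ * (‖z‖ ^ (μ s).length * |multiDeriv (ν s) k z|) := by
          gcongr
          exact abs_multiMonomial_le _ _
      _ = _ := by ring
  have hqi : ∀ s, Integrable fun z => ‖z‖ ^ θ * |q s z| := fun s => by
    refine (hmom s r hr).1.mono' ?_ (Filter.Eventually.of_forall fun z => ?_)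
    · have : Continuous fun z : Rd d => ‖z‖ ^ θ := continuous_norm.rpow_const fun _ => Or.inr h0.le
      exact (by fun_prop : Continuous fun z => ‖z‖ ^ θ * |q s z|).aestronglyMeasurable
    · rw [Real.norm_of_nonneg (by positivity)]
      exact hle s z
  -- The exponent is `d + (|μ| + θ) - |ν|` with `|ν| = |μ| + 2`, the same as for the error.
  have hqle : ∀ s, ∫ z, ‖z‖ ^ θ * |q s z| ≤ A s * r ^ ((d : ℝ) + θ - 2) := fun s => by
    refine (integral_mono (hqi s) (hmom s r hr).1 (hle s)).trans ((hmom s r hr).2.trans_eq ?_)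
    rw [pow_zero, mul_one, hμ]
    congr 2
    push_cast; ring
  have hκc : ∀ x, Continuous (κ V k x) := fun x => by
    rw [hκ]
    refine continuous_finsetSum _ fun s _ => Continuous.mul ?_ ?_
    · exact ((hB s).contDiff V).continuous.comp (Continuous.prodMk_right x)
    · exact (k.contDiff_infty.multiDeriv (ν₀ s)).continuous.comp (by fun_prop)
  refine (sobolevNorm_le_of_kernel h0.le h1 hu hcs huQ F (κ V k) hκc hF q (fun s => g s V)
    (fun s => hg s V) hC (fun s => hgC s V hV) (fun s => hq0 s (by rw [hμ]; omega)) hqi e1 e2 e3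
    fun x y hy => ?_).trans ?_
  · have := hK V hV r hr x y hy
    rw [hκ]
    simp only [hq, hk]
    exact this
  · gcongr
    have hr1 : (1 : ℝ) ≤ (1 + r) ^ N := one_le_pow₀ (by linarith)
    rw [add_mul, add_mul, Finset.sum_mul, Finset.sum_mul]
    refine add_le_add (Finset.sum_le_sum fun s _ => ?_) e4
    have := hA s
    calc _ ≤ C * (4 * Real.pi * (A s * r ^ ((d : ℝ) + θ - 2))) := by gcongr; exact hqle s
      _ = C * (4 * Real.pi * A s) * r ^ ((d : ℝ) + θ - 2) := by ring
      _ ≤ _ := le_mul_of_one_le_right (by positivity) hr1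

end ScaleEstimate

/-! ### Intermediate derivatives controlled by the Hölder norms. -/

section HolderNorms

variable {d : ℕ} {γ : ℝ}

theorem holderNormOf_le_coe {s : ℝ} {f : Rd d → ℝ} {R : ℝ≥0} (h : holderNormOf s f ≤ R) :
    (∀ x, |f x| ≤ R) ∧ ∀ σ : List (Fin d), σ.length = ⌊s⌋₊ → ∀ x y,
      |multiDeriv σ f x - multiDeriv σ f y| ≤ R * ‖x - y‖ ^ ((s - (⌊s⌋₊ : ℝ)).toNNReal : ℝ) := by
  constructor
  · intro x
    have h1 : ‖f x‖ₑ ≤ R := (le_iSup (fun x => ‖f x‖ₑ) x).trans (le_self_add.trans h)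
    rw [← ofReal_norm, ENNReal.ofReal_le_coe] at h1
    rwa [Real.norm_eq_abs] at h1
  · intro σ hσ x y
    have h1 : eHolderNorm (s - (⌊s⌋₊ : ℝ)).toNNReal (multiDeriv σ f) ≤ R :=
      (le_iSup (fun σ : {σ : List (Fin d) // σ.length = ⌊s⌋₊} =>
        eHolderNorm (s - (⌊s⌋₊ : ℝ)).toNNReal (multiDeriv σ.1 f)) ⟨σ, hσ⟩).trans
        (le_add_self.trans h)
    have h2 : MemHolder (s - (⌊s⌋₊ : ℝ)).toNNReal (multiDeriv σ f) :=
      eHolderNorm_lt_top.1 (h1.trans_lt ENNReal.coe_lt_top)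
    have h3 := h2.holderWith.nndist_le x y
    have h4 : nnHolderNorm (s - (⌊s⌋₊ : ℝ)).toNNReal (multiDeriv σ f) ≤ R := by
      rw [← ENNReal.coe_le_coe]
      exact coe_nnHolderNorm_le_eHolderNorm.trans h1
    have h5 := h3.trans (mul_le_mul_left h4 _)
    have h6 : ((nndist (multiDeriv σ f x) (multiDeriv σ f y) : ℝ≥0) : ℝ) ≤ _ := NNReal.coe_le_coe.2 h5
    rw [NNReal.coe_mul, NNReal.coe_rpow, coe_nndist, coe_nndist, dist_eq_norm, dist_eq_norm] at h6
    exact h6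

theorem exists_sub_eq_pderivAt {g : Rd d → ℝ} (hg : ContDiff ℝ ∞ g) (i : Fin d) (x : Rd d) :
    ∃ t ∈ Set.Ioo (0 : ℝ) 1, g (x + EuclideanSpace.single i 1) - g x =
      pderivAt i g (x + t • EuclideanSpace.single i 1) := by
  have hd : ∀ t : ℝ, HasDerivAt (fun t : ℝ => g (x + t • EuclideanSpace.single i 1))
      (pderivAt i g (x + t • EuclideanSpace.single i 1)) t := fun t => by
    have h1 : HasDerivAt (fun t : ℝ => x + t • (EuclideanSpace.single i 1 : Rd d))
        (EuclideanSpace.single i 1) t := by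
      simpa using ((hasDerivAt_id t).smul_const (EuclideanSpace.single i 1 : Rd d)).const_add x
    exact ((hg.differentiable (by simp)) _).hasFDerivAt.comp_hasDerivAt t h1
  obtain ⟨t, ht, h⟩ := exists_hasDerivAt_eq_slope _ _ (zero_lt_one' ℝ)
    (fun t _ => (hd t).continuousAt.continuousWithinAt) fun t _ => hd t
  exact ⟨t, ht, by simpa using h.symm⟩

theorem rpow_norm_le_two {z : Rd d} (hz : ‖z‖ ≤ 2) (h0 : 0 ≤ γ) (h1 : γ ≤ 1) : ‖z‖ ^ γ ≤ 2 := by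
  calc ‖z‖ ^ γ ≤ 2 ^ γ := by gcongr
    _ ≤ 2 ^ (1 : ℝ) := Real.rpow_le_rpow_of_exponent_le (by norm_num) h1
    _ = 2 := Real.rpow_one 2

/-- The Hölder norm contains only the sup of the function and the top seminorm. By the mean value
theorem over a unit step, the derivative is at most `2A` at some nearby point, and the seminorm
carries this bound back to `x`. -/
theorem abs_pderivAt_le {g : Rd d → ℝ} (hg : ContDiff ℝ ∞ g) {A H : ℝ} (hH : 0 ≤ H) (h0 : 0 ≤ γ)
    (h1 : γ ≤ 1) {i : Fin d} (hA : ∀ x, |g x| ≤ A)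
    (h : ∀ x y, |pderivAt i g x - pderivAt i g y| ≤ H * ‖x - y‖ ^ γ) (x : Rd d) :
    |pderivAt i g x| ≤ 2 * A + 2 * H := by
  obtain ⟨t, ht, h2⟩ := exists_sub_eq_pderivAt hg i x
  have h3 := h x (x + t • EuclideanSpace.single i 1)
  have h4 : ‖x - (x + t • (EuclideanSpace.single i 1 : Rd d))‖ ≤ 2 := by
    rw [sub_add_cancel_left, norm_neg, norm_smul, Real.norm_of_nonneg ht.1.le]
    simp only [PiLp.norm_single, norm_one, mul_one]
    linarith [ht.2]
  have h5 := mul_le_mul_of_nonneg_left (rpow_norm_le_two h4 h0 h1) hH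
  have h6 := hA (x + EuclideanSpace.single i 1)
  have h7 := hA x
  rw [← h2] at h3
  rw [abs_le] at *
  constructor <;> linarith

/-- The mixed second difference involves four values of `f`, hence `4A`, and equals the second
derivative at a point within distance `2`. -/
theorem abs_pderivAt_pderivAt_le {f : Rd d → ℝ} (hf : ContDiff ℝ ∞ f) {A H : ℝ} (hH : 0 ≤ H)
    (h0 : 0 ≤ γ) (h1 : γ ≤ 1) {i j : Fin d} (hA : ∀ x, |f x| ≤ A)
    (h : ∀ x y, |pderivAt j (pderivAt i f) x - pderivAt j (pderivAt i f) y| ≤ H * ‖x - y‖ ^ γ)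
    (x : Rd d) : |pderivAt j (pderivAt i f) x| ≤ 4 * A + 2 * H := by
  set e : Fin d → Rd d := fun i => EuclideanSpace.single i 1 with he
  have hq : ContDiff ℝ ∞ fun x => f (x + e j) - f x :=
    (hf.comp (contDiff_id.add contDiff_const)).sub hf
  obtain ⟨t, ht, h2⟩ := exists_sub_eq_pderivAt hq i x
  have hq' : ∀ x, pderivAt i (fun x => f (x + e j) - f x) x =
      pderivAt i f (x + e j) - pderivAt i f x := fun x => by
    have h3 : DifferentiableAt ℝ (fun x => f (x + e j)) x :=
      ((hf.differentiable (by simp)) _).comp x (by fun_prop)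
    rw [pderivAt, fderiv_fun_sub h3 ((hf.differentiable (by simp)) x), fderiv_comp_add_right]
    rfl
  obtain ⟨s, hs, h3⟩ := exists_sub_eq_pderivAt (hf.pderivAt i) j (x + t • EuclideanSpace.single i 1)
  rw [hq', h3] at h2
  have h4 := h x (x + t • EuclideanSpace.single i 1 + s • EuclideanSpace.single j 1)
  rw [← h2] at h4
  have h5 : ‖x - (x + t • (EuclideanSpace.single i 1 : Rd d) +
      s • (EuclideanSpace.single j 1 : Rd d))‖ ≤ 2 := by
    rw [add_assoc, sub_add_cancel_left, norm_neg]
    refine (norm_add_le _ _).trans ?_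
    rw [norm_smul, norm_smul, Real.norm_of_nonneg ht.1.le, Real.norm_of_nonneg hs.1.le]
    simp only [PiLp.norm_single, norm_one, mul_one]
    linarith [ht.2, hs.2]
  have h6 := mul_le_mul_of_nonneg_left (rpow_norm_le_two h5 h0 h1) hH
  have h7 := hA (x + EuclideanSpace.single i 1 + e j)
  have h8 := hA (x + EuclideanSpace.single i 1)
  have h9 := hA (x + e j)
  have h10 := hA x
  rw [abs_le] at *
  constructor <;> linarith

theorem abs_sub_le_of_abs_pderivAt_le {g : Rd d → ℝ} (hg : ContDiff ℝ ∞ g) {C : ℝ}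
    (h : ∀ l x, |pderivAt l g x| ≤ C) (x y : Rd d) : |g x - g y| ≤ d * C * ‖x - y‖ := by
  refine Convex.norm_image_sub_le_of_norm_fderiv_le (𝕜 := ℝ) (s := Set.univ)
    (fun z _ => hg.differentiable (by simp) z) (fun z _ => ?_) convex_univ trivial trivial
  refine (norm_clm_le_sum _).trans ?_
  refine (Finset.sum_le_sum fun l _ => h l z).trans ?_
  simp

/-- The Lipschitz bound serves for `‖x - y‖ ≤ 1`, the sup bound beyond. -/
theorem abs_sub_le_rpow {g : Rd d → ℝ} (h0 : 0 ≤ γ) (h1 : γ ≤ 1) {A L : ℝ} (hA : ∀ x, |g x| ≤ A)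
    (hL : ∀ x y, |g x - g y| ≤ L * ‖x - y‖) (hL0 : 0 ≤ L) (x y : Rd d) :
    |g x - g y| ≤ (2 * A + L) * ‖x - y‖ ^ γ := by
  have hA0 : 0 ≤ A := (abs_nonneg _).trans (hA x)
  rcases le_total ‖x - y‖ 1 with h | h
  · refine (hL x y).trans (mul_le_mul (by linarith) ?_ (norm_nonneg _) (by positivity))
    rcases (norm_nonneg (x - y)).eq_or_lt with h2 | h2
    · rw [← h2]; positivity
    · simpa using Real.rpow_le_rpow_of_exponent_ge h2 h h1
  · have h2 : 1 ≤ ‖x - y‖ ^ γ := Real.one_le_rpow h h0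
    calc |g x - g y| ≤ 2 * A := (abs_sub _ _).trans (by linarith [hA x, hA y])
      _ ≤ (2 * A + L) * 1 := by linarith
      _ ≤ _ := by gcongr

theorem unifHolder_of_fieldHolderNorm_one_add {R : ℝ≥0} (h0 : 0 < γ) (h1 : γ < 1) (l : Fin d) :
    UnifHolder {V : Fin d → 𝓢(Rd d, ℝ) | fieldHolderNorm (1 + γ) V ≤ R} γ fun V => V l := by
  have hfl : ⌊1 + γ⌋₊ = 1 := by rw [Nat.floor_eq_iff (by linarith)]; norm_num; constructor <;> linarith
  refine ⟨fun V => (V l).contDiff_infty, 4 * R, by positivity, fun V hV => ?_⟩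
  obtain ⟨h2, h3⟩ := holderNormOf_le_coe ((le_iSup (fun l => holderNormOf (1 + γ) (V l)) l).trans hV)
  rw [hfl, Nat.cast_one, add_sub_cancel_left, Real.coe_toNNReal γ h0.le] at h3
  have hR : (0 : ℝ) ≤ R := R.2
  refine ⟨fun x => (h2 x).trans (by linarith), fun m x => ?_, fun m x y => ?_⟩
  · exact (abs_pderivAt_le (V l).contDiff_infty hR h0.le h1.le h2 (h3 [m] rfl) x).trans
      (by linarith)
  · exact (h3 [m] rfl x y).trans (by gcongr; linarith)

theorem unifHolder_of_fieldHolderNorm_two_add {R : ℝ≥0} (h0 : 0 < γ) (h1 : γ < 1) (l : Fin d) :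
    UnifHolder {V : Fin d → 𝓢(Rd d, ℝ) | fieldHolderNorm (2 + γ) V ≤ R} γ (fun V => V l) ∧
      ∀ m, UnifHolder {V : Fin d → 𝓢(Rd d, ℝ) | fieldHolderNorm (2 + γ) V ≤ R} γ
        fun V => pderivAt m (V l) := by
  have hfl : ⌊2 + γ⌋₊ = 2 := by rw [Nat.floor_eq_iff (by linarith)]; norm_num; constructor <;> linarith
  have hR : (0 : ℝ) ≤ R := R.2
  have key : ∀ V : Fin d → 𝓢(Rd d, ℝ), fieldHolderNorm (2 + γ) V ≤ R →
      (∀ x, |V l x| ≤ R) ∧ (∀ m x, |pderivAt m (V l) x| ≤ (2 + 12 * d) * R) ∧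
      (∀ m n x, |pderivAt n (pderivAt m (V l)) x| ≤ 6 * R) ∧
      ∀ m n x y, |pderivAt n (pderivAt m (V l)) x - pderivAt n (pderivAt m (V l)) y| ≤
        R * ‖x - y‖ ^ γ := fun V hV => by
    obtain ⟨h2, h3⟩ :=
      holderNormOf_le_coe ((le_iSup (fun l => holderNormOf (2 + γ) (V l)) l).trans hV)
    rw [hfl, Nat.cast_two, add_sub_cancel_left, Real.coe_toNNReal γ h0.le] at h3
    have h4 : ∀ m n x, |pderivAt n (pderivAt m (V l)) x| ≤ 6 * R := fun m n x =>
      (abs_pderivAt_pderivAt_le (V l).contDiff_infty hR h0.le h1.le h2 (h3 [n, m] rfl) x).trans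
        (by linarith)
    refine ⟨h2, fun m x => ?_, h4, fun m n => h3 [n, m] rfl⟩
    have h5 := abs_sub_le_of_abs_pderivAt_le ((V l).contDiff_infty.pderivAt m) (h4 m)
    -- The bounded second derivatives make the gradient Lipschitz, so the first-order interpolation
    -- applies with exponent `1`, giving `2R + 12dR`.
    refine (abs_pderivAt_le (γ := 1) (H := d * (6 * R)) (V l).contDiff_infty (by positivity)
      zero_le_one le_rfl h2 (fun x y => by rw [Real.rpow_one]; exact h5 x y) x).trans_eq (by ring)
  -- `(4 + 30d)R` is `2A + L` with `A = (2 + 12d)R` and `L = 6dR`.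
  refine ⟨⟨fun V => (V l).contDiff_infty, (4 + 30 * d) * R, by positivity, fun V hV => ?_⟩,
    fun m => ⟨fun V => (V l).contDiff_infty.pderivAt m, (6 + 12 * d) * R, by positivity,
      fun V hV => ?_⟩⟩
  · obtain ⟨k1, k2, k3, k4⟩ := key V hV
    have hd : 0 ≤ (d : ℝ) * R := by positivity
    refine ⟨fun x => (k1 x).trans (by linarith), fun m x => (k2 m x).trans (by linarith),
      fun m x y => ?_⟩
    refine (abs_sub_le_rpow h0.le h1.le (k2 m) (abs_sub_le_of_abs_pderivAt_le
      ((V l).contDiff_infty.pderivAt m) (k3 m)) (by positivity) x y).trans ?_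
    gcongr
    linarith
  · obtain ⟨k1, k2, k3, k4⟩ := key V hV
    have hd : 0 ≤ (d : ℝ) * R := by positivity
    refine ⟨fun x => (k2 m x).trans (by linarith), fun n x => (k3 m n x).trans (by linarith),
      fun n x y => (k4 m n x y).trans ?_⟩
    gcongr
    linarith

end HolderNorms

/-! ### Single-scale bounds for the two commutators. -/

section OperatorBounds

variable {d : ℕ} {𝒱 : Set (Fin d → 𝓢(Rd d, ℝ))} {Q : Set (Rd d)} {θ γ : ℝ} {a b : Rd d → ℝ}

/-- The starting point: coefficients `a(x) c(y)` of vanishing order `0` against at most two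
derivatives of `k`. The growth of derivatives of `a` is harmless, since expansions tolerate
polynomial growth in `x - y`. -/
theorem commutatorKernel_kernelOp (h0 : 0 ≤ θ) (h1 : θ ≤ 1) (hQ : IsCompact Q)
    (ha : a.HasTemperateGrowth) (hb : ContDiff ℝ ∞ b) (i j : Fin d) (n : ℕ)
    (hV : ∀ l, UnifPolyDeriv 𝒱 Set.univ n fun V => V l) :
    CommutatorKernel 𝒱 Q θ n fun _ k x y =>
      a x * b y * multiDeriv [j, i] k (x - y) + a x * -pderivAt j b y * multiDeriv [i] k (x - y) +
        (a x * -pderivAt i b y * multiDeriv [j] k (x - y) +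
          a x * pderivAt j (pderivAt i b) y * multiDeriv [] k (x - y)) := by
  have hV' : ∀ l, UnifPolyDeriv 𝒱 Q (n - 1) fun V => V l := fun l => by
    have := (hV l).mono (Set.subset_univ Q)
    cases n with
    | zero => exact this
    | succ n => exact this.1
  have key : ∀ {c : Rd d → ℝ}, ContDiff ℝ ∞ c → ∀ {ν : List (Fin d)}, ν.length ≤ 2 →
      CommutatorKernel 𝒱 Q θ n fun _ k x y => a x * c y * multiDeriv ν k (x - y) := by
    intro c hc ν hν
    have h2 := (smoothExpands_fst h0 h1 hQ (unifPolyDeriv_of_hasTemperateGrowth (n + 1) ha) hV).mul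
      h0 h1 (smoothExpands_snd hQ (unifPolyDeriv_const hQ n hc) hV')
    exact h2.commutatorKernel (by omega)
  exact ((key hb le_rfl).add (key (hb.pderivAt j).neg (by simp))).add
    ((key (hb.pderivAt i).neg (by simp)).add (key ((hb.pderivAt i).pderivAt j) (by simp)))

theorem exists_sobolevNorm_opComm_le (h0 : 0 < θ) (hθ : θ ≤ γ) (h1 : γ ≤ 1) (hQ : IsCompact Q)
    (ha : a.HasTemperateGrowth) (hb : ContDiff ℝ ∞ b) (i j : Fin d)
    (hV : ∀ l, UnifHolder 𝒱 γ fun V => V l) (h : 𝓢(Rd d, ℝ)) :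
    ∃ (C : ℝ) (N : ℕ), 0 ≤ C ∧ ∀ V ∈ 𝒱, ∀ r, 0 < r → ∀ k : 𝓢(Rd d, ℝ), (k : Rd d → ℝ) = dilate r h →
      ∀ u : Rd d → ℂ, ContDiff ℝ ∞ u → HasCompactSupport u → tsupport u ⊆ Q →
        ∀ F : 𝓢(Rd d, ℂ), (F : Rd d → ℂ) = opComm (fieldOp V) (kernelOp a b k i j) u →
          sobolevNorm (-θ) F ≤
            ENNReal.ofReal (C * r ^ ((d : ℝ) + θ - 2) * (1 + r) ^ N) * eLpNorm u 2 volume := by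
  have hV1 := fun l => (hV l).unifPolyDeriv
  have hκ := (commutatorKernel_kernelOp (Q := Q) h0.le (hθ.trans h1) hQ ha hb i j 1 hV1).kernelLie
    h0.le (hθ.trans h1) (fun l => (hV l).smoothExpands h0.le hθ h1)
    (smoothExpands_snd hQ (UnifPolyDeriv.divField fun l => (hV1 l).mono (Set.subset_univ Q))
      fun l => ((hV1 l).mono (Set.subset_univ Q)).1)
  obtain ⟨C, N, hC, hle⟩ := hκ.exists_sobolevNorm_le h0 (hθ.trans h1) h
  refine ⟨C, N, hC, fun V hVV r hr k hk u hu hcs huQ F hF => hle V hVV r hr k hk u hu hcs huQ F ?_⟩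
  intro x
  rw [hF]
  exact ((hasKernel_kernelOp ha.1 hb k.contDiff_infty i j).opComm V).2 u hu hcs x

/-- The stability of the kernel class is applied twice, from a budget of two transports. In the
first application `V^l(x) - V^l(y)` must itself survive a transport; in the second its expansion
alone is enough. -/
theorem exists_sobolevNorm_opComm_opComm_le (h0 : 0 < θ) (hθ : θ ≤ γ) (h1 : γ ≤ 1)
    (hQ : IsCompact Q) (ha : a.HasTemperateGrowth) (hb : ContDiff ℝ ∞ b) (i j : Fin d)
    (hV : ∀ l, UnifHolder 𝒱 γ fun V => V l)
    (hdV : ∀ l m, UnifHolder 𝒱 γ fun V => pderivAt m (V l)) (h : 𝓢(Rd d, ℝ)) :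
    ∃ (C : ℝ) (N : ℕ), 0 ≤ C ∧ ∀ V ∈ 𝒱, ∀ r, 0 < r → ∀ k : 𝓢(Rd d, ℝ), (k : Rd d → ℝ) = dilate r h →
      ∀ u : Rd d → ℂ, ContDiff ℝ ∞ u → HasCompactSupport u → tsupport u ⊆ Q →
        ∀ F : 𝓢(Rd d, ℂ), (F : Rd d → ℂ) =
            opComm (fieldOp V) (opComm (fieldOp V) (kernelOp a b k i j)) u →
          sobolevNorm (-θ) F ≤
            ENNReal.ofReal (C * r ^ ((d : ℝ) + θ - 2) * (1 + r) ^ N) * eLpNorm u 2 volume := by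
  have h01 := hθ.trans h1
  have hV2 : ∀ l, UnifPolyDeriv 𝒱 Set.univ 2 fun V => V l := fun l =>
    ⟨(hV l).unifPolyDeriv, fun m => (hdV l m).unifPolyDeriv⟩
  have hV2Q := fun l => (hV2 l).mono (Set.subset_univ Q)
  have hκ := ((commutatorKernel_kernelOp (Q := Q) h0.le h01 hQ ha hb i j 2 hV2).kernelLie
    h0.le h01 (smoothExpands_sub_of_unifHolder_pderivAt h0.le hθ h1 hQ hV hdV)
    (smoothExpands_snd hQ (UnifPolyDeriv.divField hV2Q) fun l => (hV2Q l).1.1)).kernelLie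
    h0.le h01 (fun l => (hV l).smoothExpands h0.le hθ h1)
    (smoothExpands_snd hQ (UnifPolyDeriv.divField fun l => (hV2Q l).1) fun l => (hV2Q l).1.1)
  obtain ⟨C, N, hC, hle⟩ := hκ.exists_sobolevNorm_le h0 h01 h
  refine ⟨C, N, hC, fun V hVV r hr k hk u hu hcs huQ F hF => hle V hVV r hr k hk u hu hcs huQ F ?_⟩
  intro x
  rw [hF]
  exact (((hasKernel_kernelOp ha.1 hb k.contDiff_infty i j).opComm V).opComm V).2 u hu hcs x

end OperatorBounds

/-! ### The Gaussian as a Schwartz function. -/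

section Gaussian

/-- From `(1 + t)^M ≤ M! e^{1+t}` and `1 + t - πt² ≤ 2`. -/
theorem one_add_pow_mul_exp_neg_le (M : ℕ) {t : ℝ} (ht : 0 ≤ t) :
    (1 + t) ^ M * Real.exp (-Real.pi * t ^ 2) ≤ M.factorial * Real.exp 2 := by
  have h1 := Real.pow_div_factorial_le_exp (1 + t) (by linarith) M
  rw [div_le_iff₀ (by positivity)] at h1
  calc (1 + t) ^ M * Real.exp (-Real.pi * t ^ 2)
      ≤ Real.exp (1 + t) * M.factorial * Real.exp (-Real.pi * t ^ 2) := by gcongr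
    _ = M.factorial * Real.exp (1 + t + -Real.pi * t ^ 2) := by rw [Real.exp_add (1 + t)]; ring
    _ ≤ _ := by
      gcongr
      nlinarith [Real.pi_gt_three, sq_nonneg (t - 1), sq_nonneg t]

/-- The Gaussian is a Schwartz function. -/
theorem exists_schwartz_gaussian (d : ℕ) :
    ∃ g : 𝓢(Rd d, ℝ), ∀ x, g x = Real.exp (-Real.pi * ‖x‖ ^ 2) := by
  have hf : (fun x : Rd d => -Real.pi * ‖x‖ ^ 2).HasTemperateGrowth :=
    (Function.HasTemperateGrowth.const (-Real.pi)).mul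
      (Function.hasTemperateGrowth_norm_sq (Rd d))
  refine ⟨⟨fun x => Real.exp (-Real.pi * ‖x‖ ^ 2), Real.contDiff_exp.comp hf.1, fun k n => ?_⟩,
    fun x => rfl⟩
  obtain ⟨m, C, hC, h⟩ := hf.norm_iteratedFDeriv_le_uniform n
  refine ⟨n.factorial * (1 + C) ^ n * ((k + m * n).factorial * Real.exp 2), fun x => ?_⟩
  have h1 : (1 : ℝ) ≤ 1 + ‖x‖ := le_add_of_nonneg_right (norm_nonneg x)
  -- The composition estimate wants the `i`-th derivative of the exponent bounded by an `i`-th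
  -- power; replacing `C` by `1 + C` makes the base at least `1`, so one bound serves all `i ≥ 1`.
  have hle : ‖iteratedFDeriv ℝ n (Real.exp ∘ fun x : Rd d => -Real.pi * ‖x‖ ^ 2) x‖ ≤
      n.factorial * Real.exp (-Real.pi * ‖x‖ ^ 2) * ((1 + C) * (1 + ‖x‖) ^ m) ^ n := by
    refine norm_iteratedFDeriv_comp_le Real.contDiff_exp hf.1 (mod_cast le_top) x
      (fun i _ => ?_) fun i hi hin => ?_
    · rw [norm_iteratedFDeriv_eq_norm_iteratedDeriv, iteratedDeriv_eq_iterate, Real.iter_deriv_exp,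
        Real.norm_of_nonneg (Real.exp_pos _).le]
    · refine (h i hin x).trans ?_
      have h2 : 1 ≤ (1 + C) * (1 + ‖x‖) ^ m := by
        have := one_le_pow₀ (n := m) h1
        nlinarith
      calc C * (1 + ‖x‖) ^ m ≤ (1 + C) * (1 + ‖x‖) ^ m := by gcongr; linarith
        _ ≤ _ := le_self_pow₀ h2 (by omega)
  calc _ ≤ (1 + ‖x‖) ^ k * (n.factorial * Real.exp (-Real.pi * ‖x‖ ^ 2) *
        ((1 + C) * (1 + ‖x‖) ^ m) ^ n) := by
        gcongr
        · linarith
        · exact hle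
    _ = n.factorial * (1 + C) ^ n *
        ((1 + ‖x‖) ^ (k + m * n) * Real.exp (-Real.pi * ‖x‖ ^ 2)) := by
        rw [mul_pow, ← pow_mul, pow_add]; ring
    _ ≤ _ := by
        exact mul_le_mul_of_nonneg_left (one_add_pow_mul_exp_neg_le _ (norm_nonneg x))
          (by positivity)

end Gaussian

/-! ### Kernels of class `𝒥_α` as superpositions of dilations. -/

section ScaleIntegral

variable {d : ℕ} {E : Type*} [NormedAddCommGroup E] [NormedSpace ℝ E]

/-- The weight `w^s e^{-w/4π}`. -/
noncomputable def scaleWeight (s w : ℝ) : ℝ := w ^ s * Real.exp (-w / (4 * Real.pi))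

/-- The superposition `∫_0^∞ w^s e^{-w/4π} h(w^{-1/2} z) dw` of dilations of `h`. -/
noncomputable def scaleIntegral (h : Rd d → E) (s : ℝ) (z : Rd d) : E :=
  ∫ w in Set.Ioi (0 : ℝ), scaleWeight s w • h ((√w)⁻¹ • z)

theorem measurable_scaleWeight (s : ℝ) : Measurable (scaleWeight s) := by
  unfold scaleWeight; fun_prop

theorem scaleWeight_nonneg (s : ℝ) {w : ℝ} (hw : 0 ≤ w) : 0 ≤ scaleWeight s w := by
  unfold scaleWeight; positivity

theorem scaleWeight_add (s p : ℝ) {w : ℝ} (hw : 0 < w) :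
    scaleWeight (s + p) w = w ^ p * scaleWeight s w := by
  rw [scaleWeight, scaleWeight, Real.rpow_add hw]; ring

theorem scaleWeight_mul_inv_sqrt (s : ℝ) {w : ℝ} (hw : 0 < w) :
    scaleWeight s w * (√w)⁻¹ = scaleWeight (s - 1 / 2) w := by
  rw [sub_eq_add_neg, scaleWeight_add _ _ hw, Real.sqrt_eq_rpow, Real.rpow_neg hw.le, mul_comm]

theorem scaleWeight_mul_sqrt (s : ℝ) {w : ℝ} (hw : 0 < w) :
    scaleWeight s w * √w = scaleWeight (s + 1 / 2) w := by
  rw [scaleWeight_add _ _ hw, Real.sqrt_eq_rpow, mul_comm]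

theorem integrableOn_scaleWeight {s : ℝ} (hs : -1 < s) :
    IntegrableOn (scaleWeight s) (Set.Ioi 0) := by
  have h := integrableOn_rpow_mul_exp_neg_mul_rpow hs zero_lt_one
    (by positivity : 0 < (4 * Real.pi)⁻¹)
  refine h.congr_fun (fun w _ => ?_) measurableSet_Ioi
  beta_reduce
  rw [scaleWeight, Real.rpow_one, neg_div, div_eq_inv_mul, neg_mul]

/-- Away from the origin, Schwartz decay of order `2N` becomes a factor `w^N`, which compensates any
negative power of `w` in the superposition. -/
theorem exists_norm_dilate_le (h : 𝓢(Rd d, E)) (N : ℕ) : ∃ C : ℝ, 0 ≤ C ∧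
    ∀ w, 0 < w → ∀ (δ : ℝ) (z : Rd d), 0 < δ → δ ≤ ‖z‖ →
      ‖h ((√w)⁻¹ • z)‖ ≤ C * (δ ^ (2 * N))⁻¹ * w ^ (N : ℝ) := by
  obtain ⟨C, hC, hle⟩ := h.decay (2 * N) 0
  refine ⟨C, hC.le, fun w hw δ z hδ hz => ?_⟩
  have h1 := hle ((√w)⁻¹ • z)
  rw [norm_iteratedFDeriv_zero, norm_smul, Real.norm_of_nonneg (by positivity), mul_pow, inv_pow,
    pow_mul √w, Real.sq_sqrt hw.le] at h1
  have h2 : δ ^ (2 * N) ≤ ‖z‖ ^ (2 * N) := by gcongr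
  rw [Real.rpow_natCast, mul_right_comm, ← div_eq_mul_inv, le_div_iff₀ (by positivity)]
  have h3 : 0 < w ^ N := by positivity
  calc _ ≤ ‖h ((√w)⁻¹ • z)‖ * ‖z‖ ^ (2 * N) := by gcongr
    _ = w ^ N * ((w ^ N)⁻¹ * ‖z‖ ^ (2 * N) * ‖h ((√w)⁻¹ • z)‖) := by field_simp
    _ ≤ w ^ N * C := by gcongr
    _ = _ := mul_comm _ _

theorem aestronglyMeasurable_scaleIntegrand (h : 𝓢(Rd d, E)) (s : ℝ) (z : Rd d) (μ : Measure ℝ) :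
    AEStronglyMeasurable (fun w => scaleWeight s w • h ((√w)⁻¹ • z)) μ := by
  refine (measurable_scaleWeight s).aestronglyMeasurable.smul ?_
  have h1 : Measurable fun w : ℝ => (√w)⁻¹ • z := by fun_prop
  exact (h.continuous.comp_stronglyMeasurable h1.stronglyMeasurable).aestronglyMeasurable

theorem exists_scaleIntegrand_bound (h : 𝓢(Rd d, E)) (s : ℝ) {δ : ℝ} (hδ : 0 < δ) :
    ∃ B : ℝ → ℝ, IntegrableOn B (Set.Ioi 0) ∧ ∀ w ∈ Set.Ioi (0 : ℝ), ∀ z : Rd d, δ ≤ ‖z‖ →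
      ‖scaleWeight s w • h ((√w)⁻¹ • z)‖ ≤ B w := by
  -- This choice makes `s + N > -1`, so the dominating weight is integrable at `0`.
  obtain ⟨N, hN⟩ := exists_nat_gt (-1 - s)
  obtain ⟨C, hC, hle⟩ := exists_norm_dilate_le h N
  refine ⟨fun w => C * (δ ^ (2 * N))⁻¹ * scaleWeight (s + N) w,
    (integrableOn_scaleWeight (by linarith)).const_mul _, fun w hw z hz => ?_⟩
  beta_reduce
  rw [norm_smul, Real.norm_of_nonneg (scaleWeight_nonneg s (le_of_lt hw)), scaleWeight_add _ _ hw]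
  calc _ ≤ scaleWeight s w * (C * (δ ^ (2 * N))⁻¹ * w ^ (N : ℝ)) :=
        mul_le_mul_of_nonneg_left (hle w hw δ z hδ hz) (scaleWeight_nonneg s (le_of_lt hw))
    _ = _ := by ring

theorem integrableOn_scaleIntegrand (h : 𝓢(Rd d, E)) (s : ℝ) {z : Rd d} (hz : z ≠ 0) :
    IntegrableOn (fun w => scaleWeight s w • h ((√w)⁻¹ • z)) (Set.Ioi 0) := by
  obtain ⟨B, hB, hle⟩ := exists_scaleIntegrand_bound h s (norm_pos_iff.2 hz)
  refine hB.mono' (aestronglyMeasurable_scaleIntegrand h s z _) ?_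
  filter_upwards [ae_restrict_mem measurableSet_Ioi] with w hw using hle w hw z le_rfl

/-- Differentiation under the integral on the ball of radius `‖z‖ / 2`, which avoids the origin; the
chain rule factor `w^{-1/2}` lowers the exponent by `1/2`. -/
theorem hasFDerivAt_scaleIntegral (h : 𝓢(Rd d, E)) (s : ℝ) {z : Rd d} (hz : z ≠ 0) :
    HasFDerivAt (scaleIntegral h s) (scaleIntegral (fderiv ℝ h) (s - 1 / 2) z) z := by
  have hδ : 0 < ‖z‖ / 2 := by positivity
  obtain ⟨B, hB, hle⟩ := exists_scaleIntegrand_bound (SchwartzMap.fderivCLM ℝ _ _ h) (s - 1 / 2) hδ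
  refine hasFDerivAt_integral_of_dominated_of_fderiv_le (𝕜 := ℝ)
    (F := fun z w => scaleWeight s w • h ((√w)⁻¹ • z))
    (F' := fun z w => scaleWeight (s - 1 / 2) w • fderiv ℝ h ((√w)⁻¹ • z))
    (Metric.ball_mem_nhds z hδ)
    (Filter.Eventually.of_forall fun z => aestronglyMeasurable_scaleIntegrand h s z _)
    (integrableOn_scaleIntegrand h s hz)
    (aestronglyMeasurable_scaleIntegrand (SchwartzMap.fderivCLM ℝ _ _ h) _ z _) ?_ hB ?_
  · filter_upwards [ae_restrict_mem measurableSet_Ioi] with w hw y hy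
    refine hle w hw y ?_
    have := norm_sub_norm_le z y
    rw [Metric.mem_ball, dist_comm, dist_eq_norm] at hy
    linarith
  · filter_upwards [ae_restrict_mem measurableSet_Ioi] with w hw y _
    have h1 : HasFDerivAt (fun y : Rd d => (√w)⁻¹ • y)
        ((√w)⁻¹ • ContinuousLinearMap.id ℝ (Rd d)) y := (hasFDerivAt_id (𝕜 := ℝ) y).const_smul (√w)⁻¹
    have h2 := ((h.hasFDerivAt ((√w)⁻¹ • y)).comp y h1).const_smul (scaleWeight s w)
    refine h2.congr_fderiv ?_
    rw [ContinuousLinearMap.comp_smul, ContinuousLinearMap.comp_id, smul_smul,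
      scaleWeight_mul_inv_sqrt s hw]

theorem pderivAt_scaleIntegral [CompleteSpace E] (h : 𝓢(Rd d, E)) (s : ℝ) {z : Rd d} (hz : z ≠ 0)
    (l : Fin d) : pderivAt l (scaleIntegral h s) z = scaleIntegral (pderivAt l h) (s - 1 / 2) z := by
  rw [pderivAt, (hasFDerivAt_scaleIntegral h s hz).fderiv]
  have h1 := ((ContinuousLinearMap.apply ℝ E (EuclideanSpace.single l 1 : Rd d))).integral_comp_comm
    (integrableOn_scaleIntegrand (SchwartzMap.fderivCLM ℝ _ _ h) (s - 1 / 2) hz)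
  exact h1.symm

theorem exists_multiDeriv_scaleIntegral (h : 𝓢(Rd d, ℝ)) (s : ℝ) {f : Rd d → ℝ}
    (hf : ∀ z, z ≠ 0 → f z = scaleIntegral h s z) (τ : List (Fin d)) :
    ∃ g : 𝓢(Rd d, ℝ), ∀ z, z ≠ 0 →
      multiDeriv τ f z = scaleIntegral g (s - τ.length / 2) z := by
  induction τ with
  | nil => exact ⟨h, fun z hz => by simpa [multiDeriv] using hf z hz⟩
  | cons l τ ih =>
    obtain ⟨g, hg⟩ := ih
    refine ⟨schwartzPderiv l g, fun z hz => ?_⟩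
    have h1 : multiDeriv τ f =ᶠ[nhds z] scaleIntegral g (s - τ.length / 2) := by
      filter_upwards [isOpen_ne.mem_nhds hz] with y hy using hg y hy
    rw [multiDeriv, pderivAt, h1.fderiv_eq, coe_schwartzPderiv]
    have h2 := pderivAt_scaleIntegral g (s - τ.length / 2) hz l
    rw [pderivAt] at h2
    rw [h2]
    congr 1
    simp only [List.length_cons]
    push_cast; ring

/-- Writing `z_l = √w (w^{-1/2} z)_l`, each coordinate is absorbed into the profile and raises the
exponent by `1/2`. -/
theorem exists_multiMonomial_mul_scaleIntegral (h : 𝓢(Rd d, ℝ)) (s : ℝ) (σ : List (Fin d)) :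
    ∃ g : 𝓢(Rd d, ℝ), ∀ z, multiMonomial σ z * scaleIntegral h s z =
      scaleIntegral g (s + σ.length / 2) z := by
  induction σ with
  | nil => exact ⟨h, fun z => by simp [multiMonomial]⟩
  | cons l σ ih =>
    obtain ⟨g, hg⟩ := ih
    refine ⟨schwartzCoordMul l g, fun z => ?_⟩
    have h1 : multiMonomial (l :: σ) z = z l * multiMonomial σ z := by simp [multiMonomial]
    rw [h1, mul_assoc, hg, scaleIntegral, scaleIntegral, ← integral_const_mul]
    refine setIntegral_congr_fun measurableSet_Ioi fun w hw => ?_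
    have h2 : s + ((l :: σ).length : ℝ) / 2 = s + σ.length / 2 + 1 / 2 := by
      simp only [List.length_cons]; push_cast; ring
    have hw' : √w ≠ 0 := (Real.sqrt_pos.2 hw).ne'
    beta_reduce
    rw [h2, ← scaleWeight_mul_sqrt _ hw, schwartzCoordMul_apply, PiLp.smul_apply]
    simp only [smul_eq_mul]
    field_simp

theorem exists_besselKernel_eq_scaleIntegral (d : ℕ) (t : ℝ) :
    ∃ h : 𝓢(Rd d, ℝ), ∀ z, besselKernel d t z = scaleIntegral h ((-(d : ℝ) + t) / 2 - 1) z := by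
  obtain ⟨g, hg⟩ := exists_schwartz_gaussian d
  refine ⟨(1 / (4 * Real.pi) ^ (t / 2) * (1 / Real.Gamma (t / 2))) • g, fun z => ?_⟩
  rw [besselKernel, scaleIntegral, ← integral_const_mul]
  refine setIntegral_congr_fun measurableSet_Ioi fun w hw => ?_
  have hw0 : (0 : ℝ) < w := hw
  beta_reduce
  rw [smul_apply, hg, norm_smul, Real.norm_of_nonneg (by positivity), mul_pow, inv_pow,
    Real.sq_sqrt hw0.le, scaleWeight, Real.rpow_sub_one hw0.ne', smul_eq_mul, smul_eq_mul]
  rw [show -Real.pi * (w⁻¹ * ‖z‖ ^ 2) = -Real.pi * ‖z‖ ^ 2 / w by ring]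
  ring

/-- Kernels of class `𝒥_α` are superpositions of dilations of Schwartz functions. -/
theorem exists_scaleIntegral_of_mem_kernelClass {α : ℝ} {J : Rd d → ℝ} (hJ : J ∈ kernelClass d α) :
    ∃ (n : ℕ) (h : Fin n → 𝓢(Rd d, ℝ)) (s : Fin n → ℝ), (∀ k, (α - d) / 2 - 1 ≤ s k) ∧
      ∀ z, z ≠ 0 → J z = ∑ k, scaleIntegral (h k) (s k) z := by
  obtain ⟨n, c, t, σ, τ, ht, hJ⟩ := hJ
  have key : ∀ k, ∃ g : 𝓢(Rd d, ℝ), ∀ z, z ≠ 0 →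
      c k * (multiMonomial (σ k) z * multiDeriv (τ k) (besselKernel d (t k)) z) =
        -- The exponent is `(|σ| - |τ| + t - d)/2 - 1`, so the defining condition of the class
        -- becomes the lower bound `(α - d)/2 - 1`.
        scaleIntegral g ((-(d : ℝ) + t k) / 2 - 1 - (τ k).length / 2 + (σ k).length / 2) z := by
    intro k
    obtain ⟨g₁, h₁⟩ := exists_besselKernel_eq_scaleIntegral d (t k)
    obtain ⟨g₂, h₂⟩ := exists_multiDeriv_scaleIntegral g₁ _ (fun z _ => h₁ z) (τ k)
    obtain ⟨g₃, h₃⟩ := exists_multiMonomial_mul_scaleIntegral g₂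
      ((-(d : ℝ) + t k) / 2 - 1 - (τ k).length / 2) (σ k)
    refine ⟨c k • g₃, fun z hz => ?_⟩
    rw [h₂ z hz, h₃, scaleIntegral, scaleIntegral, ← integral_const_mul]
    refine integral_congr_ae (Filter.Eventually.of_forall fun w => ?_)
    simp only [smul_apply, smul_eq_mul]
    ring
  choose g hg using key
  refine ⟨n, g, fun k => (-(d : ℝ) + t k) / 2 - 1 - (τ k).length / 2 + (σ k).length / 2,
    fun k => ?_, fun z hz => ?_⟩
  · linarith [(ht k).2]
  · rw [hJ z hz]
    exact Finset.sum_congr rfl fun k _ => hg k z hz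

end ScaleIntegral

/-! ### Commutators for merely integrable kernels, and their symbols. -/

section ConvolutionSums

variable {d : ℕ}

/-- Convolution with a complexified real kernel. -/
noncomputable def convReal (f : Rd d → ℂ) (k : Rd d → ℝ) : Rd d → ℂ :=
  f ⋆[ContinuousLinearMap.mul ℝ ℂ, volume] fun z => (k z : ℂ)

theorem convReal_apply (f : Rd d → ℂ) (k : Rd d → ℝ) (x : Rd d) :
    convReal f k x = ∫ z, k z • f (x - z) := by
  rw [convReal, convolution_eq_swap]
  refine integral_congr_ae (Filter.Eventually.of_forall fun z => ?_)
  simp [mul_comm]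

/-- Functions of the form `∑ p_s (f_s * k)`, linear in the kernel `k`. -/
def ConvSum (G : (Rd d → ℝ) → Rd d → ℂ) : Prop :=
  ∃ (S : Type) (_ : Fintype S) (p : S → Rd d → ℝ) (f : S → Rd d → ℂ),
    (∀ s, (p s).HasTemperateGrowth) ∧ (∀ s, ∃ C, ∀ x, |p s x| ≤ C) ∧ (∀ s, ContDiff ℝ ∞ (f s)) ∧
    (∀ s, HasCompactSupport (f s)) ∧
    ∀ k, Integrable k → ∀ x, G k x = ∑ s, p s x • convReal (f s) k x

variable {f : Rd d → ℂ} {k : Rd d → ℝ}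

theorem hasFDerivAt_convReal (hf : ContDiff ℝ ∞ f) (hcs : HasCompactSupport f) (hk : Integrable k)
    (x : Rd d) : DifferentiableAt ℝ (convReal f k) x ∧
      ∀ l, pderivAt l (convReal f k) x = convReal (pderivAt l f) k x := by
  have hk' : LocallyIntegrable fun z => (k z : ℂ) := hk.ofReal.locallyIntegrable
  have h := hcs.hasFDerivAt_convolution_left (ContinuousLinearMap.mul ℝ ℂ) (hf.of_le (by simp)) hk' x
  refine ⟨h.differentiableAt, fun l => ?_⟩
  have h1 : pderivAt l (convReal f k) x = _ :=
    congrArg (fun L : Rd d →L[ℝ] ℂ => L (EuclideanSpace.single l 1)) h.fderiv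
  have h2 := ((hcs.fderiv (𝕜 := ℝ)).convolutionExists_left
    ((ContinuousLinearMap.mul ℝ ℂ).precompL (Rd d)) (hf.continuous_fderiv (by simp)) hk' x)
  rw [h1, convolution_def, ContinuousLinearMap.integral_apply h2]
  rfl

theorem ConvSum.sub {G H : (Rd d → ℝ) → Rd d → ℂ} (hG : ConvSum G) (hH : ConvSum H) :
    ConvSum fun k x => G k x - H k x := by
  obtain ⟨S, _, p, f, hp, hpb, hf, hcs, hG⟩ := hG
  obtain ⟨S', _, p', f', hp', hpb', hf', hcs', hH⟩ := hH
  refine ⟨S ⊕ S', inferInstance, Sum.elim p fun s => -p' s, Sum.elim f f', ?_, ?_, ?_, ?_, ?_⟩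
  · rintro (s | s); exacts [hp s, (hp' s).neg]
  · rintro (s | s)
    · exact hpb s
    · obtain ⟨C, hC⟩ := hpb' s
      exact ⟨C, fun x => by simpa using hC x⟩
  · rintro (s | s); exacts [hf s, hf' s]
  · rintro (s | s); exacts [hcs s, hcs' s]
  · intro k hk x
    simp [hG k hk, hH k hk, sub_eq_add_neg]

theorem exists_bound_schwartz_mul (q : 𝓢(Rd d, ℝ)) {p : Rd d → ℝ} (hp : p.HasTemperateGrowth) :
    ∃ C, ∀ x, |q x * p x| ≤ C := by
  obtain ⟨C, -, hC⟩ := (SchwartzMap.smulLeftCLM ℝ p q).decay 0 0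
  refine ⟨C, fun x => ?_⟩
  have := hC x
  rw [pow_zero, one_mul, norm_iteratedFDeriv_zero, SchwartzMap.smulLeftCLM_apply_apply hp,
    smul_eq_mul, Real.norm_eq_abs, mul_comm] at this
  exact this

/-- Derivatives of a convolution fall on the test function, so `k` need only be integrable. The
derivatives of `p` may grow, but the Schwartz coefficients of `V` make the new multipliers bounded.
-/
theorem ConvSum.fieldOp (V : Fin d → 𝓢(Rd d, ℝ)) {G : (Rd d → ℝ) → Rd d → ℂ} (hG : ConvSum G) :
    ConvSum fun k => fieldOp V (G k) := by
  obtain ⟨S, _, p, f, hp, hpb, hf, hcs, hG⟩ := hG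
  have hV : ∀ l, (V l : Rd d → ℝ).HasTemperateGrowth := fun l => (V l).hasTemperateGrowth
  refine ⟨(Fin d × S) ⊕ (Fin d × S), inferInstance,
    Sum.elim (fun q => V q.1 * pderivAt q.1 (p q.2)) (fun q => V q.1 * p q.2),
    Sum.elim (fun q => f q.2) (fun q => pderivAt q.1 (f q.2)), ?_, ?_, ?_, ?_, ?_⟩
  · rintro (q | q); exacts [(hV q.1).mul ((hp q.2).pderivAt q.1), (hV q.1).mul (hp q.2)]
  · rintro (q | q)
    exacts [exists_bound_schwartz_mul _ ((hp q.2).pderivAt q.1), exists_bound_schwartz_mul _ (hp q.2)]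
  · rintro (q | q); exacts [hf q.2, (hf q.2).pderivAt q.1]
  · rintro (q | q); exacts [hcs q.2, (hcs q.2).pderivAt q.1]
  · intro k hk x
    have hp1 : ∀ s, DifferentiableAt ℝ (p s) x := fun s => (hp s).1.differentiable (by simp) x
    have hc := fun s => hasFDerivAt_convReal (hf s) (hcs s) hk x
    have h1 : G k = fun x => ∑ s, p s x • convReal (f s) k x := funext fun x => hG k hk x
    have h2 : ∀ l, pderivAt l (G k) x = ∑ s, (pderivAt l (p s) x • convReal (f s) k x +
        p s x • convReal (pderivAt l (f s)) k x) := fun l => by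
      rw [h1, pderivAt_sum _ (f := fun s x => p s x • convReal (f s) k x)
        fun s _ => (hp1 s).smul (hc s).1]
      exact Finset.sum_congr rfl fun s _ => by rw [pderivAt_smul (hp1 s) (hc s).1, (hc s).2]
    simp only [_root_.fieldOp, h2, Fintype.sum_sum_type, Sum.elim_inl, Sum.elim_inr,
      Fintype.sum_prod_type, Finset.smul_sum, ← Finset.sum_add_distrib, Pi.mul_apply, smul_add,
      smul_smul]

theorem convSum_kernelOp {a b : Rd d → ℝ} (ha : a.HasTemperateGrowth)
    (ha_bdd : ∃ K : ℝ, ∀ x, |a x| ≤ K) (hb : ContDiff ℝ ∞ b) (i j : Fin d) {u : Rd d → ℂ}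
    (hu : ContDiff ℝ ∞ u) (hcs : HasCompactSupport u) : ConvSum fun k => kernelOp a b k i j u :=
  ⟨Unit, inferInstance, fun _ => a, fun _ y => b y • pderivAt i (pderivAt j u) y, fun _ => ha,
    fun _ => ha_bdd, fun _ => hb.smul ((hu.pderivAt j).pderivAt i),
    fun _ => HasCompactSupport.smul_left (f := b) ((hcs.pderivAt j).pderivAt i),
    fun k _ x => by simp [kernelOp, convReal]⟩

theorem ConvSum.opComm (V : Fin d → 𝓢(Rd d, ℝ)) {T : (Rd d → ℝ) → (Rd d → ℂ) → Rd d → ℂ}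
    (hT : ∀ u : Rd d → ℂ, ContDiff ℝ ∞ u → HasCompactSupport u → ConvSum fun k => T k u)
    {u : Rd d → ℂ} (hu : ContDiff ℝ ∞ u) (hcs : HasCompactSupport u) :
    ConvSum fun k => opComm (_root_.fieldOp V) (T k) u :=
  ((hT u hu hcs).fieldOp V).sub
    (hT (_root_.fieldOp V u) (contDiff_fieldOp V hu) (hasCompactSupport_fieldOp V hcs))

/-- For a Schwartz kernel the result is a Schwartz function. -/
theorem ConvSum.exists_schwartz {G : (Rd d → ℝ) → Rd d → ℂ} (hG : ConvSum G) (k : 𝓢(Rd d, ℝ)) :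
    ∃ F : 𝓢(Rd d, ℂ), (F : Rd d → ℂ) = G k := by
  obtain ⟨S, _, p, f, hp, hpb, hf, hcs, hG⟩ := hG
  choose g hg using fun s => exists_schwartz_eq (hf s) (hcs s)
  choose P hP _ using fun s => exists_schwartz_convolution k (g s)
  refine ⟨∑ s, SchwartzMap.smulLeftCLM ℂ (p s) (P s), funext fun x => ?_⟩
  rw [hG k k.integrable, sum_apply]
  refine Finset.sum_congr rfl fun s _ => ?_
  rw [SchwartzMap.smulLeftCLM_apply_apply (hp s), hP, convReal_apply, hg,
    ← integral_sub_left_eq_self _ volume x]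
  simp

/-- By Fubini the symbol `m(ξ, z)` is the Fourier transform in `x` of `p(x) f(x - z)`, bounded by `C
‖f‖_{L¹}` and independent of `k`. -/
theorem exists_symbol_smul_convReal {p : Rd d → ℝ} (hpc : Continuous p) {C : ℝ}
    (hC : ∀ x, |p x| ≤ C) (hfc : Continuous f) (hfi : Integrable f) :
    ∃ (m : Rd d → Rd d → ℂ) (C : ℝ), StronglyMeasurable (Function.uncurry m) ∧
      (∀ ξ z, ‖m ξ z‖ ≤ C) ∧
      ∀ k, Integrable k → (Integrable fun x => p x • convReal f k x) ∧
        ∀ ξ, 𝓕 (fun x => p x • convReal f k x) ξ = ∫ z, k z • m ξ z := by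
  obtain ⟨n, hn0⟩ : ∃ n : Rd d → Rd d → Rd d → ℂ,
      ∀ ξ z x, n ξ z x = 𝐞 (-inner ℝ x ξ) • p x • f (x - z) := ⟨_, fun _ _ _ => rfl⟩
  have hnc : Continuous fun q : (Rd d × Rd d) × Rd d => n q.1.1 q.1.2 q.2 := by
    have h3 := Real.continuous_fourierChar
    simp only [hn0, Circle.smul_def]
    fun_prop
  have hns : StronglyMeasurable fun q : (Rd d × Rd d) × Rd d => n q.1.1 q.1.2 q.2 :=
    hnc.stronglyMeasurable
  have hn : ∀ ξ z x, ‖n ξ z x‖ ≤ C * ‖f (x - z)‖ := fun ξ z x => by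
    rw [hn0, Circle.norm_smul, norm_smul]
    exact mul_le_mul_of_nonneg_right (hC x) (norm_nonneg _)
  refine ⟨fun ξ z => ∫ x, n ξ z x, C * ∫ x, ‖f x‖, ?_, fun ξ z => ?_, fun k hk => ?_⟩
  · exact hns.integral_prod_right'
  · refine (norm_integral_le_of_norm_le ((hfi.comp_sub_right z).norm.const_mul C)
      (Filter.Eventually.of_forall (hn ξ z))).trans_eq ?_
    rw [integral_const_mul, integral_sub_right_eq_self fun x => ‖f x‖]
  have hci : Integrable (convReal f k) := hfi.integrable_convolution _ hk.ofReal
  have hpci : Integrable fun x => p x • convReal f k x := by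
    refine (hci.norm.const_mul C).mono' (hpc.aestronglyMeasurable.smul hci.aestronglyMeasurable)
      (Filter.Eventually.of_forall fun x => ?_)
    rw [norm_smul]
    exact mul_le_mul_of_nonneg_right (hC x) (norm_nonneg _)
  refine ⟨hpci, fun ξ => ?_⟩
  have hprod : Integrable fun q : Rd d × Rd d => k q.2 • n ξ q.2 q.1 := by
    have h1 : Integrable fun q : Rd d × Rd d => k q.2 • f (q.1 - q.2) :=
      hk.convolution_integrand (ContinuousLinearMap.lsmul ℝ ℝ) hfi
    refine (h1.norm.const_mul C).mono' ?_ (Filter.Eventually.of_forall fun q => ?_)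
    · refine (hk.aestronglyMeasurable.comp_snd).smul ?_
      exact (hnc.comp (by fun_prop : Continuous fun q : Rd d × Rd d => ((ξ, q.2), q.1)))
        |>.aestronglyMeasurable
    · rw [norm_smul, norm_smul, mul_left_comm]
      exact mul_le_mul_of_nonneg_left (hn ξ q.2 q.1) (norm_nonneg _)
  rw [Real.fourier_eq]
  calc _ = ∫ x, ∫ z, k z • n ξ z x := by
        refine integral_congr_ae (Filter.Eventually.of_forall fun x => ?_)
        simp only [hn0, convReal_apply, Circle.smul_def, ← integral_smul]
        refine integral_congr_ae (Filter.Eventually.of_forall fun z => ?_)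
        simp only [smul_eq_mul, Complex.real_smul]
        ring
    _ = ∫ z, ∫ x, k z • n ξ z x := integral_integral_swap hprod
    _ = _ := by simp only [integral_smul]

/-- The Fourier transform depends on the kernel through a bounded symbol. -/
theorem ConvSum.exists_symbol {G : (Rd d → ℝ) → Rd d → ℂ} (hG : ConvSum G) :
    ∃ (m : Rd d → Rd d → ℂ) (C : ℝ), StronglyMeasurable (Function.uncurry m) ∧
      (∀ ξ z, ‖m ξ z‖ ≤ C) ∧
      ∀ k, Integrable k → Integrable (G k) ∧ ∀ ξ, 𝓕 (G k) ξ = ∫ z, k z • m ξ z := by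
  obtain ⟨S, _, p, f, hp, hpb, hf, hcs, hG⟩ := hG
  choose C hC using hpb
  choose m D hm hD h using fun s => exists_symbol_smul_convReal (hp s).1.continuous (hC s)
    (hf s).continuous ((hf s).continuous.integrable_of_hasCompactSupport (hcs s))
  refine ⟨fun ξ z => ∑ s, m s ξ z, ∑ s, D s, ?_, fun ξ z => ?_, fun k hk => ?_⟩
  · exact Finset.stronglyMeasurable_fun_sum _ fun s _ => hm s
  · exact (norm_sum_le _ _).trans (Finset.sum_le_sum fun s _ => hD s ξ z)
  have hGk : G k = fun x => ∑ s, p s x • convReal (f s) k x := funext fun x => hG k hk x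
  have hi := fun s => (h s k hk).1
  refine ⟨by rw [hGk]; exact integrable_finsetSum _ fun s _ => hi s, fun ξ => ?_⟩
  have hmi : ∀ s, Integrable fun z => k z • m s ξ z := fun s => by
    refine (hk.norm.mul_const (D s)).mono' (hk.aestronglyMeasurable.smul
      ((hm s).comp_measurable measurable_prodMk_left).aestronglyMeasurable)
      (Filter.Eventually.of_forall fun z => ?_)
    rw [norm_smul]
    exact mul_le_mul_of_nonneg_left (hD s ξ z) (norm_nonneg _)
  have hF : 𝓕 (G k) ξ = ∑ s, 𝓕 (fun x => p s x • convReal (f s) k x) ξ := by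
    simp only [Real.fourier_eq, hGk, Finset.smul_sum]
    exact integral_finsetSum _ fun s _ => (Real.fourierIntegral_convergent_iff ξ).2 (hi s)
  simp only [hF, (h _ k hk).2 ξ, Finset.smul_sum]
  exact (integral_finsetSum _ fun s _ => hmi s).symm

end ConvolutionSums

/-! ### From all scales to the kernel `J`. -/

section Superposition

variable {d : ℕ}

/-- The dilation by `√w` multiplies the `L¹` norm by `w^{d/2}`, whence the condition on `s`. -/
theorem integrable_scaleWeight_smul_dilate (h : 𝓢(Rd d, ℝ)) {s : ℝ} (hs : -1 < s + d / 2) :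
    Integrable (fun q : Rd d × ℝ => scaleWeight s q.2 • dilate √q.2 h q.1)
      (volume.prod (volume.restrict (Set.Ioi 0))) := by
  have hm : StronglyMeasurable fun q : Rd d × ℝ => scaleWeight s q.2 • dilate √q.2 h q.1 := by
    refine ((measurable_scaleWeight s).comp measurable_snd).stronglyMeasurable.smul ?_
    have h1 : Measurable fun q : Rd d × ℝ => (√q.2)⁻¹ • q.1 := by fun_prop
    exact h.continuous.comp_stronglyMeasurable h1.stronglyMeasurable
  have hi : ∀ w ∈ Set.Ioi (0 : ℝ), Integrable fun z => dilate √w h z := fun w hw => by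
    obtain ⟨q, hq⟩ := exists_schwartz_dilate h (Real.sqrt_pos.2 hw).ne'
    rw [← hq]
    exact q.integrable
  refine (integrable_prod_iff' hm.aestronglyMeasurable).2 ⟨?_, ?_⟩
  · filter_upwards [ae_restrict_mem measurableSet_Ioi] with w hw using
      (hi w hw).smul (scaleWeight s w)
  · refine ((integrableOn_scaleWeight hs).mul_const (∫ z, |h z|)).congr ?_
    filter_upwards [ae_restrict_mem measurableSet_Ioi] with w hw
    have h1 := Measure.integral_comp_inv_smul_of_nonneg (volume : Measure (Rd d)) (fun z => |h z|)
      (Real.sqrt_nonneg w)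
    rw [finrank_euclideanSpace_fin, smul_eq_mul] at h1
    simp only [norm_smul, Real.norm_eq_abs, integral_const_mul, dilate]
    rw [h1, abs_of_nonneg (scaleWeight_nonneg s (le_of_lt hw)), scaleWeight_add _ _ hw,
      Real.sqrt_eq_rpow, ← Real.rpow_mul_natCast (le_of_lt hw)]
    ring_nf

theorem integrable_scaleIntegral (h : 𝓢(Rd d, ℝ)) {s : ℝ} (hs : -1 < s + d / 2) :
    Integrable (scaleIntegral h s) :=
  (integrable_scaleWeight_smul_dilate h hs).integral_prod_left

variable {m : Rd d → Rd d → ℂ} {C : ℝ}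

theorem integral_scaleIntegral_smul (hm : StronglyMeasurable (Function.uncurry m))
    (hC : ∀ ξ z, ‖m ξ z‖ ≤ C) (h : 𝓢(Rd d, ℝ)) {s : ℝ} (hs : -1 < s + d / 2) (ξ : Rd d) :
    ∫ z, scaleIntegral h s z • m ξ z =
      ∫ w in Set.Ioi (0 : ℝ), scaleWeight s w • ∫ z, dilate √w h z • m ξ z := by
  have hi := integrable_scaleWeight_smul_dilate h hs
  have hmξ : StronglyMeasurable (m ξ) := hm.comp_measurable measurable_prodMk_left
  have hi2 : Integrable (fun q : Rd d × ℝ => (scaleWeight s q.2 • dilate √q.2 h q.1) • m ξ q.1)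
      (volume.prod (volume.restrict (Set.Ioi 0))) := by
    refine (hi.norm.mul_const C).mono' (hi.aestronglyMeasurable.smul
      (hmξ.comp_measurable measurable_fst).aestronglyMeasurable)
      (Filter.Eventually.of_forall fun q => ?_)
    rw [norm_smul]
    exact mul_le_mul_of_nonneg_left (hC ξ q.1) (norm_nonneg _)
  calc _ = ∫ z, ∫ w in Set.Ioi (0 : ℝ), (scaleWeight s w • dilate √w h z) • m ξ z := by
        simp only [integral_smul_const]; rfl
    _ = ∫ w in Set.Ioi (0 : ℝ), ∫ z, (scaleWeight s w • dilate √w h z) • m ξ z :=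
        integral_integral_swap hi2
    _ = _ := by simp only [smul_assoc, integral_smul]

/-- Minkowski's inequality in `w`, applied after Fubini has exchanged the superposition with the
symbol integral. -/
theorem eLpNorm_scaleIntegral_le (hm : StronglyMeasurable (Function.uncurry m))
    (hC : ∀ ξ z, ‖m ξ z‖ ≤ C) (h : 𝓢(Rd d, ℝ)) {s : ℝ} (hs : -1 < s + d / 2) (t : ℝ) :
    eLpNorm (fun ξ => sobolevWeight t ξ • ∫ z, scaleIntegral h s z • m ξ z) 2 volume ≤
      ∫⁻ w in Set.Ioi (0 : ℝ), ENNReal.ofReal (scaleWeight s w) *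
        eLpNorm (fun ξ => sobolevWeight t ξ • ∫ z, dilate √w h z • m ξ z) 2 volume := by
  have hE : StronglyMeasurable fun q : ℝ × Rd d => ∫ z, dilate √q.1 h z • m q.2 z := by
    have h1 : Measurable fun q : (ℝ × Rd d) × Rd d => (√q.1.1)⁻¹ • q.2 := by fun_prop
    have h2 : StronglyMeasurable fun q : (ℝ × Rd d) × Rd d => dilate √q.1.1 h q.2 • m q.1.2 q.2 :=
      (h.continuous.comp_stronglyMeasurable h1.stronglyMeasurable).smul
        (hm.comp_measurable (by fun_prop : Measurable fun q : (ℝ × Rd d) × Rd d => (q.1.2, q.2)))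
    exact h2.integral_prod_right'
  have hG : Measurable (Function.uncurry fun (w : ℝ) (ξ : Rd d) =>
      ‖sobolevWeight t ξ • scaleWeight s w • ∫ z, dilate √w h z • m ξ z‖ₑ) := by
    have h1 : StronglyMeasurable fun q : ℝ × Rd d => sobolevWeight t q.2 • scaleWeight s q.1 •
        ∫ z, dilate √q.1 h z • m q.2 z :=
      ((continuous_sobolevWeight t).comp continuous_snd).stronglyMeasurable.smul
        (((measurable_scaleWeight s).comp measurable_fst).stronglyMeasurable.smul hE)
    exact h1.enorm
  rw [eLpNorm_two_eq, ENNReal.rpow_half_le_iff]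
  calc _ ≤ ∫⁻ ξ, (∫⁻ w in Set.Ioi (0 : ℝ),
        ‖sobolevWeight t ξ • scaleWeight s w • ∫ z, dilate √w h z • m ξ z‖ₑ) ^ 2 := by
        refine lintegral_mono fun ξ => ?_
        beta_reduce
        rw [integral_scaleIntegral_smul hm hC h hs ξ, ← integral_smul]
        gcongr
        exact enorm_integral_le_lintegral_enorm _
    _ ≤ _ := lintegral_sq_lintegral_le hG
    _ = _ := by
        congr 1
        refine setLIntegral_congr_fun measurableSet_Ioi fun w hw => ?_
        beta_reduce
        rw [← eLpNorm_two_eq, ← Real.enorm_of_nonneg (scaleWeight_nonneg s (le_of_lt hw)),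
          ← eLpNorm_const_smul]
        congr 1
        ext ξ
        exact smul_comm _ _ _

theorem integrableOn_scaleWeight_mul_sqrt_rpow {s p : ℝ} (hs : -1 < s + p / 2) (N : ℕ) :
    IntegrableOn (fun w => scaleWeight s w * (√w ^ p * (1 + √w) ^ N)) (Set.Ioi 0) := by
  have hm : Measurable fun w => scaleWeight s w * (√w ^ p * (1 + √w) ^ N) :=
    (measurable_scaleWeight s).mul (by fun_prop)
  -- The bound `(1 + √w)^N ≤ 2^{N-1} (1 + w^{N/2})` reduces the claim to two weights, with exponents
  -- `s + p/2` and `s + p/2 + N/2`.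
  refine (((integrableOn_scaleWeight hs).add (integrableOn_scaleWeight
    (s := s + p / 2 + N / 2) (by have : (0 : ℝ) ≤ N := N.cast_nonneg; linarith))).const_mul
    (2 ^ (N - 1))).mono' hm.aestronglyMeasurable ?_
  filter_upwards [ae_restrict_mem measurableSet_Ioi] with w hw
  have hw0 : (0 : ℝ) < w := hw
  have hW := scaleWeight_nonneg s hw0.le
  have h1 : √w ^ p = w ^ (p / 2) := by
    rw [Real.sqrt_eq_rpow, ← Real.rpow_mul hw0.le]; ring_nf
  have h2 : √w ^ N = w ^ ((N : ℝ) / 2) := by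
    rw [Real.sqrt_eq_rpow, ← Real.rpow_mul_natCast hw0.le]; ring_nf
  rw [Real.norm_of_nonneg (by positivity)]
  simp only [Pi.add_apply]
  rw [scaleWeight_add (s + p / 2) _ hw0, scaleWeight_add s _ hw0, ← h1, ← h2]
  have h3 := add_pow_le zero_le_one (Real.sqrt_nonneg w) N
  rw [one_pow] at h3
  calc _ ≤ scaleWeight s w * (√w ^ p * (2 ^ (N - 1) * (1 + √w ^ N))) := by gcongr
    _ = _ := by ring

/-- A bound for Schwartz kernels at all scales gives a bound for kernels of class `𝒥_α`. -/
theorem exists_sobolevNorm_le_of_mem_kernelClass {ι : Type*} [Nonempty (Fin d)] {α θ : ℝ}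
    (hα : 0 < α) (hθ : 2 < α + θ) {J : Rd d → ℝ} (hJ : J ∈ kernelClass d α)
    {G : ι → (Rd d → ℝ) → Rd d → ℂ} (hG : ∀ i, ConvSum (G i)) {A : ι → ℝ≥0∞}
    (hle : ∀ h : 𝓢(Rd d, ℝ), ∃ (C : ℝ) (N : ℕ), 0 ≤ C ∧ ∀ i, ∀ r, 0 < r → ∀ k : 𝓢(Rd d, ℝ),
      (k : Rd d → ℝ) = dilate r h → ∀ F : 𝓢(Rd d, ℂ), (F : Rd d → ℂ) = G i k →
        sobolevNorm (-θ) F ≤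
          ENNReal.ofReal (C * r ^ ((d : ℝ) + θ - 2) * (1 + r) ^ N) * A i) :
    ∃ C : ℝ≥0, ∀ i, Integrable (G i J) ∧ sobolevNorm (-θ) (G i J) ≤ C * A i := by
  obtain ⟨n, h, s, hs, hJ⟩ := exists_scaleIntegral_of_mem_kernelClass hJ
  choose C N hC hle using fun k => hle (h k)
  -- Integrability of the kernel uses `α > 0`; the convergence of the scale bounds, next, is where
  -- `α + θ > 2` enters.
  have hs1 : ∀ k, -1 < s k + d / 2 := fun k => by linarith [hs k]
  have hs2 : ∀ k, -1 < s k + ((d : ℝ) + θ - 2) / 2 := fun k => by linarith [hs k]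
  have hJ' : J =ᵐ[volume] fun z => ∑ k, scaleIntegral (h k) (s k) z := by
    filter_upwards [compl_mem_ae_iff.2 (measure_singleton (0 : Rd d))] with z hz using hJ z hz
  have hi : ∀ k, Integrable (scaleIntegral (h k) (s k)) := fun k =>
    integrable_scaleIntegral (h k) (hs1 k)
  have hJi : Integrable J := (integrable_finsetSum _ fun k _ => hi k).congr hJ'.symm
  refine ⟨∑ k, (C k * ∫ w in Set.Ioi (0 : ℝ),
    scaleWeight (s k) w * (√w ^ ((d : ℝ) + θ - 2) * (1 + √w) ^ N k)).toNNReal, fun i => ?_⟩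
  obtain ⟨m, D, hm, hD, hsym⟩ := (hG i).exists_symbol
  refine ⟨(hsym J hJi).1, ?_⟩
  have hmi : ∀ k ξ, Integrable fun z => scaleIntegral (h k) (s k) z • m ξ z := fun k ξ => by
    refine ((hi k).norm.mul_const D).mono' ((hi k).aestronglyMeasurable.smul
      (hm.comp_measurable measurable_prodMk_left).aestronglyMeasurable)
      (Filter.Eventually.of_forall fun z => ?_)
    rw [norm_smul]
    exact mul_le_mul_of_nonneg_left (hD ξ z) (norm_nonneg _)
  have hF : ∀ ξ, 𝓕 (G i J) ξ = ∑ k, ∫ z, scaleIntegral (h k) (s k) z • m ξ z := fun ξ => by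
    rw [(hsym J hJi).2 ξ, ← integral_finsetSum _ fun k _ => hmi k ξ]
    refine integral_congr_ae ?_
    filter_upwards [hJ'] with z hz
    rw [hz, Finset.sum_smul]
  have hmeas : ∀ k, AEStronglyMeasurable
      (fun ξ => sobolevWeight (-θ) ξ • ∫ z, scaleIntegral (h k) (s k) z • m ξ z) volume := fun k => by
    refine (continuous_sobolevWeight _).aestronglyMeasurable.smul ?_
    have h1 : AEStronglyMeasurable
        (fun q : Rd d × Rd d => scaleIntegral (h k) (s k) q.2 • m q.1 q.2) (volume.prod volume) :=
      (hi k).aestronglyMeasurable.comp_snd.smul hm.aestronglyMeasurable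
    exact h1.integral_prod_right'
  rw [sobolevNorm_eq]
  have hsplit : (fun ξ => sobolevWeight (-θ) ξ • 𝓕 (G i J) ξ) =
      ∑ k, fun ξ => sobolevWeight (-θ) ξ • ∫ z, scaleIntegral (h k) (s k) z • m ξ z := by
    ext ξ
    rw [hF, Finset.smul_sum, Finset.sum_apply]
  rw [hsplit]
  refine (eLpNorm_sum_le (fun k _ => hmeas k) one_le_two).trans ?_
  push_cast
  rw [Finset.sum_mul]
  refine Finset.sum_le_sum fun k _ => (eLpNorm_scaleIntegral_le hm hD (h k) (hs1 k) (-θ)).trans ?_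
  have hint := integrableOn_scaleWeight_mul_sqrt_rpow (hs2 k) (N k)
  have hnn : ∀ w ∈ Set.Ioi (0 : ℝ), 0 ≤ scaleWeight (s k) w *
      (√w ^ ((d : ℝ) + θ - 2) * (1 + √w) ^ N k) := fun w hw =>
    mul_nonneg (scaleWeight_nonneg _ (le_of_lt hw)) (by positivity)
  calc _ ≤ ∫⁻ w in Set.Ioi (0 : ℝ), ENNReal.ofReal (C k) * (ENNReal.ofReal (scaleWeight (s k) w *
        (√w ^ ((d : ℝ) + θ - 2) * (1 + √w) ^ N k)) * A i) := by
        refine setLIntegral_mono' measurableSet_Ioi fun w hw => ?_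
        obtain ⟨q, hq⟩ := exists_schwartz_dilate (h k) (Real.sqrt_pos.2 hw).ne'
        obtain ⟨F, hF⟩ := (hG i).exists_schwartz q
        have h1 := hle k i √w (Real.sqrt_pos.2 hw) q hq F hF
        -- The symbol formula turns the bound for the Schwartz kernel at scale `√w` into one for the
        -- integrand of the superposition.
        have h2 := (hsym q q.integrable).2
        rw [hq] at h2
        rw [sobolevNorm_eq, hF, hq] at h1
        simp only [h2] at h1
        refine (mul_le_mul' le_rfl h1).trans_eq ?_
        rw [← mul_assoc, ← mul_assoc, ← ENNReal.ofReal_mul (scaleWeight_nonneg _ (le_of_lt hw)),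
          ← ENNReal.ofReal_mul (hC k)]
        congr 2
        ring
    _ = ENNReal.ofReal (C k) * ((∫⁻ w in Set.Ioi (0 : ℝ), ENNReal.ofReal (scaleWeight (s k) w *
        (√w ^ ((d : ℝ) + θ - 2) * (1 + √w) ^ N k))) * A i) := by
        rw [lintegral_const_mul' _ _ ENNReal.ofReal_ne_top, lintegral_mul_const'']
        exact hint.aestronglyMeasurable.aemeasurable.ennreal_ofReal
    _ = _ := by
        rw [← ofReal_integral_eq_lintegral_ofReal hint
          ((ae_restrict_iff' measurableSet_Ioi).2 (Filter.Eventually.of_forall hnn)), ← mul_assoc,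
          ← ENNReal.ofReal_mul (hC k)]
        rfl

end Superposition

/-! ### The two commutator estimates. -/

theorem lemma5p1 {d : ℕ} (α : ℝ) (hα₁ : 1 < α) (hα₂ : α < 2)
    (J : Rd d → ℝ) (hJ : J ∈ kernelClass d α)
    (a b : Rd d → ℝ)
    (ha : ContDiff ℝ ∞ a) (ha_bdd : ∃ K : ℝ, ∀ x, |a x| ≤ K)
    (ha_growth : a.HasTemperateGrowth)
    (hb : ContDiff ℝ ∞ b) (hb_bdd : ∃ K : ℝ, ∀ x, |b x| ≤ K)
    (i j : Fin d)
    (β : ℝ) (hβ : 0 < β) (hαβ : 2 < α + β)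
    (Q : Set (Rd d)) (hQ : IsCompact Q)
    (γ : ℝ) (hγ₁ : 2 - α < γ) (hγ₂ : γ < 1) :
    (∀ R : ℝ≥0, ∃ C₁ : ℝ≥0, ∀ V : Fin d → 𝓢(Rd d, ℝ), fieldHolderNorm (1 + γ) V ≤ R →
      ∀ u : Rd d → ℂ, ContDiff ℝ ∞ u → tsupport u ⊆ Q →
        Integrable (opComm (fieldOp V) (kernelOp a b J i j) u) ∧
        sobolevNorm (-β) (opComm (fieldOp V) (kernelOp a b J i j) u) ≤
          C₁ * (eLpNorm u 2 volume
            + derivSobolevNorm 2 (-α - β + 1) V u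
            + derivSobolevNorm 3 (-α - β) V u)) ∧
    (∀ R : ℝ≥0, ∃ C₂ : ℝ≥0, ∀ V : Fin d → 𝓢(Rd d, ℝ), fieldHolderNorm (2 + γ) V ≤ R →
      ∀ u : Rd d → ℂ, ContDiff ℝ ∞ u → tsupport u ⊆ Q →
        Integrable (opComm (fieldOp V) (opComm (fieldOp V) (kernelOp a b J i j)) u) ∧
        sobolevNorm (-β) (opComm (fieldOp V) (opComm (fieldOp V) (kernelOp a b J i j)) u) ≤
          C₂ * (eLpNorm u 2 volume
            + derivSobolevNorm 3 (-α - β + 1) V u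
            + derivSobolevNorm 4 (-α - β) V u)) := by
  -- The index `i` forces `d ≥ 1`, so the origin, where `J` is unspecified, is a null set.
  have : Nonempty (Fin d) := ⟨i⟩
  have hγ0 : 0 < γ := by linarith
  have hθ0 : 0 < min β γ := lt_min hβ hγ0
  have hθγ : min β γ ≤ γ := min_le_right _ _
  have hαθ : 2 < α + min β γ := by
    rw [← sub_lt_iff_lt_add']; exact lt_min (by linarith) hγ₁
  have hcs : ∀ {u : Rd d → ℂ}, tsupport u ⊆ Q → HasCompactSupport u := fun hu =>
    hQ.of_isClosed_subset (isClosed_tsupport _) hu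
  have hβθ : ∀ f : Rd d → ℂ, sobolevNorm (-β) f ≤ sobolevNorm (-min β γ) f := fun f =>
    sobolevNorm_mono (neg_le_neg (min_le_left _ _)) f
  have hM : ∀ u : Rd d → ℂ, ContDiff ℝ ∞ u → HasCompactSupport u →
      ConvSum fun k => kernelOp a b k i j u := fun u hu hc =>
    convSum_kernelOp ha_growth ha_bdd hb i j hu hc
  constructor
  · intro R
    -- Indexing by all admissible pairs `(V, u)` makes the resulting constant uniform in both.
    let ι := {p : (Fin d → 𝓢(Rd d, ℝ)) × (Rd d → ℂ) //
      fieldHolderNorm (1 + γ) p.1 ≤ R ∧ ContDiff ℝ ∞ p.2 ∧ tsupport p.2 ⊆ Q}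
    obtain ⟨C, hC⟩ := exists_sobolevNorm_le_of_mem_kernelClass (ι := ι) (by linarith) hαθ hJ
      (G := fun p k => opComm (fieldOp p.1.1) (kernelOp a b k i j) p.1.2)
      (A := fun p => eLpNorm p.1.2 2 volume)
      (fun p => ConvSum.opComm p.1.1 hM p.2.2.1 (hcs p.2.2.2)) fun h => by
        obtain ⟨C, N, hC, hle⟩ := exists_sobolevNorm_opComm_le hθ0 hθγ hγ₂.le hQ ha_growth hb i j
          (unifHolder_of_fieldHolderNorm_one_add (R := R) hγ0 hγ₂) h
        exact ⟨C, N, hC, fun p r hr k hk F hF => hle p.1.1 p.2.1 r hr k hk p.1.2 p.2.2.1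
          (hcs p.2.2.2) p.2.2.2 F hF⟩
    refine ⟨C, fun V hV u hu huQ => ?_⟩
    obtain ⟨h1, h2⟩ := hC ⟨(V, u), hV, hu, huQ⟩
    refine ⟨h1, (hβθ _).trans (h2.trans (mul_le_mul' le_rfl ?_))⟩
    -- The bound already holds with `‖u‖` alone; the remaining terms are nonnegative.
    rw [add_assoc]
    exact le_self_add
  · intro R
    let ι := {p : (Fin d → 𝓢(Rd d, ℝ)) × (Rd d → ℂ) //
      fieldHolderNorm (2 + γ) p.1 ≤ R ∧ ContDiff ℝ ∞ p.2 ∧ tsupport p.2 ⊆ Q}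
    obtain ⟨C, hC⟩ := exists_sobolevNorm_le_of_mem_kernelClass (ι := ι) (by linarith) hαθ hJ
      (G := fun p k => opComm (fieldOp p.1.1) (opComm (fieldOp p.1.1) (kernelOp a b k i j)) p.1.2)
      (A := fun p => eLpNorm p.1.2 2 volume)
      (fun p => ConvSum.opComm p.1.1 (fun u hu hc => ConvSum.opComm p.1.1 hM hu hc)
        p.2.2.1 (hcs p.2.2.2)) fun h => by
        obtain ⟨C, N, hC, hle⟩ := exists_sobolevNorm_opComm_opComm_le hθ0 hθγ hγ₂.le hQ ha_growth
          hb i j (fun l => (unifHolder_of_fieldHolderNorm_two_add (R := R) hγ0 hγ₂ l).1)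
          (fun l => (unifHolder_of_fieldHolderNorm_two_add (R := R) hγ0 hγ₂ l).2) h
        exact ⟨C, N, hC, fun p r hr k hk F hF => hle p.1.1 p.2.1 r hr k hk p.1.2 p.2.2.1
          (hcs p.2.2.2) p.2.2.2 F hF⟩
    refine ⟨C, fun V hV u hu huQ => ?_⟩
    obtain ⟨h1, h2⟩ := hC ⟨(V, u), hV, hu, huQ⟩
    refine ⟨h1, (hβθ _).trans (h2.trans (mul_le_mul' le_rfl ?_))⟩
    rw [add_assoc]
    exact le_self_add
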